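/- Fix constants $C_d>0$ (Kelvin–Voigt damping), $\mu\ge 0$ (viscous damping), $\gamma>0$, $\tau>0$ and $\kappa\ge 0$. Let $V=H^2(0,1)\cap H^1_0(0,1)$, let $w_0\in V$, $v_0\in L^2(0,1)$, $z_0=(w_0,v_0)$. For a measurable set $\omega\subseteq[0,1]$ and a control $u\in L^2(0,\tau)$ let $w\in H^1(0,\tau;V)$ be the weak solution of the simply supported beam equation $$\partial_{tt}w+\partial_{xx}(\partial_{xx}w+C_d\,\partial_{xxt}w)+\mu\,\partial_t w=\chi_\omega(x)u(t),\qquad w(\cdot,0)=w_0,\quad \partial_t w(\cdot,0)=v_0,$$ $$w=\partial_{xx}w+C_d\,\partial_{xxt}w=0\quad\text{at }x=0,1,$$ that is, $w(0)=w_0$ and, for every $\varphi\in V$, the function $t\mapsto\int_0^1\partial_t w(t)\varphi\,dx$ is absolutely continuous on $[0,\tau]$ with initial value $\int_0^1v_0\varphi\,dx$ and, for a.e. $t$, $$\frac{d}{dt}\int_0^1\partial_t w\,\varphi\,dx+\int_0^1(\partial_{xx}w+C_d\,\partial_{xxt}w)\,\partial_{xx}\varphi+\mu\,\partial_tw\,\varphi\,dx=\int_0^1\chi_\omega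 u(t)\varphi\,dx .$$ Put $$J_1(\omega)=\min_{u\in L^2(0,\tau)}\int_0^\tau\Big(\int_0^1\kappa(\partial_{xx}w)^2+w^2+(\partial_tw)^2\,dx+\gamma\,u(t)^2\Big)dt .$$ (For $\kappa=1$ the inner integral is the squared norm of $(w,\partial_tw)$ in the state space $V\times L^2(0,1)$; for $\kappa=0$ it is the integral of the squared Euclidean norm of $(w,\partial_tw)$.) For every open set $\omega\subseteq[0,1]$ there are an optimal control $\bar u=\bar u^{\omega,z_0}\in L^2(0,\tau)$, the corresponding optimal deflection $\bar w=\bar w^{\omega,z_0}$, and an adjoint state $\bar p=\bar p^{\omega,z_0}\in L^2(0,\tau;V)$, which satisfies $$\int_0^\tau\!\!\int_0^1\partial_{tt}\psi\,\bar p+(\partial_{xx}\psi+C_d\,\partial_{xxt}\psi)\,\partial_{xx}\bar p+\mu\,\partial_t\psi\,\bar p\,dx\,dt=\int_0^\tau\!\!\int_0^1 2\big(\kappa\,\partial_{xx}\bar w\,\partial_{xx}\psi+\bar w\,\psi+\partial_t\bar w\,\partial_t\psi\big)dx\,dt$$ for all $\psi\in H^1(0,\tau;V)\cap H^2(0,\tau;L^2(0,1))$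 with $\psi(\cdot,0)=\partial_t\psi(\cdot,0)=0$. Moreover, for all such $\bar u,\bar w,\bar p$ and every $\eta_0\in(0,1)\setminus\partial\omega$, the function $s\mapsto\bar u(s)\,\bar p(\eta_0,s)$ is integrable on $(0,\tau)$, where $\bar p(\cdot,s)$ is the continuous representative, and the topological derivative $$\mathcal TJ_1(\omega)(\eta_0)=\begin{cases}\displaystyle\lim_{\varepsilon\searrow0}\frac{J_1(\omega\setminus\bar B_\varepsilon(\eta_0))-J_1(\omega)}{|\bar B_\varepsilon(\eta_0)|}&\text{if }\eta_0\in\omega,\\[2mm]\displaystyle\lim_{\varepsilon\searrow0}\frac{J_1(\omega\cup B_\varepsilon(\eta_0))-J_1(\omega)}{|B_\varepsilon(\eta_0)|}&\text{if }\eta_0\in(0,1)\setminus\overline\omega\end{cases}$$ exists and $$\mathcal TJ_1(\omega)(\eta_0)=\begin{cases}\displaystyle-\int_0^\tau\bar u(s)\,\bar p(\eta_0,s)\,ds&\text{if }\eta_0\in\omega,\\[2mm]\displaystyle\int_0^\tau\bar u(s)\,\bar p(\eta_0,s)\,ds&\text{if }\eta_0\in(0,1)\setminus\overline\omega.\end{cases}$$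 -/

import Mathlib

open MeasureTheory Set Filter Topology

noncomputable section

namespace Beam

/-- Lebesgue measure on the spatial domain `(0,1)`. -/
abbrev spaceMeasure : Measure ℝ := volume.restrict (Ioo (0 : ℝ) 1)

/-- Lebesgue measure on the time interval `(0,τ)`. -/
abbrev timeMeasure (τ : ℝ) : Measure ℝ := volume.restrict (Ioo (0 : ℝ) τ)

/-- `g` is the weak derivative of `f` on `(0,1)`. -/
def IsWeakDeriv (f g : ℝ → ℝ) : Prop :=
  ∀ φ : ℝ → ℝ, ContDiff ℝ (⊤ : ℕ∞) φ → HasCompactSupport φ → tsupport φ ⊆ Ioo (0 : ℝ) 1 →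
    ∫ x in Ioo (0 : ℝ) 1, f x * deriv φ x = -∫ x in Ioo (0 : ℝ) 1, g x * φ x

/-- `f` belongs to `H²(0,1) ∩ H¹₀(0,1)`, and `f₂` is its second weak derivative; `f` is the
continuous representative on `[0,1]`, so that its boundary values are its traces. -/
structure IsV (f f₂ : ℝ → ℝ) : Prop where
  memLp : MemLp f 2 spaceMeasure
  memLp₂ : MemLp f₂ 2 spaceMeasure
  weakDeriv : ∃ f₁ : ℝ → ℝ, MemLp f₁ 2 spaceMeasure ∧ IsWeakDeriv f f₁ ∧ IsWeakDeriv f₁ f₂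
  continuousOn : ContinuousOn f (Icc 0 1)
  left : f 0 = 0
  right : f 1 = 0

/-- A field in `L²((0,τ) × (0,1))`; the first argument is time. -/
def IsL2L2 (τ : ℝ) (f : ℝ → ℝ → ℝ) : Prop :=
  MemLp (Function.uncurry f) 2 ((timeMeasure τ).prod spaceMeasure)

/-- `f` belongs to `L²(0,τ; H²(0,1) ∩ H¹₀(0,1))`, with second spatial derivative `fxx`. -/
structure IsL2V (τ : ℝ) (f fxx : ℝ → ℝ → ℝ) : Prop where
  memLp : IsL2L2 τ f
  memLp_xx : IsL2L2 τ fxx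
  section_mem : ∀ᵐ t ∂(timeMeasure τ), IsV (f t) (fxx t)

/-- A displacement field `w`, the velocity field `v`, and their second spatial derivatives,
all with time as the first argument. -/
structure Motion where
  w : ℝ → ℝ → ℝ
  wxx : ℝ → ℝ → ℝ
  v : ℝ → ℝ → ℝ
  vxx : ℝ → ℝ → ℝ

/-- The motion `z` is the weak solution on `(0,τ)` of
`w_tt + (w_xx + C_d w_xxt)_xx + μ w_t = χ_ω(x) u(t)`, with `w = w_xx + C_d w_xxt = 0` at
`x = 0, 1`, `w(0) = w₀` and `w_t(0) = v₀`: `w ∈ H¹(0,τ;V)` with `w(0) = w₀` and `w_t = v`, where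
`V = H² ∩ H¹₀`, and for every `φ ∈ V` the function `t ↦ ∫ v(t) φ` is absolutely continuous, with
initial value `∫ v₀ φ` and derivative `∫ χ_ω u φ - ∫ (w_xx + C_d v_xx) φ_xx - μ ∫ v φ`. -/
structure IsWeakSolution (Cd μ τ : ℝ) (w₀ v₀ : ℝ → ℝ) (ω : Set ℝ) (u : ℝ → ℝ) (z : Motion) :
    Prop where
  disp_mem : IsL2V τ z.w z.wxx
  vel_mem : IsL2V τ z.v z.vxx
  disp_eq : ∀ t ∈ Icc 0 τ, ∀ x ∈ Icc (0 : ℝ) 1, z.w t x = w₀ x + ∫ s in (0 : ℝ)..t, z.v s x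
  weak_eq : ∀ φ φxx : ℝ → ℝ, IsV φ φxx → ∀ᵐ t ∂(timeMeasure τ),
    ∫ x in Ioo (0 : ℝ) 1, z.v t x * φ x =
      (∫ x in Ioo (0 : ℝ) 1, v₀ x * φ x) +
        ∫ s in (0 : ℝ)..t,
          ((∫ x in Ioo (0 : ℝ) 1, ω.indicator (fun _ => u s) x * φ x)
            - (∫ x in Ioo (0 : ℝ) 1, (z.wxx s x + Cd * z.vxx s x) * φxx x)
            - μ * ∫ x in Ioo (0 : ℝ) 1, z.v s x * φ x)

/-- The quadratic cost `∫₀^τ (∫₀¹ κ w_xx² + w² + v² dx + γ u²) dt`. For `κ = 1` the inner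
integral is the squared norm of `(w,v)` in the state space `(H² ∩ H¹₀) × L²`; for `κ = 0` it is
the integral of the squared Euclidean norm of `(w(x),v(x))`. -/
def cost (κ γ τ : ℝ) (u : ℝ → ℝ) (z : Motion) : ℝ :=
  ∫ t in Ioo (0 : ℝ) τ,
    ((∫ x in Ioo (0 : ℝ) 1, (κ * z.wxx t x ^ 2 + z.w t x ^ 2 + z.v t x ^ 2)) + γ * u t ^ 2)

/-- All the costs that controls in `L²(0,τ)` achieve with the actuator `ω`. -/
def costSet (Cd μ γ τ κ : ℝ) (w₀ v₀ : ℝ → ℝ) (ω : Set ℝ) : Set ℝ :=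
  {c | ∃ (u : ℝ → ℝ) (z : Motion), MemLp u 2 (timeMeasure τ) ∧
    IsWeakSolution Cd μ τ w₀ v₀ ω u z ∧ c = cost κ γ τ u z}

/-- The optimal cost `J₁(ω)` for the initial condition `(w₀,v₀)`. -/
def J₁ (Cd μ γ τ κ : ℝ) (w₀ v₀ : ℝ → ℝ) (ω : Set ℝ) : ℝ :=
  sInf (costSet Cd μ γ τ κ w₀ v₀ ω)

/-- `u` is an optimal control for the actuator `ω`, and `z` is the optimal motion. -/
structure IsOptimal (Cd μ γ τ κ : ℝ) (w₀ v₀ : ℝ → ℝ) (ω : Set ℝ) (u : ℝ → ℝ) (z : Motion) :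
    Prop where
  control_mem : MemLp u 2 (timeMeasure τ)
  solution : IsWeakSolution Cd μ τ w₀ v₀ ω u z
  least : IsLeast (costSet Cd μ γ τ κ w₀ v₀ ω) (cost κ γ τ u z)

/-- Test functions for the adjoint equation: `ψ ∈ H¹(0,τ;V) ∩ H²(0,τ;L²)`, where
`V = H² ∩ H¹₀`, with `ψ(0) = ψ_t(0) = 0`. -/
structure IsTest (τ : ℝ) (ψ ψxx ψt ψtxx ψtt : ℝ → ℝ → ℝ) : Prop where
  mem : IsL2V τ ψ ψxx
  mem_t : IsL2V τ ψt ψtxx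
  mem_tt : IsL2L2 τ ψtt
  eq_t : ∀ t ∈ Icc 0 τ, ∀ x ∈ Icc (0 : ℝ) 1, ψ t x = ∫ s in (0 : ℝ)..t, ψt s x
  eq_tt : ∀ᵐ t ∂(timeMeasure τ), ∀ᵐ x ∂spaceMeasure, ψt t x = ∫ s in (0 : ℝ)..t, ψtt s x

/-- `p ∈ L²(0,τ;V)` is the adjoint state that belongs to the motion `z`. The terminal conditions
at `t = τ` are contained in the equation, because the test functions are free there. -/
structure IsAdjoint (Cd μ τ κ : ℝ) (z : Motion) (p pxx : ℝ → ℝ → ℝ) : Prop where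
  mem : IsL2V τ p pxx
  eq : ∀ ψ ψxx ψt ψtxx ψtt : ℝ → ℝ → ℝ, IsTest τ ψ ψxx ψt ψtxx ψtt →
    ∫ t in Ioo (0 : ℝ) τ, ∫ x in Ioo (0 : ℝ) 1,
        (ψtt t x * p t x + (ψxx t x + Cd * ψtxx t x) * pxx t x + μ * ψt t x * p t x) =
      ∫ t in Ioo (0 : ℝ) τ, ∫ x in Ioo (0 : ℝ) 1,
        2 * (κ * z.wxx t x * ψxx t x + z.w t x * ψ t x + z.v t x * ψt t x)

/-- The shape functional `J` has the topological derivative `d` at `ω` in the point `η`. -/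
def HasTopologicalDerivAt (J : Set ℝ → ℝ) (ω : Set ℝ) (η d : ℝ) : Prop :=
  (η ∈ ω → Tendsto (fun ε : ℝ =>
      (J (ω \ Metric.closedBall η ε) - J ω) / volume.real (Metric.closedBall η ε))
    (𝓝[>] 0) (𝓝 d)) ∧
  (η ∉ closure ω → Tendsto (fun ε : ℝ =>
      (J (ω ∪ Metric.ball η ε) - J ω) / volume.real (Metric.ball η ε))
    (𝓝[>] 0) (𝓝 d))

end Beam

end

/-! Everything is expressed through second space derivatives. Let `G` be Green's operator, the
inverse of ∂xx with zero boundary values, and `I` integration in time from 0. Since V = H² ∩ H¹₀ is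
the image of L² under `G` (`isV_iff`), a motion is determined by ζ = v_xx: v = Gζ, w_xx = w₀_xx +
Iζ, w = G w_xx. Testing the weak equation with φ = GΦ for all Φ turns it into one equation in
L²((0,τ) × (0,1)), namely Mζ = G v₀ + I(G(χ_ω u) - w₀_xx) with M = G² + C_d I + I² + μ I G²
(`weak_eq_iff`).

Solvability rests on energy estimates. I + I* is integration over all of (0,τ), so ⟪Ix, x⟫ ≥ 0.
Testing M with Ix gives uniqueness, and testing M* with I*x bounds I*x by M*x. Douglas factorization
(`exists_factor`) converts such bounds into operators: it yields the solution operator Z with MZ =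
I, the lift of the initial velocity, the adjoint state and the optimal control.

Hence J₁(ω) is the minimum of ‖y₀ + Lu‖² + γ‖u‖², where y₀ does not depend on ω and L is linear in
χ_ω (`costSet_eq`). If L changes by D, the minimum changes by 2⟪y₀ + Lū, Dū⟫ + O(‖D‖²)
(`abs_lq_value_sub_le`), and the adjoint state (`adjoint_duality`) rewrites the linear term as
±⟪p_xx, G(χ_B ū)⟫, where B is the ball removed or added.

The actuator acts only through Gχ_B = ∫_B green(·,y) dy. Green's function is bounded and Lipschitz,
so Gχ_B = |B| green(η₀,·) + O(ε|B|) uniformly (`norm_tensorOp_potential_le`). Thus ‖D‖ = O(|B|), and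
since p(η₀,s) = ∫ green(η₀,y) p_xx(y,s) dy, the linear term is ±|B| ∫ ū p(η₀,·) ds + O(ε|B|).
Division by |B| = 2ε gives the limit. -/

namespace Beam

open scoped InnerProductSpace ENNReal NNReal

/-! ### Douglas factorization and the abstract damped evolution equation -/

section Abstract

/-- Douglas factorization: an operator dominated by `N` factors through `N`. -/
theorem exists_factor {X H W : Type*} [AddCommGroup X] [Module ℝ X]
    [NormedAddCommGroup H] [InnerProductSpace ℝ H] [CompleteSpace H]
    [NormedAddCommGroup W] [NormedSpace ℝ W] [CompleteSpace W]
    (N : X →ₗ[ℝ] H) (T : X →ₗ[ℝ] W) (C : ℝ) (h : ∀ x, ‖T x‖ ≤ C * ‖N x‖) :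
    ∃ Q : H →L[ℝ] W, ∀ x, Q (N x) = T x := by
  let S : Submodule ℝ H := N.range.topologicalClosure
  have hS : IsClosed (S : Set H) := Submodule.isClosed_topologicalClosure _
  have : CompleteSpace S := hS.completeSpace_coe
  have hmem : ∀ x, N x ∈ S := fun x => Submodule.le_topologicalClosure _ ⟨x, rfl⟩
  let e : X →ₗ[ℝ] S := N.codRestrict S hmem
  have he : DenseRange e := by
    intro y
    rw [closure_subtype]
    have hy : (y : H) ∈ closure (N.range : Set H) := by
      have := y.2
      rwa [← SetLike.mem_coe, Submodule.topologicalClosure_coe] at this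
    convert hy using 1
    congr 1
    ext z
    simp only [mem_image, mem_range, SetLike.mem_coe, LinearMap.mem_range]
    constructor
    · rintro ⟨_, ⟨x, rfl⟩, rfl⟩
      exact ⟨x, rfl⟩
    · rintro ⟨x, rfl⟩
      exact ⟨_, ⟨x, rfl⟩, rfl⟩
  -- On the range of `N` the bound makes `T` a well-defined bounded function of `N x`. `Q` extends
  -- it to the closure and vanishes on the orthogonal complement.
  refine ⟨(T.extendOfNorm e).comp S.orthogonalProjectionOnto, fun x => ?_⟩
  have h1 : S.orthogonalProjectionOnto (N x) = e x :=
    Submodule.orthogonalProjectionOnto_mem_subspace_eq_self (e x)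
  rw [ContinuousLinearMap.comp_apply, h1]
  exact LinearMap.extendOfNorm_eq he ⟨C, h⟩ x

variable {H : Type*} [NormedAddCommGroup H] [InnerProductSpace ℝ H] [CompleteSpace H]

/-- An abstract pair of a symmetric operator `G` and a Volterra integration operator `I`. -/
structure IsVolterraPair (τ : ℝ) (G I : H →L[ℝ] H) : Prop where
  pos : 0 < τ
  symm : ∀ x y, ⟪G x, y⟫_ℝ = ⟪x, G y⟫_ℝ
  comm : ∀ x, G (I x) = I (G x)
  inj : ∀ x, I x = 0 → x = 0
  sq : ∀ x, (I + I.adjoint) ((I + I.adjoint) x) = τ • (I + I.adjoint) x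

/-- The operator of the twice integrated damped evolution equation. -/
def evolutionOp (Cd μ : ℝ) (G I : H →L[ℝ] H) : H →L[ℝ] H :=
  G ∘L G + Cd • I + I ∘L I + μ • (I ∘L G ∘L G)

theorem evolutionOp_apply (Cd μ : ℝ) (G I : H →L[ℝ] H) (x : H) :
    evolutionOp Cd μ G I x = G (G x) + Cd • I x + I (I x) + μ • I (G (G x)) := rfl

namespace IsVolterraPair

variable {τ Cd μ : ℝ} {G I : H →L[ℝ] H} (h : IsVolterraPair τ G I)
include h

/-- For time integration, `I + I.adjoint` is the integral over the whole interval, and this is the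
integrated form of (∫f)² = 2 ∫ f(t) ∫₀ᵗ f ds dt. It is the source of all positivity below. -/
theorem norm_sq_eq (x : H) : ‖(I + I.adjoint) x‖ ^ 2 = 2 * τ * ⟪I x, x⟫_ℝ := by
  have h1 : ⟪(I + I.adjoint) x, (I + I.adjoint) x⟫_ℝ = ⟪(I + I.adjoint) ((I + I.adjoint) x), x⟫_ℝ := by
    simp only [add_apply, inner_add_left, inner_add_right,
      ContinuousLinearMap.adjoint_inner_left, ContinuousLinearMap.adjoint_inner_right, map_add]
    ring
  rw [← real_inner_self_eq_norm_sq, h1, h.sq, inner_smul_left, add_apply,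
    inner_add_left, ContinuousLinearMap.adjoint_inner_left, real_inner_comm (I x) x]
  simp
  ring

theorem inner_nonneg (x : H) : 0 ≤ ⟪I x, x⟫_ℝ := by
  have := h.norm_sq_eq x
  have h2 : 0 ≤ 2 * τ * ⟪I x, x⟫_ℝ := this ▸ sq_nonneg _
  have := h.pos
  by_contra hc
  push Not at hc
  nlinarith

theorem adjoint_injective (x : H) (hx : I.adjoint x = 0) : x = 0 := by
  have h1 : ⟪I x, x⟫_ℝ = 0 := by
    rw [← ContinuousLinearMap.adjoint_inner_right, hx, inner_zero_right]
  have h2 := h.norm_sq_eq x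
  rw [h1, mul_zero, sq_eq_zero_iff, norm_eq_zero, add_apply, hx, add_zero] at h2
  exact h.inj x h2

/-- The orthogonal complement of the range is the kernel of the adjoint. If the adjoint kills `x`,
then ⟪Ix, x⟫ = 0, so the sum with the adjoint kills `x` too, and then so does `I`. -/
theorem dense_range : DenseRange I := by
  have : (I.range)ᗮ = ⊥ := by
    rw [ContinuousLinearMap.orthogonal_range, LinearMap.ker_eq_bot']
    exact fun x hx => h.adjoint_injective x hx
  have := (Submodule.topologicalClosure_eq_top_iff).2 this
  exact (Submodule.dense_iff_topologicalClosure_eq_top).2 this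

/-- Testing with `I x` makes every term nonnegative, and the damping contributes Cd ‖I x‖², which
must then vanish. -/
theorem injective (hCd : 0 < Cd) (hμ : 0 ≤ μ) (x : H) (hx : evolutionOp Cd μ G I x = 0) :
    x = 0 := by
  apply h.inj
  have h0 : ⟪evolutionOp Cd μ G I x, I x⟫_ℝ = 0 := by rw [hx, inner_zero_left]
  rw [evolutionOp_apply] at h0
  simp only [inner_add_left, real_inner_smul_left] at h0
  have e1 : ⟪G (G x), I x⟫_ℝ = ⟪I (G x), G x⟫_ℝ := by rw [h.symm, h.comm, real_inner_comm]
  have e2 : ⟪I (G (G x)), I x⟫_ℝ = ⟪G (I x), G (I x)⟫_ℝ := by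
    rw [← h.comm, ← h.comm, h.symm]
  rw [e1, e2] at h0
  have p1 := h.inner_nonneg (G x)
  have p2 := h.inner_nonneg (I x)
  have p3 : 0 ≤ ⟪G (I x), G (I x)⟫_ℝ := real_inner_self_nonneg
  have p4 : 0 ≤ ⟪I x, I x⟫_ℝ := real_inner_self_nonneg
  have p5 := mul_nonneg hμ p3
  have p6 : ⟪I x, I x⟫_ℝ = 0 := by
    have := mul_nonneg hCd.le p4
    have : Cd * ⟪I x, I x⟫_ℝ = 0 := by linarith
    rcases mul_eq_zero.1 this with h' | h'
    · exact absurd h' hCd.ne'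
    · exact h'
  exact inner_self_eq_zero.1 p6

/-- The multiplier `I.adjoint x` plays the role of `I x` for the transposed problem. The term G²
yields ⟪I(Gx), Gx⟫, which controls the total time integral of `G x` and is what admits an initial
velocity that is merely L². The terms from I² and μ are nonnegative and are dropped. -/
theorem adjoint_estimate (hμ : 0 ≤ μ) (x : H) :
    Cd * ‖I.adjoint x‖ ^ 2 + ‖(I + I.adjoint) (G x)‖ ^ 2 / (2 * τ) ≤
      ⟪(evolutionOp Cd μ G I).adjoint x, I.adjoint x⟫_ℝ := by
  rw [ContinuousLinearMap.adjoint_inner_left, evolutionOp_apply]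
  have hc : ∀ y, G (I.adjoint y) = I.adjoint (G y) := by
    intro y
    refine ext_inner_left ℝ fun z => ?_
    rw [← h.symm, ContinuousLinearMap.adjoint_inner_right, ContinuousLinearMap.adjoint_inner_right,
      ← h.comm, h.symm]
  simp only [inner_add_right, real_inner_smul_right]
  have e1 : ⟪x, G (G (I.adjoint x))⟫_ℝ = ‖(I + I.adjoint) (G x)‖ ^ 2 / (2 * τ) := by
    rw [← h.symm, hc, ContinuousLinearMap.adjoint_inner_right, h.norm_sq_eq]
    field_simp [h.pos.ne']
  have e2 : ⟪x, I (G (G (I.adjoint x)))⟫_ℝ = ‖G (I.adjoint x)‖ ^ 2 := by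
    rw [← ContinuousLinearMap.adjoint_inner_left, ← h.symm, real_inner_self_eq_norm_sq]
  have e3 : 0 ≤ ⟪x, I (I (I.adjoint x))⟫_ℝ := by
    rw [← ContinuousLinearMap.adjoint_inner_left, real_inner_comm]; exact h.inner_nonneg _
  have e4 : ⟪x, I (I.adjoint x)⟫_ℝ = ‖I.adjoint x‖ ^ 2 := by
    rw [← ContinuousLinearMap.adjoint_inner_left, real_inner_self_eq_norm_sq]
  rw [e1, e2, e4]
  have := mul_nonneg hμ (sq_nonneg ‖G (I.adjoint x)‖)
  linarith

theorem norm_adjoint_le (hCd : 0 < Cd) (hμ : 0 ≤ μ) (x : H) :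
    ‖I.adjoint x‖ ≤ Cd⁻¹ * ‖(evolutionOp Cd μ G I).adjoint x‖ := by
  have h1 := h.adjoint_estimate (Cd := Cd) hμ x
  have h2 := real_inner_le_norm ((evolutionOp Cd μ G I).adjoint x) (I.adjoint x)
  have h3 : 0 ≤ ‖(I + I.adjoint) (G x)‖ ^ 2 / (2 * τ) := by have := h.pos; positivity
  have h4 : Cd * ‖I.adjoint x‖ * ‖I.adjoint x‖ ≤
      ‖(evolutionOp Cd μ G I).adjoint x‖ * ‖I.adjoint x‖ := by nlinarith
  rw [inv_mul_eq_div, le_div_iff₀ hCd]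
  rcases (norm_nonneg (I.adjoint x)).eq_or_lt with h0 | h0
  · rw [← h0, zero_mul]; positivity
  · have := le_of_mul_le_mul_right h4 h0
    linarith

theorem norm_sum_green_le (hCd : 0 < Cd) (hμ : 0 ≤ μ) (x : H) :
    ‖(I + I.adjoint) (G x)‖ ≤ √(2 * τ * Cd⁻¹) * ‖(evolutionOp Cd μ G I).adjoint x‖ := by
  have hτ := h.pos
  have h1 := h.adjoint_estimate (Cd := Cd) hμ x
  have h2 := real_inner_le_norm ((evolutionOp Cd μ G I).adjoint x) (I.adjoint x)
  have h3 := mul_le_mul_of_nonneg_left (h.norm_adjoint_le hCd hμ x)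
    (norm_nonneg ((evolutionOp Cd μ G I).adjoint x))
  have h4 : 0 ≤ Cd * ‖I.adjoint x‖ ^ 2 := by positivity
  have h5 : ‖(I + I.adjoint) (G x)‖ ^ 2 / (2 * τ) ≤
      Cd⁻¹ * ‖(evolutionOp Cd μ G I).adjoint x‖ ^ 2 := by nlinarith
  rw [div_le_iff₀ (by positivity)] at h5
  apply le_of_sq_le_sq _ (by positivity)
  rw [mul_pow, Real.sq_sqrt (by positivity)]
  linarith

/-- The solution operator of the twice integrated evolution equation. -/
theorem exists_solutionOp (hCd : 0 < Cd) (hμ : 0 ≤ μ) :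
    ∃ Z : H →L[ℝ] H, ∀ f, evolutionOp Cd μ G I (Z f) = I f := by
  obtain ⟨Q, hQ⟩ := exists_factor (evolutionOp Cd μ G I).adjoint.toLinearMap I.adjoint.toLinearMap
    Cd⁻¹ (h.norm_adjoint_le hCd hμ)
  -- Transposing Q M* = I* gives M Q* = I.
  refine ⟨Q.adjoint, fun f => ext_inner_left ℝ fun x => ?_⟩
  rw [← ContinuousLinearMap.adjoint_inner_left, ContinuousLinearMap.adjoint_inner_right,
    ← ContinuousLinearMap.adjoint_inner_left]
  exact congrArg (⟪·, f⟫_ℝ) (hQ x)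

/-- The hypothesis on `a` expresses that it is constant in time. Factoring (I + I*)G = Q M* and
transposing gives M Q* a = G(I + I*)a = τ G a. -/
theorem exists_initial (hCd : 0 < Cd) (hμ : 0 ≤ μ) (a : H) (ha : (I + I.adjoint) a = τ • a) :
    ∃ ζ : H, evolutionOp Cd μ G I ζ = G a := by
  have hτ := h.pos
  obtain ⟨Q, hQ⟩ := exists_factor (evolutionOp Cd μ G I).adjoint.toLinearMap
    ((I + I.adjoint) ∘L G).toLinearMap _ (h.norm_sum_green_le hCd hμ)
  refine ⟨τ⁻¹ • Q.adjoint a, ext_inner_left ℝ fun x => ?_⟩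
  have h1 : Q ((evolutionOp Cd μ G I).adjoint x) = (I + I.adjoint) (G x) := hQ x
  rw [← ContinuousLinearMap.adjoint_inner_left, real_inner_smul_right,
    ContinuousLinearMap.adjoint_inner_right, h1, add_apply, inner_add_left,
    ContinuousLinearMap.adjoint_inner_left, ← ContinuousLinearMap.adjoint_inner_right,
    ← inner_add_right, add_comm, ← add_apply, ha, real_inner_smul_right,
    h.symm]
  field_simp

/-- Here φ stands for ψ_txx and ξ for ψ_tt, and the constraint says that both describe the same ψ_t.
It turns ⟪Gξ, φ⟫ into ⟪ξ, Iξ⟫ ≥ 0, so testing with φ leaves the damping term. -/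
theorem norm_le_testOp (hCd : 0 < Cd) (hμ : 0 ≤ μ) (φ ξ : H) (hφ : G φ = I ξ) :
    ‖φ‖ ≤ Cd⁻¹ * ‖G ξ + I φ + Cd • φ + μ • G (G φ)‖ := by
  set n := G ξ + I φ + Cd • φ + μ • G (G φ) with hn
  have h1 : Cd * ‖φ‖ ^ 2 ≤ ⟪n, φ⟫_ℝ := by
    rw [hn]
    simp only [inner_add_left, real_inner_smul_left]
    rw [h.symm ξ φ, h.symm (G φ) φ, hφ, real_inner_comm, real_inner_self_eq_norm_sq,
      real_inner_self_eq_norm_sq]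
    have := mul_nonneg hμ (sq_nonneg ‖I ξ‖)
    linarith [h.inner_nonneg ξ, h.inner_nonneg φ]
  have h2 := real_inner_le_norm n φ
  rw [inv_mul_eq_div, le_div_iff₀ hCd]
  rcases (norm_nonneg φ).eq_or_lt with h0 | h0
  · rw [← h0, zero_mul]; positivity
  · refine le_of_mul_le_mul_right ?_ h0
    nlinarith

theorem exists_adjoint_state (hCd : 0 < Cd) (hμ : 0 ≤ μ) (r : H) :
    ∃ q : H, ∀ φ ξ : H, G φ = I ξ →
      ⟪q, G ξ + I φ + Cd • φ + μ • G (G φ)⟫_ℝ = ⟪r, φ⟫_ℝ := by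
  let S : Submodule ℝ (H × H) :=
    LinearMap.eqLocus (G ∘L ContinuousLinearMap.fst ℝ H H).toLinearMap
      (I ∘L ContinuousLinearMap.snd ℝ H H).toLinearMap
  let N : H × H →L[ℝ] H := G ∘L ContinuousLinearMap.snd ℝ H H +
    (I + Cd • ContinuousLinearMap.id ℝ H + μ • (G ∘L G)) ∘L ContinuousLinearMap.fst ℝ H H
  have hN : ∀ φ ξ, N (φ, ξ) = G ξ + I φ + Cd • φ + μ • G (G φ) := by
    intro φ ξ
    simp [N, add_assoc]
  -- On the admissible pairs `S` the test operator `N` dominates φ, so φ = Q N(φ, ξ) there, and the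
  -- adjoint state is Q* r.
  obtain ⟨Q, hQ⟩ := exists_factor (N.toLinearMap ∘ₗ S.subtype)
    ((ContinuousLinearMap.fst ℝ H H).toLinearMap ∘ₗ S.subtype) Cd⁻¹ (by
      rintro ⟨⟨φ, ξ⟩, hx⟩
      have := h.norm_le_testOp hCd hμ φ ξ hx
      rw [← hN] at this
      exact this)
  refine ⟨Q.adjoint r, fun φ ξ hφ => ?_⟩
  rw [ContinuousLinearMap.adjoint_inner_left, ← hN]
  exact congrArg (⟪r, ·⟫_ℝ) (hQ ⟨(φ, ξ), hφ⟩)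

/-- An adjoint state represents the derivative of the linear functional `r` of the state. -/
theorem adjoint_duality (hCd : 0 < Cd) (hμ : 0 ≤ μ) {Z : H →L[ℝ] H}
    (hZ : ∀ f, evolutionOp Cd μ G I (Z f) = I f) {q r : H}
    (hq : ∀ a, ⟪q, evolutionOp Cd μ G I a⟫_ℝ = ⟪r, I a⟫_ℝ) (f : H) :
    ⟪q, f⟫_ℝ = ⟪r, Z f⟫_ℝ := by
  -- M commutes with `I` and is injective, so its solution operator commutes with `I`. Therefore the
  -- claim holds on the range of `I`, which is dense.
  have hcomm : ∀ x, Z (I x) = I (Z x) := by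
    intro x
    rw [← sub_eq_zero]
    apply h.injective hCd hμ
    have : evolutionOp Cd μ G I (I (Z x)) = I (evolutionOp Cd μ G I (Z x)) := by
      simp only [evolutionOp_apply, map_add, map_smul, h.comm]
    rw [map_sub, hZ, this, hZ, sub_self]
  refine congrFun (h.dense_range.equalizer (g := fun f => ⟪q, f⟫_ℝ) (h := fun f => ⟪r, Z f⟫_ℝ)
    (by fun_prop) (by fun_prop) (funext fun x => ?_)) f
  simp only [Function.comp_apply]
  rw [hcomm, ← hq, hZ]

end IsVolterraPair

end Abstract

/-! ### Linear quadratic control and the sensitivity of its optimal value -/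

section LinearQuadratic

variable {U Y : Type*} [NormedAddCommGroup U] [InnerProductSpace ℝ U] [CompleteSpace U]
  [NormedAddCommGroup Y] [InnerProductSpace ℝ Y]

/-- The reduced cost of a linear quadratic control problem. -/
def lqCost (γ : ℝ) (y₀ : Y) (L : U →L[ℝ] Y) (u : U) : ℝ := ‖y₀ + L u‖ ^ 2 + γ * ‖u‖ ^ 2

theorem lqCost_add (γ : ℝ) (y₀ : Y) (L : U →L[ℝ] Y) (u k : U) :
    lqCost γ y₀ L (u + k) = lqCost γ y₀ L u +
      2 * (⟪y₀ + L u, L k⟫_ℝ + γ * ⟪u, k⟫_ℝ) + (‖L k‖ ^ 2 + γ * ‖k‖ ^ 2) := by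
  rw [lqCost, lqCost, map_add, ← add_assoc, norm_add_sq_real, norm_add_sq_real u k]
  ring

theorem exists_lq_minimizer [CompleteSpace Y] {γ : ℝ} (hγ : 0 < γ) (y₀ : Y) (L : U →L[ℝ] Y) :
    ∃ u, ∀ k, lqCost γ y₀ L u ≤ lqCost γ y₀ L k := by
  -- A is the Hessian, up to the factor 2, and ‖Ax‖ ≥ γ‖x‖. Factorization gives a left inverse Q,
  -- and because A is symmetric, -Q* L* y₀ solves the normal equation.
  let A : U →L[ℝ] U := L.adjoint ∘L L + γ • ContinuousLinearMap.id ℝ U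
  have hA : ∀ x y, ⟪A x, y⟫_ℝ = ⟪L x, L y⟫_ℝ + γ * ⟪x, y⟫_ℝ := by
    intro x y
    simp [A, inner_add_left, real_inner_smul_left, ContinuousLinearMap.adjoint_inner_left]
  obtain ⟨Q, hQ⟩ := exists_factor A.toLinearMap LinearMap.id γ⁻¹ (by
    intro x
    have h1 := hA x x
    have h2 := real_inner_le_norm (A x) x
    rw [real_inner_self_eq_norm_sq, real_inner_self_eq_norm_sq] at h1
    simp only [LinearMap.id_apply, ContinuousLinearMap.coe_coe]
    rw [inv_mul_eq_div, le_div_iff₀ hγ]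
    rcases (norm_nonneg x).eq_or_lt with h0 | h0
    · rw [← h0, zero_mul]; positivity
    · refine le_of_mul_le_mul_right ?_ h0
      nlinarith [sq_nonneg ‖L x‖])
  refine ⟨-(Q.adjoint (L.adjoint y₀)), fun k => ?_⟩
  set u := -(Q.adjoint (L.adjoint y₀)) with hu
  have hstat : ∀ k, ⟪y₀ + L u, L k⟫_ℝ + γ * ⟪u, k⟫_ℝ = 0 := by
    intro k
    have h1 : ⟪u, A k⟫_ℝ = -⟪y₀, L k⟫_ℝ := by
      rw [hu, inner_neg_left, ContinuousLinearMap.adjoint_inner_left,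
        ContinuousLinearMap.adjoint_inner_left]
      exact congrArg (fun z => -⟪y₀, L z⟫_ℝ) (hQ k)
    rw [real_inner_comm, hA, real_inner_comm, real_inner_comm u k] at h1
    rw [inner_add_left]
    linarith [real_inner_comm (L u) (L k)]
  have := lqCost_add γ y₀ L u (k - u)
  rw [add_sub_cancel, hstat] at this
  rw [this]
  have : 0 ≤ ‖L (k - u)‖ ^ 2 + γ * ‖k - u‖ ^ 2 := by positivity
  linarith

theorem lq_stationary {γ : ℝ} {y₀ : Y} {L : U →L[ℝ] Y} {u : U}
    (hu : ∀ k, lqCost γ y₀ L u ≤ lqCost γ y₀ L k) (k : U) :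
    ⟪y₀ + L u, L k⟫_ℝ + γ * ⟪u, k⟫_ℝ = 0 := by
  set a := ⟪y₀ + L u, L k⟫_ℝ + γ * ⟪u, k⟫_ℝ with ha
  set b := ‖L k‖ ^ 2 + γ * ‖k‖ ^ 2 with hb
  -- Along the line u + tk the excess cost is bt² + 2at ≥ 0. It has no constant term, so its
  -- discriminant (2a)² is at most 0.
  have key : ∀ t : ℝ, 0 ≤ b * (t * t) + (2 * a) * t + 0 := by
    intro t
    have h1 := hu (u + t • k)
    rw [lqCost_add, map_smul, real_inner_smul_right, real_inner_smul_right, norm_smul, norm_smul,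
      mul_pow, mul_pow, Real.norm_eq_abs, sq_abs] at h1
    rw [ha, hb]
    nlinarith
  have := discrim_le_zero key
  rw [discrim] at this
  nlinarith [sq_nonneg a]

theorem lqCost_perturb_le {γ : ℝ} (y₀ : Y) (L D : U →L[ℝ] Y) (u : U) :
    lqCost γ y₀ (L + D) u ≤ lqCost γ y₀ L u + 2 * ⟪y₀ + L u, D u⟫_ℝ + ‖D‖ ^ 2 * ‖u‖ ^ 2 := by
  have h1 : lqCost γ y₀ (L + D) u =
      lqCost γ y₀ L u + 2 * ⟪y₀ + L u, D u⟫_ℝ + ‖D u‖ ^ 2 := by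
    rw [lqCost, lqCost, add_apply, ← add_assoc, norm_add_sq_real]
    ring
  rw [h1, ← mul_pow]
  gcongr
  exact D.le_opNorm u

/-- Stationarity removes the terms linear in d = k - u that do not involve `D`. The remaining cross
term 2⟪y₀ + Lu, Dd⟫ is absorbed by γ‖d‖², uniformly in d, so minimizers for `L + D` never have to be
compared with `u`. -/
theorem le_lqCost_perturb {γ : ℝ} (hγ : 0 < γ) {y₀ : Y} {L : U →L[ℝ] Y} (D : U →L[ℝ] Y) {u : U}
    (hu : ∀ k, lqCost γ y₀ L u ≤ lqCost γ y₀ L k) (k : U) :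
    lqCost γ y₀ L u + 2 * ⟪y₀ + L u, D u⟫_ℝ - ‖D‖ ^ 2 * (‖y₀ + L u‖ ^ 2 / γ) ≤
      lqCost γ y₀ (L + D) k := by
  obtain ⟨d, rfl⟩ : ∃ d, k = u + d := ⟨k - u, by abel⟩
  have hst := lq_stationary hu d
  have e : lqCost γ y₀ (L + D) (u + d) = lqCost γ y₀ L u +
      2 * (⟪y₀ + L u, D u⟫_ℝ + ⟪y₀ + L u, D d⟫_ℝ) + ‖L d + D u + D d‖ ^ 2 + γ * ‖d‖ ^ 2 := by
    have e1 : y₀ + (L + D) (u + d) = (y₀ + L u) + (L d + D u + D d) := by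
      simp only [add_apply, map_add]; abel
    rw [lqCost, lqCost, e1, norm_add_sq_real, norm_add_sq_real u d, inner_add_right,
      inner_add_right]
    linarith
  rw [e]
  have h1 : |⟪y₀ + L u, D d⟫_ℝ| ≤ ‖y₀ + L u‖ * (‖D‖ * ‖d‖) :=
    (abs_real_inner_le_norm _ _).trans (by gcongr; exact D.le_opNorm d)
  have h2 := (abs_le.1 h1).1
  -- Completing the square: γ‖d‖² - 2‖y₀ + Lu‖‖D‖‖d‖ is at least -‖D‖²‖y₀ + Lu‖²/γ.
  have h3 : 0 ≤ (γ * ‖d‖ - ‖y₀ + L u‖ * ‖D‖) ^ 2 / γ := by positivity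
  have h4 : (γ * ‖d‖ - ‖y₀ + L u‖ * ‖D‖) ^ 2 / γ = γ * ‖d‖ ^ 2 -
      2 * (‖y₀ + L u‖ * (‖D‖ * ‖d‖)) + ‖D‖ ^ 2 * (‖y₀ + L u‖ ^ 2 / γ) := by
    field_simp; ring
  nlinarith [sq_nonneg ‖L d + D u + D d‖]

/-- The optimal value depends on the operator to first order through the optimal output. -/
theorem abs_lq_value_sub_le {γ : ℝ} (hγ : 0 < γ) {y₀ : Y} {L : U →L[ℝ] Y} (D : U →L[ℝ] Y) {u : U}
    (hu : ∀ k, lqCost γ y₀ L u ≤ lqCost γ y₀ L k) :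
    |sInf (range (lqCost γ y₀ (L + D))) - lqCost γ y₀ L u - 2 * ⟪y₀ + L u, D u⟫_ℝ| ≤
      ‖D‖ ^ 2 * (‖u‖ ^ 2 + ‖y₀ + L u‖ ^ 2 / γ) := by
  have hbdd : BddBelow (range (lqCost γ y₀ (L + D))) :=
    ⟨_, by rintro _ ⟨j, rfl⟩; exact le_lqCost_perturb hγ D hu j⟩
  have h1 := (csInf_le hbdd (mem_range_self u)).trans (lqCost_perturb_le y₀ L D u)
  have h2 : _ ≤ sInf (range (lqCost γ y₀ (L + D))) := le_csInf (range_nonempty _) (by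
    rintro _ ⟨j, rfl⟩
    exact le_lqCost_perturb hγ D hu j)
  have h3 : 0 ≤ ‖D‖ ^ 2 * ‖u‖ ^ 2 := by positivity
  have h4 : 0 ≤ ‖D‖ ^ 2 * (‖y₀ + L u‖ ^ 2 / γ) := by positivity
  rw [abs_le]
  constructor <;> linarith

end LinearQuadratic

/-! ### Integral operators on L² whose argument is transported by a measure preserving map -/

section Kernel

theorem eLpNorm_two_sq {α : Type*} [MeasurableSpace α] (m : Measure α) (f : α → ℝ) :
    eLpNorm f 2 m ^ 2 = ∫⁻ x, ‖f x‖ₑ ^ 2 ∂m := by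
  have := eLpNorm_nnreal_pow_eq_lintegral (f := f) (μ := m) (p := 2) (by norm_num)
  simpa using this

theorem MemLp.ae_section {Y B : Type*} [MeasurableSpace Y] [MeasurableSpace B] {n : Measure Y}
    {β : Measure B} [SFinite n] [SFinite β] {F : Y × B → ℝ} (hF : MemLp F 2 (n.prod β)) :
    ∀ᵐ y ∂n, MemLp (fun b => F (y, b)) 2 β := by
  have h1 : ∫⁻ p, ‖F p‖ₑ ^ 2 ∂(n.prod β) < ⊤ := by
    rw [← eLpNorm_two_sq]
    exact ENNReal.pow_lt_top hF.2
  have hm : AEMeasurable (fun p => ‖F p‖ₑ ^ 2) (n.prod β) := hF.1.enorm.pow_const 2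
  rw [lintegral_prod _ hm] at h1
  have h2 := ae_lt_top' hm.lintegral_prod_right' h1.ne
  filter_upwards [h2, hF.1.prodMk_left] with y hy hy'
  refine ⟨hy', ?_⟩
  rw [← eLpNorm_two_sq] at hy
  by_contra hc
  rw [not_lt, top_le_iff] at hc
  rw [hc] at hy
  simp at hy

theorem memLp_prod_of_section_bound {Y B : Type*} [MeasurableSpace Y] [MeasurableSpace B]
    {n : Measure Y} {β : Measure B} [SFinite n] [SFinite β] {k : Y × B → ℝ}
    (hk : AEStronglyMeasurable k (n.prod β)) {C : ℝ≥0}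
    (hC : ∀ᵐ y ∂n, eLpNorm (fun b => k (y, b)) 2 β ≤ C) {g : Y → ℝ} (hg : MemLp g 2 n) :
    MemLp (fun p => g p.1 * k p) 2 (n.prod β) := by
  have hm : AEStronglyMeasurable (fun p : Y × B => g p.1 * k p) (n.prod β) := hg.1.comp_fst.mul hk
  refine ⟨hm, ?_⟩
  have : eLpNorm (fun p : Y × B => g p.1 * k p) 2 (n.prod β) ^ 2 < ⊤ := by
    rw [eLpNorm_two_sq, lintegral_prod _ (hm.enorm.pow_const 2)]
    calc ∫⁻ y, ∫⁻ b, ‖g y * k (y, b)‖ₑ ^ 2 ∂β ∂n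
        ≤ ∫⁻ y, ‖g y‖ₑ ^ 2 * C ^ 2 ∂n := by
          apply lintegral_mono_ae
          filter_upwards [hC] with y hy
          simp_rw [enorm_mul, mul_pow]
          rw [lintegral_const_mul' _ _ (by simp)]
          gcongr
          rw [← eLpNorm_two_sq]
          gcongr
      _ < ⊤ := by
          rw [lintegral_mul_const' _ _ (by simp), ← eLpNorm_two_sq]
          exact ENNReal.mul_lt_top (ENNReal.pow_lt_top hg.2) (by simp)
  by_contra hc
  rw [not_lt, top_le_iff] at hc
  rw [hc] at this
  simp at this

-- One scheme covers three operators: f is evaluated at the first component of σ(y,b) and integrated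
-- over b against k. For Green's operator and for time integration σ exchanges two coordinates; for
-- tensor products B is a point and B' is the space interval. Cauchy–Schwarz in b and invariance of
-- the product measure give the operator bound.
variable {X Y B B' : Type*} [MeasurableSpace X] [MeasurableSpace Y] [MeasurableSpace B]
  [MeasurableSpace B'] {m : Measure X} {n : Measure Y} {β : Measure B} {β' : Measure B'}
  [IsFiniteMeasure m] [IsFiniteMeasure n] [IsFiniteMeasure β] [IsFiniteMeasure β']
  {σ : Y × B → X × B'} (hσ : MeasurePreserving σ (n.prod β) (m.prod β'))
  {k : Y × B → ℝ} (hk : AEStronglyMeasurable k (n.prod β)) {C : ℝ≥0}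
  (hC : ∀ᵐ y ∂n, eLpNorm (fun b => k (y, b)) 2 β ≤ C)

include hσ in
theorem memLp_comp_fst_transport {f : X → ℝ} (hf : MemLp f 2 m) :
    MemLp (fun p => f (σ p).1) 2 (n.prod β) := by
  have h1 : MemLp (fun p : X × B' => f p.1) 2 (m.prod β') := hf.comp_fst β'
  exact h1.comp_measurePreserving hσ

include hσ in
theorem lintegral_comp_fst_transport {f : X → ℝ} (hf : MemLp f 2 m) :
    ∫⁻ p, ‖f (σ p).1‖ₑ ^ 2 ∂(n.prod β) = β' univ * ∫⁻ x, ‖f x‖ₑ ^ 2 ∂m := by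
  have hm : AEMeasurable (fun p : X × B' => ‖f p.1‖ₑ ^ 2) (m.prod β') :=
    (hf.comp_fst β').1.enorm.pow_const 2
  rw [← hσ.map_eq] at hm
  have h1 := lintegral_map' hm hσ.aemeasurable
  rw [← h1, hσ.map_eq, lintegral_prod _ (by rwa [hσ.map_eq] at hm)]
  simp only [lintegral_const]
  rw [lintegral_mul_const'' _ (hf.1.enorm.pow_const 2), mul_comm]

include hσ hk hC in
theorem kernel_integrable {f : X → ℝ} (hf : MemLp f 2 m) :
    ∀ᵐ y ∂n, Integrable (fun b => k (y, b) * f (σ (y, b)).1) β := by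
  filter_upwards [hC, hk.prodMk_left, MemLp.ae_section (memLp_comp_fst_transport hσ hf)]
    with y h1 h2 h3
  exact MemLp.integrable_mul (p := 2) (q := 2) ⟨h2, h1.trans_lt (by simp)⟩ h3

include hσ hk hC in
theorem kernel_enorm_le {f : X → ℝ} (hf : MemLp f 2 m) :
    ∀ᵐ y ∂n, ‖∫ b, k (y, b) * f (σ (y, b)).1 ∂β‖ₑ ^ 2 ≤
      C ^ 2 * ∫⁻ b, ‖f (σ (y, b)).1‖ₑ ^ 2 ∂β := by
  filter_upwards [hC, hk.prodMk_left, MemLp.ae_section (memLp_comp_fst_transport hσ hf)]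
    with y h1 h2 h3
  have h4 : ‖∫ b, k (y, b) * f (σ (y, b)).1 ∂β‖ₑ ≤
      eLpNorm (fun b => k (y, b)) 2 β * eLpNorm (fun b => f (σ (y, b)).1) 2 β := by
    refine (enorm_integral_le_lintegral_enorm _).trans ?_
    rw [← eLpNorm_one_eq_lintegral_enorm]
    have h5 := eLpNorm_smul_le_mul_eLpNorm (p := 2) (q := 2) (r := 1) h3.1 h2
    simpa only [smul_eq_mul, Pi.mul_def] using h5
  calc _ ≤ (eLpNorm (fun b => k (y, b)) 2 β * eLpNorm (fun b => f (σ (y, b)).1) 2 β) ^ 2 := by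
        gcongr
    _ ≤ _ := by
        rw [mul_pow, eLpNorm_two_sq β (fun b => f (σ (y, b)).1)]
        gcongr

include hσ hk in
theorem kernel_aestronglyMeasurable {f : X → ℝ} (hf : MemLp f 2 m) :
    AEStronglyMeasurable (fun y => ∫ b, k (y, b) * f (σ (y, b)).1 ∂β) n :=
  (hk.mul (memLp_comp_fst_transport hσ hf).1).integral_prod_right'

include hσ hk hC in
theorem kernel_lintegral_le {f : X → ℝ} (hf : MemLp f 2 m) :
    ∫⁻ y, ‖∫ b, k (y, b) * f (σ (y, b)).1 ∂β‖ₑ ^ 2 ∂n ≤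
      C ^ 2 * (β' univ * ∫⁻ x, ‖f x‖ₑ ^ 2 ∂m) := by
  refine (lintegral_mono_ae (kernel_enorm_le hσ hk hC hf)).trans ?_
  rw [← lintegral_comp_fst_transport hσ hf, lintegral_const_mul' _ _ (by simp), lintegral_prod]
  exact (memLp_comp_fst_transport hσ hf).1.enorm.pow_const 2

include hσ hk hC in
theorem kernel_eLpNorm_le {f : X → ℝ} (hf : MemLp f 2 m) :
    eLpNorm (fun y => ∫ b, k (y, b) * f (σ (y, b)).1 ∂β) 2 n ≤
      ENNReal.ofReal (C * √(β'.real univ)) * eLpNorm f 2 m := by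
  rw [← ENNReal.pow_le_pow_left_iff (n := 2) (by norm_num), mul_pow, eLpNorm_two_sq, eLpNorm_two_sq]
  refine (kernel_lintegral_le hσ hk hC hf).trans ?_
  rw [← mul_assoc]
  gcongr
  rw [← ENNReal.ofReal_pow (by positivity), mul_pow, Real.sq_sqrt measureReal_nonneg,
    ENNReal.ofReal_mul (by positivity), ofReal_measureReal,
    ENNReal.ofReal_pow (by positivity), ENNReal.ofReal_coe_nnreal]

include hσ hk hC in
theorem kernel_memLp {f : X → ℝ} (hf : MemLp f 2 m) :
    MemLp (fun y => ∫ b, k (y, b) * f (σ (y, b)).1 ∂β) 2 n :=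
  ⟨kernel_aestronglyMeasurable hσ hk hf, (kernel_eLpNorm_le hσ hk hC hf).trans_lt
    (ENNReal.mul_lt_top ENNReal.ofReal_lt_top hf.2)⟩

include hσ in
theorem kernel_congr {f g : X → ℝ} (hfg : f =ᵐ[m] g) :
    (fun y => ∫ b, k (y, b) * f (σ (y, b)).1 ∂β) =ᵐ[n]
      fun y => ∫ b, k (y, b) * g (σ (y, b)).1 ∂β := by
  have h1 : ∀ᵐ p ∂(m.prod β'), f p.1 = g p.1 := Measure.quasiMeasurePreserving_fst.ae hfg
  have h2 : ∀ᵐ p ∂(n.prod β), f (σ p).1 = g (σ p).1 := hσ.quasiMeasurePreserving.ae h1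
  filter_upwards [Measure.ae_ae_of_ae_prod h2] with y hy
  refine integral_congr_ae ?_
  filter_upwards [hy] with b hb
  rw [hb]

include hσ hk hC in
/-- The bounded operator on `L²` given by a kernel. -/
theorem exists_kernelOp :
    ∃ T : Lp ℝ 2 m →L[ℝ] Lp ℝ 2 n, ‖T‖ ≤ C * √(β'.real univ) ∧
      ∀ (f : X → ℝ) (hf : MemLp f 2 m),
        T (hf.toLp f) =ᵐ[n] fun y => ∫ b, k (y, b) * f (σ (y, b)).1 ∂β := by
  let T₀ : Lp ℝ 2 m →ₗ[ℝ] Lp ℝ 2 n :=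
    { toFun := fun f => (kernel_memLp hσ hk hC (Lp.memLp f)).toLp _
      map_add' := by
        intro f g
        apply Lp.ext
        refine (MemLp.coeFn_toLp _).trans ?_
        refine (kernel_congr hσ (Lp.coeFn_add f g)).trans ?_
        filter_upwards [Lp.coeFn_add ((kernel_memLp hσ hk hC (Lp.memLp f)).toLp _)
          ((kernel_memLp hσ hk hC (Lp.memLp g)).toLp _),
          (kernel_memLp hσ hk hC (Lp.memLp f)).coeFn_toLp,
          (kernel_memLp hσ hk hC (Lp.memLp g)).coeFn_toLp,
          kernel_integrable hσ hk hC (Lp.memLp f),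
          kernel_integrable hσ hk hC (Lp.memLp g)] with y h1 h2 h3 h4 h5
        rw [h1, Pi.add_apply, h2, h3, ← integral_add h4 h5]
        simp only [Pi.add_apply, mul_add]
      map_smul' := by
        intro c f
        apply Lp.ext
        refine (MemLp.coeFn_toLp _).trans ?_
        refine (kernel_congr hσ (Lp.coeFn_smul c f)).trans ?_
        filter_upwards [Lp.coeFn_smul c ((kernel_memLp hσ hk hC (Lp.memLp f)).toLp _),
          (kernel_memLp hσ hk hC (Lp.memLp f)).coeFn_toLp] with y h1 h2
        rw [RingHom.id_apply, h1, Pi.smul_apply, h2, ← integral_smul]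
        simp only [Pi.smul_apply, smul_eq_mul, mul_left_comm] }
  have hT₀ : ∀ f, ‖T₀ f‖ ≤ C * √(β'.real univ) * ‖f‖ := by
    intro f
    change ‖(kernel_memLp hσ hk hC (Lp.memLp f)).toLp _‖ ≤ _
    rw [Lp.norm_toLp, Lp.norm_def]
    have := kernel_eLpNorm_le hσ hk hC (Lp.memLp f)
    refine (ENNReal.toReal_mono (ENNReal.mul_ne_top ENNReal.ofReal_ne_top (Lp.memLp f).2.ne) this).trans ?_
    rw [ENNReal.toReal_mul, ENNReal.toReal_ofReal (by positivity)]
  refine ⟨T₀.mkContinuous _ hT₀, T₀.mkContinuous_norm_le (by positivity) hT₀, fun f hf => ?_⟩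
  exact (kernel_memLp hσ hk hC (Lp.memLp (hf.toLp f))).coeFn_toLp.trans
    (kernel_congr hσ hf.coeFn_toLp)

include hσ hk hC in
theorem kernel_inner {f : X → ℝ} (hf : MemLp f 2 m) {g : Y → ℝ} (hg : MemLp g 2 n) :
    ∫ y, (∫ b, k (y, b) * f (σ (y, b)).1 ∂β) * g y ∂n =
      ∫ p, g p.1 * k p * f (σ p).1 ∂(n.prod β) := by
  have hint : Integrable (fun p : Y × B => g p.1 * k p * f (σ p).1) (n.prod β) :=
    MemLp.integrable_mul (p := 2) (q := 2) (memLp_prod_of_section_bound hk hC hg)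
      (memLp_comp_fst_transport hσ hf)
  rw [integral_prod _ hint]
  refine integral_congr_ae (ae_of_all _ fun y => ?_)
  simp only
  rw [mul_comm, ← integral_const_mul]
  simp only [mul_assoc]

-- Both sides are integrals of f·k·g over a product space, and the change of variables σ, undone by
-- σ', carries one into the other.
include hσ hk hC in
theorem kernel_adjoint {σ' : X × B' → Y × B} (hσ' : MeasurePreserving σ' (m.prod β') (n.prod β))
    (hσσ' : ∀ p, σ' (σ p) = p) {k' : X × B' → ℝ} (hk' : AEStronglyMeasurable k' (m.prod β'))
    {C' : ℝ≥0} (hC' : ∀ᵐ x ∂m, eLpNorm (fun b => k' (x, b)) 2 β' ≤ C') (hkk' : ∀ p, k' (σ p) = k p)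
    {f : X → ℝ} (hf : MemLp f 2 m) {g : Y → ℝ} (hg : MemLp g 2 n) :
    ∫ y, (∫ b, k (y, b) * f (σ (y, b)).1 ∂β) * g y ∂n =
      ∫ x, f x * (∫ b, k' (x, b) * g (σ' (x, b)).1 ∂β') ∂m := by
  rw [kernel_inner hσ hk hC hf hg]
  simp_rw [mul_comm (f _) (∫ _, _ ∂β')]
  rw [kernel_inner hσ' hk' hC' hg hf]
  have hint : Integrable (fun p : X × B' => f p.1 * k' p * g (σ' p).1) (m.prod β') :=
    MemLp.integrable_mul (p := 2) (q := 2) (memLp_prod_of_section_bound hk' hC' hf)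
      (memLp_comp_fst_transport hσ' hg)
  have h1 := integral_map hσ.aemeasurable (by rw [hσ.map_eq]; exact hint.1)
  rw [hσ.map_eq] at h1
  rw [h1]
  refine integral_congr_ae (ae_of_all _ fun p => ?_)
  simp only [hσσ', hkk']
  ring

end Kernel

/-! ### Weak derivatives on (0,1) -/

section WeakDeriv

theorem integrable_of_memLp_two {α : Type*} [MeasurableSpace α] {m : Measure α} [IsFiniteMeasure m]
    {f : α → ℝ} (hf : MemLp f 2 m) : Integrable f m :=
  hf.integrable (by norm_num)

theorem intervalIntegrable_of_space {f : ℝ → ℝ} (hf : Integrable f spaceMeasure) :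
    IntervalIntegrable f volume 0 1 := by
  rw [intervalIntegrable_iff_integrableOn_Ioo_of_le zero_le_one]
  exact hf

theorem integral_space_eq (f : ℝ → ℝ) : ∫ x, f x ∂spaceMeasure = ∫ x in (0 : ℝ)..1, f x := by
  rw [intervalIntegral.integral_of_le zero_le_one, integral_Ioc_eq_integral_Ioo]

theorem eq_zero_of_tsupport_subset {φ : ℝ → ℝ} (h : tsupport φ ⊆ Ioo (0 : ℝ) 1) {x : ℝ}
    (hx : x ∉ Ioo (0 : ℝ) 1) : φ x = 0 :=
  image_eq_zero_of_notMem_tsupport fun h' => hx (h h')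

/-- A primitive has the expected weak derivative. -/
theorem isWeakDeriv_of_primitive {F f : ℝ → ℝ} {c : ℝ} (hf : Integrable f spaceMeasure)
    (hF : ∀ x ∈ Ioo (0 : ℝ) 1, F x = c + ∫ y in (0 : ℝ)..x, f y) : IsWeakDeriv F f := by
  intro φ hφ _ hs
  have hi := intervalIntegrable_of_space hf
  have hac := hi.absolutelyContinuousOnInterval_intervalIntegral (c := 0) (by simp)
  have hac2 : AbsolutelyContinuousOnInterval φ 0 1 :=
    (hφ.of_le (by exact_mod_cast le_top)).contDiffOn.absolutelyContinuousOnInterval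
  have key := hac.integral_mul_deriv_eq_deriv_mul hac2
  rw [eq_zero_of_tsupport_subset hs (by simp), eq_zero_of_tsupport_subset hs (by simp)] at key
  have hd : ∫ x in (0 : ℝ)..1, deriv (fun x => ∫ y in (0 : ℝ)..x, f y) x * φ x =
      ∫ x in (0 : ℝ)..1, f x * φ x := by
    apply intervalIntegral.integral_congr_ae
    filter_upwards [hi.ae_hasDerivAt_integral] with x hx hx'
    rw [(hx (uIoc_subset_uIcc hx') 0 (by simp)).deriv]
  have hdφ : Continuous (deriv φ) := hφ.continuous_deriv (by exact_mod_cast le_top)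
  have hc : ∫ x in (0 : ℝ)..1, c * deriv φ x = 0 := by
    rw [intervalIntegral.integral_const_mul, intervalIntegral.integral_deriv_eq_sub
      (fun x _ => (hφ.differentiable (by simp)) x) (hdφ.intervalIntegrable _ _),
      eq_zero_of_tsupport_subset hs (by simp), eq_zero_of_tsupport_subset hs (by simp)]
    simp
  have h1 : ∫ x in Ioo (0 : ℝ) 1, F x * deriv φ x =
      ∫ x in Ioo (0 : ℝ) 1, (c * deriv φ x + (∫ y in (0 : ℝ)..x, f y) * deriv φ x) :=
    setIntegral_congr_fun measurableSet_Ioo fun x hx => by simp only [hF x hx]; ring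
  rw [h1, integral_space_eq, integral_space_eq, intervalIntegral.integral_add, hc, key, hd]
  · simp
  · exact (continuous_const.mul hdφ).intervalIntegrable _ _
  · exact (hac.continuousOn.mul hdφ.continuousOn).intervalIntegrable

theorem ae_eq_zero_of_test {f : ℝ → ℝ} (hf : Integrable f spaceMeasure)
    (h : ∀ φ : ℝ → ℝ, ContDiff ℝ (⊤ : ℕ∞) φ → HasCompactSupport φ → tsupport φ ⊆ Ioo (0 : ℝ) 1 →
      ∫ x in Ioo (0 : ℝ) 1, f x * φ x = 0) : f =ᵐ[spaceMeasure] 0 := by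
  have h1 : ∀ᵐ x, x ∈ Ioo (0 : ℝ) 1 → f x = 0 := by
    refine isOpen_Ioo.ae_eq_zero_of_integral_contDiff_smul_eq_zero
      (IntegrableOn.locallyIntegrableOn hf) fun φ h1 h2 h3 => ?_
    rw [← h φ h1 h2 h3]
    simp only [smul_eq_mul, mul_comm (φ _)]
    refine (setIntegral_eq_integral_of_forall_compl_eq_zero fun x hx => ?_).symm
    rw [eq_zero_of_tsupport_subset h3 hx, mul_zero]
  exact (ae_restrict_iff' measurableSet_Ioo).2 h1

theorem ae_eq_zero_of_isWeakDeriv {f g : ℝ → ℝ} (hf : f =ᵐ[spaceMeasure] 0)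
    (hg : Integrable g spaceMeasure) (h : IsWeakDeriv f g) : g =ᵐ[spaceMeasure] 0 := by
  refine ae_eq_zero_of_test hg fun φ h1 h2 h3 => ?_
  have h4 := h φ h1 h2 h3
  rw [integral_congr_ae (g := fun _ => 0) (by filter_upwards [hf] with x hx; simp [hx])] at h4
  simp at h4
  linarith

theorem exists_primitive_test {ψ : ℝ → ℝ} (h1 : ContDiff ℝ (⊤ : ℕ∞) ψ) (h2 : HasCompactSupport ψ)
    (h3 : tsupport ψ ⊆ Ioo (0 : ℝ) 1) (h4 : ∫ x, ψ x = 0) :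
    ∃ Ψ : ℝ → ℝ, ContDiff ℝ (⊤ : ℕ∞) Ψ ∧ HasCompactSupport Ψ ∧ tsupport Ψ ⊆ Ioo (0 : ℝ) 1 ∧
      deriv Ψ = ψ := by
  -- The extra point 1/2 keeps the compact set nonempty when ψ = 0, so that it has a least and a
  -- greatest element.
  have hK : IsCompact (insert (1 / 2) (tsupport ψ)) := h2.isCompact.insert _
  have hne : (insert (1 / 2 : ℝ) (tsupport ψ)).Nonempty := insert_nonempty _ _
  have hsub : insert (1 / 2) (tsupport ψ) ⊆ Ioo (0 : ℝ) 1 :=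
    insert_subset (by norm_num) h3
  obtain ⟨a, ha, ha'⟩ := hK.exists_isLeast hne
  obtain ⟨b, hb, hb'⟩ := hK.exists_isGreatest hne
  have hz : ∀ x, x ∉ Icc a b → ψ x = 0 := fun x hx =>
    image_eq_zero_of_notMem_tsupport fun h =>
      hx ⟨ha' (mem_insert_of_mem _ h), hb' (mem_insert_of_mem _ h)⟩
  have hd : ∀ x, HasDerivAt (fun x => ∫ y in (0 : ℝ)..x, ψ y) (ψ x) x := fun x =>
    (h1.continuous.integral_hasStrictDerivAt 0 x).hasDerivAt
  have hderiv : deriv (fun x => ∫ y in (0 : ℝ)..x, ψ y) = ψ := funext fun x => (hd x).deriv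
  have hsupp : tsupport (fun x => ∫ y in (0 : ℝ)..x, ψ y) ⊆ Icc a b := by
    refine closure_minimal ?_ isClosed_Icc
    intro x hx
    by_contra hc
    apply hx
    simp only [mem_Icc, not_and_or, not_le] at hc
    rcases hc with hc | hc
    · have : EqOn ψ (fun _ => 0) (uIcc 0 x) := by
        intro y hy
        refine hz y fun hy' => ?_
        have := hy.2
        have h0 := (hsub ha).1
        have : y ≤ max 0 x := hy.2
        exact absurd (hy'.1.trans this) (not_le.2 (max_lt h0 hc))
      simp only
      rw [intervalIntegral.integral_congr this]
      simp
    · simp only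
      rw [intervalIntegral.integral_eq_integral_of_support_subset, h4]
      intro y hy
      have hy' : y ∈ Icc a b := by
        by_contra h
        exact hy (hz y h)
      exact ⟨(hsub ha).1.trans_le hy'.1, hy'.2.trans hc.le⟩
  refine ⟨fun x => ∫ y in (0 : ℝ)..x, ψ y, ?_, ?_, ?_, hderiv⟩
  · exact contDiff_infty_iff_deriv.2 ⟨fun x => (hd x).differentiableAt, by rw [hderiv]; exact h1⟩
  · exact isCompact_Icc.of_isClosed_subset (isClosed_tsupport _) hsupp
  · exact hsupp.trans (Icc_subset_Ioo (hsub ha).1 (hsub hb).2)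

/-- The lemma of du Bois-Reymond. -/
theorem exists_const_of_isWeakDeriv_zero {f g : ℝ → ℝ} (hf : Integrable f spaceMeasure)
    (hg : g =ᵐ[spaceMeasure] 0) (h : IsWeakDeriv f g) : ∃ c, f =ᵐ[spaceMeasure] fun _ => c := by
  let B : ContDiffBump (1 / 2 : ℝ) := ⟨1 / 8, 1 / 4, by norm_num, by norm_num⟩
  let φ₀ : ℝ → ℝ := B.normed volume
  have hφ₀ : ContDiff ℝ (⊤ : ℕ∞) φ₀ := B.contDiff_normed
  have hs₀ : tsupport φ₀ ⊆ Ioo (0 : ℝ) 1 := by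
    rw [show tsupport φ₀ = Metric.closedBall (1 / 2 : ℝ) (1 / 4) from B.tsupport_normed_eq,
      Real.closedBall_eq_Icc]
    exact Icc_subset_Ioo (by norm_num) (by norm_num)
  have hc₀ : HasCompactSupport φ₀ := B.hasCompactSupport_normed
  have hi₀ : ∫ x, φ₀ x = 1 := B.integral_normed
  have hmul : ∀ {φ : ℝ → ℝ}, ContDiff ℝ (⊤ : ℕ∞) φ → HasCompactSupport φ →
      Integrable (fun x => f x * φ x) spaceMeasure := by
    intro φ h1 h2
    obtain ⟨C, hC⟩ := h2.exists_bound_of_continuous h1.continuous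
    exact hf.mul_bdd (c := C) h1.continuous.aestronglyMeasurable (ae_of_all _ hC)
  have hint : ∀ {φ : ℝ → ℝ}, tsupport φ ⊆ Ioo (0 : ℝ) 1 →
      ∫ x in Ioo (0 : ℝ) 1, φ x = ∫ x, φ x := fun h =>
    setIntegral_eq_integral_of_forall_compl_eq_zero fun x hx => eq_zero_of_tsupport_subset h hx
  refine ⟨∫ x in Ioo (0 : ℝ) 1, f x * φ₀ x, ?_⟩
  set c := ∫ x in Ioo (0 : ℝ) 1, f x * φ₀ x with hc
  have : (fun x => f x - c) =ᵐ[spaceMeasure] 0 := by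
    refine ae_eq_zero_of_test (hf.sub (integrable_const c)) fun φ h1 h2 h3 => ?_
    -- φ - dφ₀ has integral zero and so is the derivative of a test function. Against such a
    -- derivative f integrates to zero, which identifies the constant as the pairing of f with φ₀.
    set d := ∫ x, φ x with hd
    have hs : tsupport (fun x => φ x - d * φ₀ x) ⊆ tsupport φ ∪ tsupport φ₀ := by
      refine closure_minimal (fun x hx => ?_) ((isClosed_tsupport _).union (isClosed_tsupport _))
      by_contra hn
      simp only [mem_union, not_or] at hn
      apply hx
      simp [image_eq_zero_of_notMem_tsupport hn.1, image_eq_zero_of_notMem_tsupport hn.2]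
    obtain ⟨Ψ, g1, g2, g3, g4⟩ := exists_primitive_test (ψ := fun x => φ x - d * φ₀ x)
      (h1.sub (contDiff_const.mul hφ₀))
      ((h2.isCompact.union hc₀.isCompact).of_isClosed_subset (isClosed_tsupport _) hs)
      (hs.trans (union_subset h3 hs₀)) (by
        rw [integral_sub (h1.continuous.integrable_of_hasCompactSupport h2)
          ((hφ₀.continuous.integrable_of_hasCompactSupport hc₀).const_mul _), integral_const_mul,
          hi₀, mul_one, sub_self])
    have h5 := h Ψ g1 g2 g3
    rw [integral_congr_ae (f := fun x => g x * Ψ x) (g := fun _ => 0)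
      (by filter_upwards [hg] with x hx; simp [hx]), g4] at h5
    simp only [integral_zero, neg_zero] at h5
    have e1 : ∫ x in Ioo (0 : ℝ) 1, f x * (φ x - d * φ₀ x) =
        (∫ x in Ioo (0 : ℝ) 1, f x * φ x) - d * c := by
      rw [hc, ← integral_const_mul, ← integral_sub (hmul h1 h2) ((hmul hφ₀ hc₀).const_mul d)]
      congr 1; ext x; ring
    have e2 : ∫ x in Ioo (0 : ℝ) 1, (f x - c) * φ x =
        (∫ x in Ioo (0 : ℝ) 1, f x * φ x) - c * d := by
      rw [hd, ← hint h3, ← integral_const_mul, ← integral_sub (hmul h1 h2)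
        (((h1.continuous.integrable_of_hasCompactSupport h2).integrableOn).const_mul c)]
      congr 1; ext x; ring
    rw [e1] at h5
    rw [e2]
    linear_combination h5
  filter_upwards [this] with x hx
  simp only [Pi.zero_apply] at hx
  linarith

/-- A function whose primitive vanishes on a dense set vanishes. -/
theorem ae_eq_zero_of_primitive {f : ℝ → ℝ} {c : ℝ} (hc : 0 ≤ c)
    (hf : Integrable f (volume.restrict (Ioo 0 c))) {S : Set ℝ} (hS : Dense S)
    (h : ∀ t ∈ S, t ∈ Ioo 0 c → ∫ s in (0 : ℝ)..t, f s = 0) :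
    f =ᵐ[volume.restrict (Ioo 0 c)] 0 := by
  have hi : IntervalIntegrable f volume 0 c := by
    rwa [intervalIntegrable_iff_integrableOn_Ioo_of_le hc]
  have hcont : ContinuousOn (fun t => ∫ s in (0 : ℝ)..t, f s) (Icc 0 c) := by
    have := intervalIntegral.continuousOn_primitive_interval' hi (a := 0) (by simp)
    rwa [uIcc_of_le hc] at this
  have hz : ∀ t ∈ Ioo 0 c, ∫ s in (0 : ℝ)..t, f s = 0 := by
    intro t ht
    have h1 : t ∈ closure (Ioo 0 c ∩ S) := hS.open_subset_closure_inter isOpen_Ioo ht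
    have h2 : ContinuousWithinAt (fun t => ∫ s in (0 : ℝ)..t, f s) (Ioo 0 c ∩ S) t :=
      (hcont t (Ioo_subset_Icc_self ht)).mono (inter_subset_left.trans Ioo_subset_Icc_self)
    have h3 := h2.mem_closure_image h1
    have h4 : (fun t => ∫ s in (0 : ℝ)..t, f s) '' (Ioo 0 c ∩ S) ⊆ {0} := by
      rintro _ ⟨s, hs, rfl⟩
      exact h s hs.2 hs.1
    simpa using closure_mono h4 h3
  refine (ae_restrict_iff' measurableSet_Ioo).2 ?_
  filter_upwards [hi.ae_hasDerivAt_integral] with t ht ht'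
  have h1 := ht (by rw [uIcc_of_le hc]; exact Ioo_subset_Icc_self ht') 0 (by simp)
  have h2 : (fun t => ∫ s in (0 : ℝ)..t, f s) =ᶠ[𝓝 t] fun _ => 0 := by
    filter_upwards [isOpen_Ioo.mem_nhds ht'] with s hs using hz s hs
  exact h1.unique ((hasDerivAt_const t (0 : ℝ)).congr_of_eventuallyEq h2)

end WeakDeriv

/-! ### Green's function and the space H² ∩ H¹₀ -/

section Green

/-- Green's function of the second derivative on `(0,1)` with Dirichlet boundary conditions. -/
def green (x y : ℝ) : ℝ := max (x - y) 0 - x * (1 - y)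

theorem green_comm (x y : ℝ) : green x y = green y x := by
  rw [green, green]
  rcases le_total x y with h | h
  · rw [max_eq_right (by linarith), max_eq_left (by linarith)]; ring
  · rw [max_eq_left (by linarith), max_eq_right (by linarith)]; ring

theorem continuous_green : Continuous fun p : ℝ × ℝ => green p.1 p.2 := by
  unfold green; fun_prop

theorem continuous_green_left (x : ℝ) : Continuous (green x) := by
  unfold green; fun_prop

/-- As a function of the first variable, Green's function has slope y - 1 to the left of y and slope
y to the right. This Lipschitz bound later makes the localization error proportional to the radius
of the ball. -/
theorem abs_green_sub_le {x x' y : ℝ} (hy : y ∈ Icc (0 : ℝ) 1) :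
    |green x y - green x' y| ≤ |x - x'| := by
  wlog h : x' ≤ x generalizing x x'
  · rw [abs_sub_comm, abs_sub_comm x]; exact this (le_of_not_ge h)
  rw [abs_of_nonneg (sub_nonneg.2 h), green, green, abs_le]
  have h1 : 0 ≤ (x - x') * y := mul_nonneg (by linarith) hy.1
  have h2 : 0 ≤ (x - x') * (1 - y) := mul_nonneg (by linarith) (by linarith [hy.2])
  constructor
  · rcases le_total x y with h3 | h3 <;> rcases le_total x' y with h4 | h4 <;>
    simp only [max_def] <;> split_ifs <;> nlinarith
  · rcases le_total x y with h3 | h3 <;> rcases le_total x' y with h4 | h4 <;>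
    simp only [max_def] <;> split_ifs <;> nlinarith

theorem abs_green_le {x y : ℝ} (hx : x ∈ Icc (0 : ℝ) 1) (hy : y ∈ Icc (0 : ℝ) 1) :
    |green x y| ≤ 1 := by
  have := abs_green_sub_le (x := x) (x' := 0) hy
  have h0 : green 0 y = 0 := by rw [green, max_eq_right (by linarith [hy.1])]; ring
  rw [h0, sub_zero, sub_zero, abs_of_nonneg hx.1] at this
  exact this.trans hx.2

theorem ae_space_mem : ∀ᵐ x ∂spaceMeasure, x ∈ Ioo (0 : ℝ) 1 := ae_restrict_mem measurableSet_Ioo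

theorem integrable_green_mul {f : ℝ → ℝ} (hf : Integrable f spaceMeasure) {x : ℝ}
    (hx : x ∈ Icc (0 : ℝ) 1) : Integrable (fun y => green x y * f y) spaceMeasure := by
  refine hf.bdd_mul (c := 1) (continuous_green_left x).aestronglyMeasurable ?_
  filter_upwards [ae_space_mem] with y hy
  exact abs_green_le hx (Ioo_subset_Icc_self hy)

/-- Integration by parts. The potential becomes a double primitive that vanishes at 0, with initial
slope -∫(1 - y)f, which is the slope that makes it vanish at 1 as well. -/
theorem integral_green_eq {f : ℝ → ℝ} (hf : Integrable f spaceMeasure) {x : ℝ}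
    (hx : x ∈ Icc (0 : ℝ) 1) :
    ∫ y in Ioo (0 : ℝ) 1, green x y * f y =
      ∫ z in (0 : ℝ)..x, (-(∫ y in Ioo (0 : ℝ) 1, (1 - y) * f y) + ∫ y in (0 : ℝ)..z, f y) := by
  have hi := intervalIntegrable_of_space hf
  have hix : IntervalIntegrable f volume 0 x :=
    hi.mono_set (by rw [uIcc_of_le hx.1, uIcc_of_le zero_le_one]; exact Icc_subset_Icc_right hx.2)
  have hix1 : IntervalIntegrable f volume x 1 :=
    hi.mono_set (by rw [uIcc_of_le hx.2, uIcc_of_le zero_le_one]; exact Icc_subset_Icc_left hx.1)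
  have hac := hix.absolutelyContinuousOnInterval_intervalIntegral (c := 0) (by simp)
  have hac2 : AbsolutelyContinuousOnInterval (fun y : ℝ => y - x) 0 x :=
    (contDiff_id.sub contDiff_const : ContDiff ℝ 1 _).contDiffOn.absolutelyContinuousOnInterval
  have key := hac.integral_mul_deriv_eq_deriv_mul hac2
  have hd : ∫ z in (0 : ℝ)..x, deriv (fun x => ∫ y in (0 : ℝ)..x, f y) z * (z - x) =
      ∫ z in (0 : ℝ)..x, f z * (z - x) := by
    apply intervalIntegral.integral_congr_ae
    filter_upwards [hix.ae_hasDerivAt_integral] with z hz hz'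
    rw [(hz (uIoc_subset_uIcc hz') 0 (by simp)).deriv]
  rw [hd] at key
  simp only [deriv_sub_const, deriv_id'', mul_one, sub_self, mul_zero, zero_sub,
    intervalIntegral.integral_same, zero_mul] at key
  have hm : ∀ g : ℝ → ℝ, Continuous g → IntervalIntegrable (fun y => g y * f y) volume 0 1 :=
    fun g hg => hi.continuousOn_mul hg.continuousOn
  have e1 : ∫ y in Ioo (0 : ℝ) 1, max (x - y) 0 * f y = -∫ z in (0 : ℝ)..x, f z * (z - x) := by
    rw [integral_space_eq, ← intervalIntegral.integral_add_adjacent_intervals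
      (hix.continuousOn_mul (g := fun y => max (x - y) 0) (by fun_prop))
      (hix1.continuousOn_mul (g := fun y => max (x - y) 0) (by fun_prop)),
      ← intervalIntegral.integral_neg]
    have a1 : ∫ y in (0 : ℝ)..x, max (x - y) 0 * f y = ∫ y in (0 : ℝ)..x, -(f y * (y - x)) := by
      apply intervalIntegral.integral_congr
      intro y hy
      rw [uIcc_of_le hx.1] at hy
      simp only
      rw [max_eq_left (by linarith [hy.2])]
      ring
    have a2 : ∫ y in x..1, max (x - y) 0 * f y = ∫ y in x..1, (0 : ℝ) := by
      apply intervalIntegral.integral_congr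
      intro y hy
      rw [uIcc_of_le hx.2] at hy
      simp only
      rw [max_eq_right (by linarith [hy.1]), zero_mul]
    rw [a1, a2, intervalIntegral.integral_zero, add_zero]
  have e2 : ∫ y in Ioo (0 : ℝ) 1, green x y * f y = (∫ y in Ioo (0 : ℝ) 1, max (x - y) 0 * f y) -
      x * ∫ y in Ioo (0 : ℝ) 1, (1 - y) * f y := by
    rw [← integral_const_mul, ← integral_sub]
    · congr 1; ext y; rw [green]; ring
    · rw [← IntegrableOn, ← intervalIntegrable_iff_integrableOn_Ioo_of_le zero_le_one]
      exact hm _ (by fun_prop)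
    · refine Integrable.const_mul ?_ _
      rw [← IntegrableOn, ← intervalIntegrable_iff_integrableOn_Ioo_of_le zero_le_one]
      exact hm _ (by fun_prop)
  rw [e2, e1, ← key, intervalIntegral.integral_add (by simp) hac.continuousOn.intervalIntegrable]
  simp
  ring

theorem memLp_green_space {f : ℝ → ℝ} (hf : Integrable f spaceMeasure) :
    MemLp (fun x => ∫ y in Ioo (0 : ℝ) 1, green x y * f y) 2 spaceMeasure := by
  refine MemLp.of_bound ?_ (∫ y in Ioo (0 : ℝ) 1, ‖f y‖) ?_
  · exact (continuous_green.aestronglyMeasurable.mul hf.1.comp_snd).integral_prod_right'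
  · filter_upwards [ae_space_mem] with x hx
    refine norm_integral_le_of_norm_le hf.norm ?_
    filter_upwards [ae_space_mem] with y hy
    rw [norm_mul]
    exact mul_le_of_le_one_left (norm_nonneg _)
      (abs_green_le (Ioo_subset_Icc_self hx) (Ioo_subset_Icc_self hy))

/-- `H² ∩ H¹₀` is the image of `L²` under Green's operator. -/
theorem isV_iff {f f₂ : ℝ → ℝ} : IsV f f₂ ↔ MemLp f₂ 2 spaceMeasure ∧
    ∀ x ∈ Icc (0 : ℝ) 1, f x = ∫ y in Ioo (0 : ℝ) 1, green x y * f₂ y := by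
  constructor
  · intro h
    refine ⟨h.memLp₂, ?_⟩
    obtain ⟨f₁, hf₁, h1, h2⟩ := h.weakDeriv
    have hf₂ := integrable_of_memLp_two h.memLp₂
    have hi := intervalIntegrable_of_space hf₂
    have hprim : Integrable (fun x => ∫ y in (0 : ℝ)..x, f₂ y) spaceMeasure := by
      have := (hi.absolutelyContinuousOnInterval_intervalIntegral (c := 0)
        (by simp)).continuousOn.intervalIntegrable (μ := volume)
      rwa [intervalIntegrable_iff_integrableOn_Ioo_of_le zero_le_one] at this
    have hsub : ∀ {a a' b b' : ℝ → ℝ}, Integrable a spaceMeasure → Integrable b spaceMeasure →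
        Integrable a' spaceMeasure → Integrable b' spaceMeasure →
        IsWeakDeriv a a' → IsWeakDeriv b b' →
        IsWeakDeriv (fun x => a x - b x) (fun x => a' x - b' x) := by
      intro a a' b b' ha hb ha' hb' hA hB φ h1 h2 h3
      have hd : Continuous (deriv φ) := h1.continuous_deriv (by exact_mod_cast le_top)
      obtain ⟨C, hC⟩ := h2.exists_bound_of_continuous h1.continuous
      obtain ⟨D, hD⟩ := h2.deriv.exists_bound_of_continuous hd
      have i1 : ∀ {g : ℝ → ℝ}, Integrable g spaceMeasure →
          Integrable (fun x => g x * φ x) spaceMeasure := fun hg =>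
        hg.mul_bdd (c := C) h1.continuous.aestronglyMeasurable (ae_of_all _ hC)
      have i2 : ∀ {g : ℝ → ℝ}, Integrable g spaceMeasure →
          Integrable (fun x => g x * deriv φ x) spaceMeasure := fun hg =>
        hg.mul_bdd (c := D) hd.aestronglyMeasurable (ae_of_all _ hD)
      simp only [sub_mul]
      rw [integral_sub (i2 ha) (i2 hb), integral_sub (i1 ha') (i1 hb'), hA φ h1 h2 h3,
        hB φ h1 h2 h3]
      ring
    have hW2 : IsWeakDeriv (fun x => ∫ y in (0 : ℝ)..x, f₂ y) f₂ :=
      isWeakDeriv_of_primitive (c := 0) hf₂ fun x _ => by simp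
    have hf₁i := integrable_of_memLp_two hf₁
    -- `f₁` and the primitive of `f₂` have the same weak derivative, so they differ by a constant;
    -- the same argument is used again for `f` and the primitive of `F₁`. Continuity removes the
    -- exceptional null set, and the boundary values at 0 and 1 determine the two constants.
    obtain ⟨c, hc⟩ := exists_const_of_isWeakDeriv_zero (hf₁i.sub hprim)
      (by filter_upwards with x; simp) (hsub hf₁i hprim hf₂ hf₂ h2 hW2)
    set F₁ : ℝ → ℝ := fun z => c + ∫ y in (0 : ℝ)..z, f₂ y with hF₁
    have hF₁i : Integrable F₁ spaceMeasure := (integrable_const c).add hprim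
    have hac1 := (intervalIntegrable_of_space hF₁i).absolutelyContinuousOnInterval_intervalIntegral
      (c := 0) (by simp)
    have hF : Integrable (fun x => ∫ z in (0 : ℝ)..x, F₁ z) spaceMeasure := by
      have := hac1.continuousOn.intervalIntegrable (μ := volume)
      rwa [intervalIntegrable_iff_integrableOn_Ioo_of_le zero_le_one] at this
    obtain ⟨d, hd⟩ := exists_const_of_isWeakDeriv_zero ((integrable_of_memLp_two h.memLp).sub hF)
      (by filter_upwards [hc] with x hx
          simp only [hF₁, Pi.zero_apply, Pi.sub_apply] at hx ⊢
          linarith)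
      (hsub (integrable_of_memLp_two h.memLp) hF hf₁i hF₁i h1
        (isWeakDeriv_of_primitive (c := 0) hF₁i fun x _ => by simp))
    have hcont : ContinuousOn (fun x => f x - ∫ z in (0 : ℝ)..x, F₁ z) (Icc 0 1) := by
      have := hac1.continuousOn
      rw [uIcc_of_le zero_le_one] at this
      exact h.continuousOn.sub this
    have hall : ∀ x ∈ Icc (0 : ℝ) 1, f x - ∫ z in (0 : ℝ)..x, F₁ z = d := by
      have h3 : EqOn (fun x => f x - ∫ z in (0 : ℝ)..x, F₁ z) (fun _ => d) (Ioo 0 1) :=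
        Measure.eqOn_Ioo_of_ae_eq volume hd (hcont.mono Ioo_subset_Icc_self) continuousOn_const
      have h4 := h3.of_subset_closure hcont continuousOn_const Ioo_subset_Icc_self
        (by rw [closure_Ioo zero_ne_one])
      exact fun x hx => h4 hx
    have hd0 : d = 0 := by
      have := hall 0 (by simp)
      rw [h.left] at this
      simpa using this.symm
    have hf_eq : ∀ x ∈ Icc (0 : ℝ) 1, f x = c * x + ((∫ y in Ioo (0 : ℝ) 1, green x y * f₂ y) +
        x * ∫ y in Ioo (0 : ℝ) 1, (1 - y) * f₂ y) := by
      intro x hx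
      have h3 := hall x hx
      have h5 : IntervalIntegrable (fun z => ∫ y in (0 : ℝ)..z, f₂ y) volume 0 x :=
        (intervalIntegrable_of_space hprim).mono_set
          (by rw [uIcc_of_le hx.1, uIcc_of_le zero_le_one]; exact Icc_subset_Icc_right hx.2)
      rw [integral_green_eq hf₂ hx, intervalIntegral.integral_add (by simp) h5]
      rw [hF₁, intervalIntegral.integral_add (by simp) h5, hd0] at h3
      simp only [intervalIntegral.integral_const, sub_zero, smul_eq_mul] at h3 ⊢
      linarith
    have hg1 : ∫ y in Ioo (0 : ℝ) 1, green 1 y * f₂ y = 0 := by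
      rw [setIntegral_congr_fun (g := fun _ => 0) measurableSet_Ioo]
      · simp
      · intro y hy
        simp only
        rw [green, max_eq_left (by linarith [hy.2])]
        ring
    have h6 := hf_eq 1 (by simp)
    rw [h.right, hg1] at h6
    intro x hx
    rw [hf_eq x hx]
    linear_combination (-x) * h6
  · rintro ⟨h2, h⟩
    have hf₂ := integrable_of_memLp_two h2
    have hi := intervalIntegrable_of_space hf₂
    set c := -(∫ y in Ioo (0 : ℝ) 1, (1 - y) * f₂ y) with hc
    have hac := (hi.absolutelyContinuousOnInterval_intervalIntegral (c := 0) (by simp)).continuousOn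
    rw [uIcc_of_le zero_le_one] at hac
    have hF₁c : ContinuousOn (fun z => c + ∫ y in (0 : ℝ)..z, f₂ y) (Icc 0 1) :=
      continuousOn_const.add hac
    have hF₁i : Integrable (fun z => c + ∫ y in (0 : ℝ)..z, f₂ y) spaceMeasure :=
      (hF₁c.integrableOn_Icc).mono_set Ioo_subset_Icc_self
    obtain ⟨D, hD⟩ := isCompact_Icc.exists_bound_of_continuousOn hF₁c
    have hf_eq : ∀ x ∈ Icc (0 : ℝ) 1, f x = ∫ z in (0 : ℝ)..x, (c + ∫ y in (0 : ℝ)..z, f₂ y) :=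
      fun x hx => by rw [h x hx, integral_green_eq hf₂ hx]
    refine ⟨?_, h2, ⟨fun z => c + ∫ y in (0 : ℝ)..z, f₂ y, ?_, ?_, ?_⟩, ?_, ?_, ?_⟩
    · refine (memLp_green_space hf₂).ae_eq ?_
      filter_upwards [ae_space_mem] with x hx
      exact (h x (Ioo_subset_Icc_self hx)).symm
    · refine MemLp.of_bound hF₁i.1 D ?_
      filter_upwards [ae_space_mem] with x hx using hD x (Ioo_subset_Icc_self hx)
    · exact isWeakDeriv_of_primitive (c := 0) hF₁i fun x hx => by
        rw [hf_eq x (Ioo_subset_Icc_self hx), zero_add]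
    · exact isWeakDeriv_of_primitive hf₂ fun x _ => rfl
    · have := ((intervalIntegrable_of_space hF₁i).absolutelyContinuousOnInterval_intervalIntegral
        (c := 0) (by simp)).continuousOn
      rw [uIcc_of_le zero_le_one] at this
      exact this.congr hf_eq
    · rw [hf_eq 0 (by simp)]; simp
    · rw [h 1 (by simp), setIntegral_congr_fun (g := fun _ => 0) measurableSet_Ioo]
      · simp
      · intro y hy
        simp only
        rw [green, max_eq_left (by linarith [hy.2])]
        ring

/-- `f` is the second weak derivative of its potential, and weak derivatives of a function that
vanishes almost everywhere vanish. -/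
theorem ae_eq_zero_of_green {f : ℝ → ℝ} (hf : MemLp f 2 spaceMeasure)
    (h : ∀ᵐ x ∂spaceMeasure, ∫ y in Ioo (0 : ℝ) 1, green x y * f y = 0) :
    f =ᵐ[spaceMeasure] 0 := by
  have hV : IsV (fun x => ∫ y in Ioo (0 : ℝ) 1, green x y * f y) f := isV_iff.2 ⟨hf, fun _ _ => rfl⟩
  obtain ⟨f₁, h1, h2, h3⟩ := hV.weakDeriv
  exact ae_eq_zero_of_isWeakDeriv
    (ae_eq_zero_of_isWeakDeriv h (integrable_of_memLp_two h1) h2) (integrable_of_memLp_two hf) h3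

end Green

/-! ### Green's operator and time integration on the space-time cylinder -/

section SpaceTime

/-- Lebesgue measure on the space-time cylinder. -/
noncomputable abbrev cylMeasure (τ : ℝ) : Measure (ℝ × ℝ) := (timeMeasure τ).prod spaceMeasure

/-- The Hilbert space `L²((0,τ) × (0,1))`. -/
noncomputable abbrev SpaceTime (τ : ℝ) := Lp ℝ 2 (cylMeasure τ)

/-- The Hilbert space `L²(0,τ)` of controls. -/
noncomputable abbrev Control (τ : ℝ) := Lp ℝ 2 (timeMeasure τ)

theorem inner_toLp {α : Type*} [MeasurableSpace α] {m : Measure α} {f g : α → ℝ}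
    (hf : MemLp f 2 m) (hg : MemLp g 2 m) :
    ⟪hf.toLp f, hg.toLp g⟫_ℝ = ∫ x, f x * g x ∂m := by
  rw [L2.inner_def]
  refine integral_congr_ae ?_
  filter_upwards [hf.coeFn_toLp, hg.coeFn_toLp] with x h1 h2
  rw [h1, h2]
  simp [mul_comm]

theorem norm_sq_toLp {α : Type*} [MeasurableSpace α] {m : Measure α} {f : α → ℝ}
    (hf : MemLp f 2 m) : ‖hf.toLp f‖ ^ 2 = ∫ x, f x ^ 2 ∂m := by
  rw [← real_inner_self_eq_norm_sq, inner_toLp]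
  simp only [sq]

theorem ae_eq_zero_of_ae_ae {α β : Type*} [MeasurableSpace α] [MeasurableSpace β] {m : Measure α}
    {n : Measure β} [SFinite m] [SFinite n] {f : α × β → ℝ}
    (hf : AEStronglyMeasurable f (m.prod n)) (h : ∀ᵐ a ∂m, ∀ᵐ b ∂n, f (a, b) = 0) :
    f =ᵐ[m.prod n] 0 := by
  -- Recombining null sections into a product null set requires a measurable zero set, hence the
  -- measurable representative.
  have h1 : ∀ᵐ a ∂m, ∀ᵐ b ∂n, hf.mk f (a, b) = 0 := by
    filter_upwards [h, Measure.ae_ae_of_ae_prod hf.ae_eq_mk] with a h1 h2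
    filter_upwards [h1, h2] with b h3 h4
    rw [← h4, h3]
  have hms : MeasurableSet {p | hf.mk f p = 0} :=
    hf.stronglyMeasurable_mk.measurable (measurableSet_singleton 0)
  have h2 := (Measure.ae_prod_iff_ae_ae hms).2 h1
  filter_upwards [h2, hf.ae_eq_mk] with p h3 h4
  rw [h4, h3, Pi.zero_apply]

theorem ae_eq_zero_of_ae_ae_swap {α β : Type*} [MeasurableSpace α] [MeasurableSpace β]
    {m : Measure α} {n : Measure β} [SFinite m] [SFinite n] {f : α × β → ℝ}
    (hf : AEStronglyMeasurable f (m.prod n)) (h : ∀ᵐ b ∂n, ∀ᵐ a ∂m, f (a, b) = 0) :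
    f =ᵐ[m.prod n] 0 := by
  have h1 := ae_eq_zero_of_ae_ae (m := n) (n := m) hf.prod_swap h
  exact Measure.measurePreserving_swap.quasiMeasurePreserving.ae h1

theorem ae_ae_swap_of_ae_prod {α β : Type*} [MeasurableSpace α] [MeasurableSpace β]
    {m : Measure α} {n : Measure β} [SFinite m] [SFinite n] {p : α × β → Prop}
    (h : ∀ᵐ z ∂(m.prod n), p z) : ∀ᵐ b ∂n, ∀ᵐ a ∂m, p (a, b) :=
  Measure.ae_ae_of_ae_prod
    ((Measure.measurePreserving_swap (μ := n) (ν := m)).quasiMeasurePreserving.ae h)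

theorem measurePreserving_swap_right {α β : Type*} [MeasurableSpace α] [MeasurableSpace β]
    (m : Measure α) (n : Measure β) [SFinite m] [SFinite n] :
    MeasurePreserving (fun p : (α × β) × β => ((p.1.1, p.2), p.1.2))
      ((m.prod n).prod n) ((m.prod n).prod n) := by
  have h1 := measurePreserving_prodAssoc m n n
  have h2 : MeasurePreserving (Prod.map id Prod.swap) (m.prod (n.prod n)) (m.prod (n.prod n)) :=
    (MeasurePreserving.id m).prod Measure.measurePreserving_swap
  exact (h1.symm _).comp (h2.comp h1)

theorem measurePreserving_swap_left {α β : Type*} [MeasurableSpace α] [MeasurableSpace β]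
    (m : Measure α) (n : Measure β) [SFinite m] [SFinite n] :
    MeasurePreserving (fun p : (α × β) × α => ((p.2, p.1.2), p.1.1))
      ((m.prod n).prod m) ((m.prod n).prod m) := by
  have h1 : MeasurePreserving (fun p : (α × β) × α => ((p.1.2, p.1.1), p.2))
      ((m.prod n).prod m) ((n.prod m).prod m) :=
    Measure.measurePreserving_swap.prod (MeasurePreserving.id m)
  have h2 := measurePreserving_swap_right n m
  have h3 : MeasurePreserving (fun p : (β × α) × α => ((p.1.2, p.1.1), p.2))
      ((n.prod m).prod m) ((m.prod n).prod m) :=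
    Measure.measurePreserving_swap.prod (MeasurePreserving.id m)
  exact h3.comp (h2.comp h1)

theorem eLpNorm_le_of_bound_one {α : Type*} [MeasurableSpace α] {m : Measure α} [IsFiniteMeasure m]
    {f : α → ℝ} (hf : ∀ᵐ x ∂m, ‖f x‖ ≤ 1) : eLpNorm f 2 m ≤ (√(m.real univ)).toNNReal := by
  have h := eLpNorm_le_of_ae_bound (p := 2) hf
  refine h.trans ?_
  simp only [ENNReal.ofReal_one, mul_one]
  rw [← ENNReal.ofReal, Real.sqrt_eq_rpow, ← ENNReal.ofReal_rpow_of_nonneg measureReal_nonneg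
    (by norm_num), ofReal_measureReal]
  simp

/-- The indicator function of `s < t`. -/
noncomputable def before (s t : ℝ) : ℝ := if s < t then 1 else 0

theorem norm_before_le (s t : ℝ) : ‖before s t‖ ≤ 1 := by
  rw [before]; split_ifs <;> simp

theorem measurable_before : Measurable fun p : ℝ × ℝ => before p.1 p.2 :=
  Measurable.ite (measurableSet_lt measurable_fst measurable_snd) measurable_const measurable_const

theorem integral_before_mul {τ t : ℝ} (ht : t ∈ Icc 0 τ) (f : ℝ → ℝ) :
    ∫ s, before s t * f s ∂(timeMeasure τ) = ∫ s in (0 : ℝ)..t, f s := by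
  have h1 : ∀ s, before s t * f s = (Iio t).indicator f s := by
    intro s
    rw [before, indicator_apply]
    simp only [mem_Iio]
    split_ifs <;> simp
  simp_rw [h1]
  rw [integral_indicator measurableSet_Iio, Measure.restrict_restrict measurableSet_Iio,
    intervalIntegral.integral_of_le ht.1, integral_Ioc_eq_integral_Ioo]
  congr 2
  ext s
  simp only [mem_inter_iff, mem_Iio, mem_Ioo]
  constructor
  · rintro ⟨h1, h2, h3⟩; exact ⟨h2, h1⟩
  · rintro ⟨h2, h1⟩; exact ⟨h1, h2, h1.trans_le ht.2⟩

theorem ae_time_mem (τ : ℝ) : ∀ᵐ t ∂(timeMeasure τ), t ∈ Ioo 0 τ := ae_restrict_mem measurableSet_Ioo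

theorem ae_cyl_mem (τ : ℝ) : ∀ᵐ p ∂(cylMeasure τ), p.1 ∈ Ioo 0 τ ∧ p.2 ∈ Ioo (0 : ℝ) 1 := by
  filter_upwards [Measure.quasiMeasurePreserving_fst.ae (ae_time_mem τ),
    Measure.quasiMeasurePreserving_snd.ae ae_space_mem] with p h1 h2 using ⟨h1, h2⟩

/-- The exchange (t,x,y) ↦ (t,y,x) is its own inverse and the kernel is symmetric, so
`kernel_adjoint` with σ' = σ and k' = k gives symmetry of the operator. -/
theorem exists_greenOp (τ : ℝ) : ∃ T : SpaceTime τ →L[ℝ] SpaceTime τ,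
    (∀ (f : ℝ × ℝ → ℝ) (hf : MemLp f 2 (cylMeasure τ)),
      T (hf.toLp f) =ᵐ[cylMeasure τ] fun p => ∫ y in Ioo (0 : ℝ) 1, green p.2 y * f (p.1, y)) ∧
    ∀ f g, ⟪T f, g⟫_ℝ = ⟪f, T g⟫_ℝ := by
  have hσ := measurePreserving_swap_right (timeMeasure τ) spaceMeasure
  have hk : AEStronglyMeasurable (fun p : (ℝ × ℝ) × ℝ => green p.1.2 p.2)
      ((cylMeasure τ).prod spaceMeasure) :=
    (continuous_green.comp (by fun_prop : Continuous fun p : (ℝ × ℝ) × ℝ =>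
      (p.1.2, p.2))).aestronglyMeasurable
  have hC : ∀ᵐ p ∂(cylMeasure τ), eLpNorm (fun y => green p.2 y) 2 spaceMeasure ≤
      ((√(spaceMeasure.real univ)).toNNReal : ℝ≥0) := by
    filter_upwards [ae_cyl_mem τ] with p hp
    refine eLpNorm_le_of_bound_one ?_
    filter_upwards [ae_space_mem] with y hy
    exact abs_green_le (Ioo_subset_Icc_self hp.2) (Ioo_subset_Icc_self hy)
  obtain ⟨T, -, hT⟩ := exists_kernelOp hσ hk hC
  refine ⟨T, hT, fun f g => ?_⟩
  have h1 := kernel_adjoint hσ hk hC hσ (fun p => rfl) hk hC (fun p => green_comm _ _)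
    (Lp.memLp f) (Lp.memLp g)
  have h2 := hT f (Lp.memLp f)
  have h3 := hT g (Lp.memLp g)
  rw [Lp.toLp_coeFn] at h2 h3
  rw [L2.inner_def, L2.inner_def]
  refine Eq.trans (integral_congr_ae ?_) (h1.trans (integral_congr_ae ?_))
  · filter_upwards [h2] with p hp
    rw [hp]; simp [mul_comm]
  · filter_upwards [h3] with p hp
    rw [hp]; simp [mul_comm]

/-- Green's operator in the space variable. -/
noncomputable def greenOp (τ : ℝ) : SpaceTime τ →L[ℝ] SpaceTime τ := (exists_greenOp τ).choose

theorem greenOp_toLp {τ : ℝ} {f : ℝ × ℝ → ℝ} (hf : MemLp f 2 (cylMeasure τ)) :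
    greenOp τ (hf.toLp f) =ᵐ[cylMeasure τ]
      fun p => ∫ y in Ioo (0 : ℝ) 1, green p.2 y * f (p.1, y) :=
  (exists_greenOp τ).choose_spec.1 f hf

theorem greenOp_symm {τ : ℝ} (f g : SpaceTime τ) : ⟪greenOp τ f, g⟫_ℝ = ⟪f, greenOp τ g⟫_ℝ :=
  (exists_greenOp τ).choose_spec.2 f g

/-- The kernels of the forward and the backward primitive, the indicators of s < t and t < s, are
interchanged by exchanging the two times. -/
theorem exists_timeOp (τ : ℝ) : ∃ T S : SpaceTime τ →L[ℝ] SpaceTime τ,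
    (∀ (f : ℝ × ℝ → ℝ) (hf : MemLp f 2 (cylMeasure τ)),
      T (hf.toLp f) =ᵐ[cylMeasure τ] fun p => ∫ s, before s p.1 * f (s, p.2) ∂(timeMeasure τ)) ∧
    (∀ (f : ℝ × ℝ → ℝ) (hf : MemLp f 2 (cylMeasure τ)),
      S (hf.toLp f) =ᵐ[cylMeasure τ] fun p => ∫ s, before p.1 s * f (s, p.2) ∂(timeMeasure τ)) ∧
    T.adjoint = S := by
  have hσ := measurePreserving_swap_left (timeMeasure τ) spaceMeasure
  have hk : AEStronglyMeasurable (fun p : (ℝ × ℝ) × ℝ => before p.2 p.1.1)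
      ((cylMeasure τ).prod (timeMeasure τ)) :=
    (measurable_before.comp (by fun_prop : Measurable fun p : (ℝ × ℝ) × ℝ =>
      (p.2, p.1.1))).aestronglyMeasurable
  have hk' : AEStronglyMeasurable (fun p : (ℝ × ℝ) × ℝ => before p.1.1 p.2)
      ((cylMeasure τ).prod (timeMeasure τ)) :=
    (measurable_before.comp (by fun_prop : Measurable fun p : (ℝ × ℝ) × ℝ =>
      (p.1.1, p.2))).aestronglyMeasurable
  have hC : ∀ᵐ p ∂(cylMeasure τ), eLpNorm (fun s => before s p.1) 2 (timeMeasure τ) ≤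
      ((√((timeMeasure τ).real univ)).toNNReal : ℝ≥0) :=
    ae_of_all _ fun p => eLpNorm_le_of_bound_one (ae_of_all _ fun s => norm_before_le _ _)
  have hC' : ∀ᵐ p ∂(cylMeasure τ), eLpNorm (fun s => before p.1 s) 2 (timeMeasure τ) ≤
      ((√((timeMeasure τ).real univ)).toNNReal : ℝ≥0) :=
    ae_of_all _ fun p => eLpNorm_le_of_bound_one (ae_of_all _ fun s => norm_before_le _ _)
  obtain ⟨T, -, hT⟩ := exists_kernelOp hσ hk hC
  obtain ⟨S, -, hS⟩ := exists_kernelOp hσ hk' hC'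
  refine ⟨T, S, hT, hS, ?_⟩
  symm
  rw [ContinuousLinearMap.eq_adjoint_iff]
  intro g f
  have h1 := kernel_adjoint hσ hk hC hσ (fun p => rfl) hk' hC' (fun p => rfl)
    (Lp.memLp f) (Lp.memLp g)
  have h2 := hT f (Lp.memLp f)
  have h3 := hS g (Lp.memLp g)
  rw [Lp.toLp_coeFn] at h2 h3
  rw [L2.inner_def, L2.inner_def]
  refine Eq.symm (Eq.trans (integral_congr_ae ?_) (h1.trans (integral_congr_ae ?_)))
  · filter_upwards [h2] with p hp
    rw [hp]; simp
  · filter_upwards [h3] with p hp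
    rw [hp]; simp

/-- Integration in time from `0`. -/
noncomputable def timeOp (τ : ℝ) : SpaceTime τ →L[ℝ] SpaceTime τ := (exists_timeOp τ).choose

theorem timeOp_toLp {τ : ℝ} {f : ℝ × ℝ → ℝ} (hf : MemLp f 2 (cylMeasure τ)) :
    timeOp τ (hf.toLp f) =ᵐ[cylMeasure τ] fun p => ∫ s in (0 : ℝ)..p.1, f (s, p.2) := by
  filter_upwards [(exists_timeOp τ).choose_spec.choose_spec.1 f hf, ae_cyl_mem τ] with p hp hp'
  rw [← integral_before_mul (Ioo_subset_Icc_self hp'.1)]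
  exact hp

theorem timeOp_adjoint_toLp {τ : ℝ} {f : ℝ × ℝ → ℝ} (hf : MemLp f 2 (cylMeasure τ)) :
    (timeOp τ).adjoint (hf.toLp f) =ᵐ[cylMeasure τ]
      fun p => ∫ s, before p.1 s * f (s, p.2) ∂(timeMeasure τ) := by
  have h := (exists_timeOp τ).choose_spec.choose_spec
  have h2 : (timeOp τ).adjoint = (exists_timeOp τ).choose_spec.choose := h.2.2
  rw [h2]
  exact h.2.1 f hf

theorem MemLp.ae_section_time {τ : ℝ} {f : ℝ × ℝ → ℝ} (hf : MemLp f 2 (cylMeasure τ)) :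
    ∀ᵐ x ∂spaceMeasure, MemLp (fun s => f (s, x)) 2 (timeMeasure τ) :=
  MemLp.ae_section (hf.comp_measurePreserving
    (Measure.measurePreserving_swap (μ := spaceMeasure) (ν := timeMeasure τ)))

theorem ae_cyl_snd {τ : ℝ} {p : ℝ → Prop} (h : ∀ᵐ x ∂spaceMeasure, p x) :
    ∀ᵐ z ∂(cylMeasure τ), p z.2 := Measure.quasiMeasurePreserving_snd.ae h

theorem ae_cyl_fst {τ : ℝ} {p : ℝ → Prop} (h : ∀ᵐ t ∂(timeMeasure τ), p t) :
    ∀ᵐ z ∂(cylMeasure τ), p z.1 := Measure.quasiMeasurePreserving_fst.ae h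

/-- The two kernels add up to 1 off the diagonal, which is a null set. -/
theorem timeOp_add_adjoint_toLp {τ : ℝ} {f : ℝ × ℝ → ℝ} (hf : MemLp f 2 (cylMeasure τ)) :
    (timeOp τ + (timeOp τ).adjoint) (hf.toLp f) =ᵐ[cylMeasure τ]
      fun p => ∫ s, f (s, p.2) ∂(timeMeasure τ) := by
  rw [add_apply]
  filter_upwards [Lp.coeFn_add (timeOp τ (hf.toLp f)) ((timeOp τ).adjoint (hf.toLp f)),
    timeOp_toLp hf, timeOp_adjoint_toLp hf, ae_cyl_mem τ,
    ae_cyl_snd (MemLp.ae_section_time hf)] with p h1 h2 h3 h4 h5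
  have hi := integrable_of_memLp_two h5
  rw [h1, Pi.add_apply, h2, h3, ← integral_before_mul (Ioo_subset_Icc_self h4.1), ← integral_add]
  · refine integral_congr_ae ?_
    have : ∀ᵐ s ∂(timeMeasure τ), s ≠ p.1 := Measure.ae_ne _ _
    filter_upwards [this] with s hs
    rw [before, before]
    rcases lt_or_gt_of_ne hs with h | h
    · rw [if_pos h, if_neg h.not_gt]; ring
    · rw [if_pos h, if_neg h.not_gt]; ring
  · refine hi.bdd_mul (c := 1) ?_ (ae_of_all _ fun s => norm_before_le _ _)
    exact (measurable_before.comp measurable_prodMk_right).aestronglyMeasurable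
  · refine hi.bdd_mul (c := 1) ?_ (ae_of_all _ fun s => norm_before_le _ _)
    exact (measurable_before.comp measurable_prodMk_left).aestronglyMeasurable

theorem toLp_eq_of_ae {τ : ℝ} {f : ℝ × ℝ → ℝ} {F : SpaceTime τ} (h : F =ᵐ[cylMeasure τ] f) :
    ∃ hf : MemLp f 2 (cylMeasure τ), F = hf.toLp f := by
  have hf : MemLp f 2 (cylMeasure τ) := (Lp.memLp F).ae_eq h
  exact ⟨hf, Lp.ext (h.trans hf.coeFn_toLp.symm)⟩

theorem exists_toLp {τ : ℝ} (F : SpaceTime τ) :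
    ∃ (f : ℝ × ℝ → ℝ) (hf : MemLp f 2 (cylMeasure τ)), F = hf.toLp f :=
  ⟨F, Lp.memLp F, (Lp.toLp_coeFn F _).symm⟩

/-- Integration in time commutes with pairing in space. -/
theorem integral_mul_primitive {τ t : ℝ} (ht : t ∈ Icc 0 τ) {f : ℝ × ℝ → ℝ}
    (hf : MemLp f 2 (cylMeasure τ)) {Φ : ℝ → ℝ} (hΦ : MemLp Φ 2 spaceMeasure) :
    ∫ y in Ioo (0 : ℝ) 1, Φ y * ∫ s in (0 : ℝ)..t, f (s, y) =
      ∫ s in (0 : ℝ)..t, ∫ y in Ioo (0 : ℝ) 1, Φ y * f (s, y) := by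
  have hint : Integrable (fun p : ℝ × ℝ => before p.1 t * (Φ p.2 * f p)) (cylMeasure τ) := by
    refine Integrable.bdd_mul (c := 1) ?_ ?_ (ae_of_all _ fun s => norm_before_le _ _)
    · exact MemLp.integrable_mul (p := 2) (q := 2) (hΦ.comp_snd (timeMeasure τ)) hf
    · exact (measurable_before.comp
        (measurable_fst.prodMk measurable_const)).aestronglyMeasurable
  simp_rw [← integral_before_mul ht, ← integral_const_mul]
  rw [integral_integral_swap]
  · congr 1; ext y; congr 1; ext s; ring
  · refine hint.swap.congr (ae_of_all _ fun p => ?_)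
    simp only [Function.comp_apply, Function.uncurry, Prod.fst_swap, Prod.snd_swap, Prod.swap]
    ring

theorem memLp_green_left {x : ℝ} (hx : x ∈ Icc (0 : ℝ) 1) : MemLp (green x) 2 spaceMeasure := by
  refine MemLp.of_bound (continuous_green_left x).aestronglyMeasurable 1 ?_
  filter_upwards [ae_space_mem] with y hy
  exact abs_green_le hx (Ioo_subset_Icc_self hy)

theorem greenOp_timeOp {τ : ℝ} (F : SpaceTime τ) :
    greenOp τ (timeOp τ F) = timeOp τ (greenOp τ F) := by
  obtain ⟨f, hf, rfl⟩ := exists_toLp F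
  obtain ⟨h1, e1⟩ := toLp_eq_of_ae (timeOp_toLp hf)
  obtain ⟨h2, e2⟩ := toLp_eq_of_ae (greenOp_toLp hf)
  rw [e1, e2]
  apply Lp.ext
  filter_upwards [greenOp_toLp h1, timeOp_toLp h2, ae_cyl_mem τ] with p h3 h4 h5
  rw [h3, h4]
  exact integral_mul_primitive (Ioo_subset_Icc_self h5.1) hf
    (memLp_green_left (Ioo_subset_Icc_self h5.2))

theorem timeMeasure_real_univ {τ : ℝ} (hτ : 0 < τ) : (timeMeasure τ).real univ = τ := by
  simp [Measure.real, hτ.le]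

theorem timeOp_injective {τ : ℝ} (hτ : 0 < τ) (F : SpaceTime τ) (hF : timeOp τ F = 0) : F = 0 := by
  obtain ⟨f, hf, rfl⟩ := exists_toLp F
  have h1 := timeOp_toLp hf
  rw [hF] at h1
  have h2 := ae_ae_swap_of_ae_prod (h1.symm.trans (Lp.coeFn_zero ℝ 2 (cylMeasure τ)))
  apply Lp.ext
  refine hf.coeFn_toLp.trans (EventuallyEq.trans ?_ (Lp.coeFn_zero ℝ 2 _).symm)
  refine ae_eq_zero_of_ae_ae_swap hf.1 ?_
  filter_upwards [h2, MemLp.ae_section_time hf] with x h3 h4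
  have h5 := (ae_restrict_iff' measurableSet_Ioo).1 h3
  -- The implication in `S` admits all points outside (0,τ), so `S` has full measure in ℝ and is
  -- therefore dense.
  refine ae_eq_zero_of_primitive hτ.le (integrable_of_memLp_two h4)
    (S := {t | t ∈ Ioo 0 τ → ∫ s in (0 : ℝ)..t, f (s, x) = 0}) ?_ fun t ht => ht
  exact Measure.dense_of_ae h5

theorem greenOp_injective {τ : ℝ} (F : SpaceTime τ) (hF : greenOp τ F = 0) : F = 0 := by
  obtain ⟨f, hf, rfl⟩ := exists_toLp F
  have h1 := greenOp_toLp hf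
  rw [hF] at h1
  have h2 := Measure.ae_ae_of_ae_prod (h1.symm.trans (Lp.coeFn_zero ℝ 2 (cylMeasure τ)))
  apply Lp.ext
  refine hf.coeFn_toLp.trans (EventuallyEq.trans ?_ (Lp.coeFn_zero ℝ 2 _).symm)
  refine ae_eq_zero_of_ae_ae hf.1 ?_
  filter_upwards [h2, MemLp.ae_section hf] with t h3 h4
  exact ae_eq_zero_of_green h4 h3

theorem isVolterraPair {τ : ℝ} (hτ : 0 < τ) : IsVolterraPair τ (greenOp τ) (timeOp τ) where
  pos := hτ
  symm := greenOp_symm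
  comm := greenOp_timeOp
  inj := timeOp_injective hτ
  sq F := by
    obtain ⟨f, hf, rfl⟩ := exists_toLp F
    obtain ⟨h1, e1⟩ := toLp_eq_of_ae (timeOp_add_adjoint_toLp hf)
    rw [e1]
    apply Lp.ext
    filter_upwards [timeOp_add_adjoint_toLp h1, Lp.coeFn_smul τ (h1.toLp _), h1.coeFn_toLp]
      with p h2 h3 h4
    rw [h2, h3, Pi.smul_apply, h4, integral_const, timeMeasure_real_univ hτ]

theorem memLp_const_time {τ : ℝ} {g : ℝ → ℝ} (hg : MemLp g 2 spaceMeasure) :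
    MemLp (fun p : ℝ × ℝ => g p.2) 2 (cylMeasure τ) := hg.comp_snd _

theorem timeOp_add_adjoint_const {τ : ℝ} (hτ : 0 < τ) {g : ℝ → ℝ} (hg : MemLp g 2 spaceMeasure) :
    (timeOp τ + (timeOp τ).adjoint) ((memLp_const_time (τ := τ) hg).toLp _) =
      τ • (memLp_const_time (τ := τ) hg).toLp _ := by
  apply Lp.ext
  filter_upwards [timeOp_add_adjoint_toLp (memLp_const_time (τ := τ) hg),
    Lp.coeFn_smul τ ((memLp_const_time (τ := τ) hg).toLp _),
    (memLp_const_time (τ := τ) hg).coeFn_toLp] with p h2 h3 h4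
  rw [h2, h3, Pi.smul_apply, h4, integral_const, timeMeasure_real_univ hτ]

end SpaceTime

/-! ### Tensor products of controls with profiles in space -/

section Tensor

theorem memLp_tensor {τ : ℝ} {g : ℝ → ℝ} (hg : AEStronglyMeasurable g spaceMeasure) {C : ℝ}
    (hC : ∀ᵐ x ∂spaceMeasure, ‖g x‖ ≤ C) {u : ℝ → ℝ} (hu : MemLp u 2 (timeMeasure τ)) :
    MemLp (fun p : ℝ × ℝ => g p.2 * u p.1) 2 (cylMeasure τ) := by
  have h1 : MemLp (fun p : ℝ × ℝ => u p.1) 2 (cylMeasure τ) := hu.comp_fst _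
  refine (h1.const_mul C).mono (hg.comp_snd.mul h1.1) ?_
  filter_upwards [ae_cyl_snd hC] with p hp
  rw [norm_mul, norm_mul]
  gcongr
  exact hp.trans (le_abs_self C)

theorem exists_tensorOp (τ : ℝ) {g : ℝ → ℝ} (hg : AEStronglyMeasurable g spaceMeasure) {C : ℝ}
    (hC0 : 0 ≤ C) (hC : ∀ᵐ x ∂spaceMeasure, ‖g x‖ ≤ C) :
    ∃ T : Control τ →L[ℝ] SpaceTime τ, ‖T‖ ≤ C ∧
      ∀ (u : ℝ → ℝ) (hu : MemLp u 2 (timeMeasure τ)),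
        T (hu.toLp u) =ᵐ[cylMeasure τ] fun p => g p.2 * u p.1 := by
  -- A one-point fibre turns the kernel operator into multiplication by g after u has been lifted to
  -- space-time. Since (0,1) has mass one, the bound is exactly C.
  have hσ : MeasurePreserving (fun p : (ℝ × ℝ) × Unit => p.1)
      ((cylMeasure τ).prod (Measure.dirac ())) ((timeMeasure τ).prod spaceMeasure) :=
    measurePreserving_fst
  have hk : AEStronglyMeasurable (fun p : (ℝ × ℝ) × Unit => g p.1.2)
      ((cylMeasure τ).prod (Measure.dirac ())) :=
    (hg.comp_snd (μ := timeMeasure τ)).comp_fst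
  have hC' : ∀ᵐ p ∂(cylMeasure τ), eLpNorm (fun _ : Unit => g p.2) 2 (Measure.dirac ()) ≤
      C.toNNReal := by
    filter_upwards [ae_cyl_snd hC] with p hp
    rw [eLpNorm_const _ (by norm_num) (NeZero.ne _)]
    simp only [measure_univ, ENNReal.one_rpow, mul_one]
    rw [← ofReal_norm]
    exact ENNReal.ofReal_le_ofReal hp
  obtain ⟨T, hT1, hT2⟩ := exists_kernelOp hσ hk hC'
  refine ⟨T, ?_, fun u hu => ?_⟩
  · have : spaceMeasure.real univ = 1 := by simp [Measure.real]
    rw [this, Real.sqrt_one, mul_one, Real.coe_toNNReal _ hC0] at hT1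
    exact hT1
  · have := hT2 u hu
    simpa only [integral_dirac] using this

open Classical in
/-- The tensor product of a control with a bounded function of the space variable. -/
noncomputable def tensorOp (τ : ℝ) (g : ℝ → ℝ) : Control τ →L[ℝ] SpaceTime τ :=
  if h : ∃ T : Control τ →L[ℝ] SpaceTime τ, ∀ (u : ℝ → ℝ) (hu : MemLp u 2 (timeMeasure τ)),
    T (hu.toLp u) =ᵐ[cylMeasure τ] fun p => g p.2 * u p.1 then h.choose else 0

theorem tensorOp_toLp {τ : ℝ} {g : ℝ → ℝ} (hg : AEStronglyMeasurable g spaceMeasure) {C : ℝ}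
    (hC : ∀ᵐ x ∂spaceMeasure, ‖g x‖ ≤ C) {u : ℝ → ℝ} (hu : MemLp u 2 (timeMeasure τ)) :
    tensorOp τ g (hu.toLp u) = (memLp_tensor hg hC hu).toLp _ := by
  have h : ∃ T : Control τ →L[ℝ] SpaceTime τ, ∀ (u : ℝ → ℝ) (hu : MemLp u 2 (timeMeasure τ)),
      T (hu.toLp u) =ᵐ[cylMeasure τ] fun p => g p.2 * u p.1 := by
    obtain ⟨T, -, hT⟩ := exists_tensorOp τ hg (abs_nonneg C) (hC.mono fun x hx =>
      hx.trans (le_abs_self C))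
    exact ⟨T, hT⟩
  rw [tensorOp, dif_pos h]
  exact Lp.ext ((h.choose_spec u hu).trans (memLp_tensor hg hC hu).coeFn_toLp.symm)

theorem tensorOp_coeFn {τ : ℝ} {g : ℝ → ℝ} (hg : AEStronglyMeasurable g spaceMeasure) {C : ℝ}
    (hC : ∀ᵐ x ∂spaceMeasure, ‖g x‖ ≤ C) (u : Control τ) :
    tensorOp τ g u =ᵐ[cylMeasure τ] fun p => g p.2 * u p.1 := by
  have h := tensorOp_toLp hg hC (Lp.memLp u)
  rw [Lp.toLp_coeFn] at h
  rw [h]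
  exact (memLp_tensor hg hC (Lp.memLp u)).coeFn_toLp

theorem norm_tensorOp_le {τ : ℝ} {g : ℝ → ℝ} (hg : AEStronglyMeasurable g spaceMeasure) {C : ℝ}
    (hC0 : 0 ≤ C) (hC : ∀ᵐ x ∂spaceMeasure, ‖g x‖ ≤ C) : ‖tensorOp τ g‖ ≤ C := by
  obtain ⟨T, h1, h2⟩ := exists_tensorOp τ hg hC0 hC
  suffices h : tensorOp τ g = T from h ▸ h1
  ext1 u
  have h3 := h2 u (Lp.memLp u)
  rw [Lp.toLp_coeFn] at h3
  exact Lp.ext ((tensorOp_coeFn hg hC u).trans h3.symm)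

theorem tensorOp_add {τ : ℝ} {f g : ℝ → ℝ} (hf : AEStronglyMeasurable f spaceMeasure)
    (hg : AEStronglyMeasurable g spaceMeasure) {C D : ℝ} (hC : ∀ᵐ x ∂spaceMeasure, ‖f x‖ ≤ C)
    (hD : ∀ᵐ x ∂spaceMeasure, ‖g x‖ ≤ D) :
    tensorOp τ (fun x => f x + g x) = tensorOp τ f + tensorOp τ g := by
  ext1 u
  rw [add_apply]
  apply Lp.ext
  have hfg : ∀ᵐ x ∂spaceMeasure, ‖f x + g x‖ ≤ C + D := by
    filter_upwards [hC, hD] with x h1 h2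
    exact (norm_add_le _ _).trans (add_le_add h1 h2)
  filter_upwards [tensorOp_coeFn (hf.add hg) hfg u, tensorOp_coeFn hf hC u, tensorOp_coeFn hg hD u,
    Lp.coeFn_add (tensorOp τ f u) (tensorOp τ g u)] with p h1 h2 h3 h4
  rw [h4, Pi.add_apply, h2, h3]
  simp only [Pi.add_apply] at h1
  rw [← add_mul]
  exact h1

theorem tensorOp_smul {τ : ℝ} {f : ℝ → ℝ} (hf : AEStronglyMeasurable f spaceMeasure)
    {C : ℝ} (hC : ∀ᵐ x ∂spaceMeasure, ‖f x‖ ≤ C) (c : ℝ) :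
    tensorOp τ (fun x => c * f x) = c • tensorOp τ f := by
  ext1 u
  rw [smul_apply]
  apply Lp.ext
  have hcf : ∀ᵐ x ∂spaceMeasure, ‖c * f x‖ ≤ ‖c‖ * C := by
    filter_upwards [hC] with x h1
    rw [norm_mul]; gcongr
  filter_upwards [tensorOp_coeFn (hf.const_mul c) hcf u, tensorOp_coeFn hf hC u,
    Lp.coeFn_smul c (tensorOp τ f u)] with p h1 h2 h4
  rw [h4, Pi.smul_apply, h2, h1, smul_eq_mul, mul_assoc]

/-- Green's operator acts on the space factor of a tensor product. -/
theorem greenOp_tensorOp {τ : ℝ} {g : ℝ → ℝ} (hg : AEStronglyMeasurable g spaceMeasure) {C : ℝ}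
    (hC : ∀ᵐ x ∂spaceMeasure, ‖g x‖ ≤ C)
    {k : ℝ → ℝ} (hk : ∀ x ∈ Ioo (0 : ℝ) 1, k x = ∫ y in Ioo (0 : ℝ) 1, green x y * g y)
    (hkm : AEStronglyMeasurable k spaceMeasure) {D : ℝ} (hD : ∀ᵐ x ∂spaceMeasure, ‖k x‖ ≤ D)
    (u : Control τ) : greenOp τ (tensorOp τ g u) = tensorOp τ k u := by
  have h := tensorOp_toLp hg hC (Lp.memLp u)
  rw [Lp.toLp_coeFn] at h
  rw [h]
  apply Lp.ext
  filter_upwards [greenOp_toLp (memLp_tensor hg hC (Lp.memLp u)), tensorOp_coeFn hkm hD u,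
    ae_cyl_mem τ] with p h1 h2 h3
  rw [h1, h2, hk _ h3.2, ← integral_mul_const]
  simp only [mul_assoc]

/-- The inner product with a tensor product. -/
theorem inner_tensorOp {τ : ℝ} {g : ℝ → ℝ} (hg : AEStronglyMeasurable g spaceMeasure) {C : ℝ}
    (hC : ∀ᵐ x ∂spaceMeasure, ‖g x‖ ≤ C) {u : ℝ → ℝ} (hu : MemLp u 2 (timeMeasure τ))
    {q : ℝ × ℝ → ℝ} (hq : MemLp q 2 (cylMeasure τ)) :
    Integrable (fun t => u t * ∫ x in Ioo (0 : ℝ) 1, g x * q (t, x)) (timeMeasure τ) ∧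
    ⟪hq.toLp q, tensorOp τ g (hu.toLp u)⟫_ℝ =
      ∫ t in Ioo 0 τ, u t * ∫ x in Ioo (0 : ℝ) 1, g x * q (t, x) := by
  have hint : Integrable (fun p : ℝ × ℝ => q p * (g p.2 * u p.1)) (cylMeasure τ) :=
    MemLp.integrable_mul (p := 2) (q := 2) hq (memLp_tensor hg hC hu)
  have e : ∀ t, ∫ x in Ioo (0 : ℝ) 1, q (t, x) * (g x * u t) =
      u t * ∫ x in Ioo (0 : ℝ) 1, g x * q (t, x) := by
    intro t
    rw [← integral_const_mul]
    congr 1; ext x; ring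
  refine ⟨?_, ?_⟩
  · have := hint.integral_prod_left
    simpa only [e] using this
  · rw [tensorOp_toLp hg hC hu, inner_toLp, integral_prod _ hint]
    simp only [e]

end Tensor

/-! ### Fields and their classes in L² -/

section Fields

/-- The element of `L²((0,τ) × (0,1))` given by a field. -/
noncomputable def IsL2L2.cls {τ : ℝ} {f : ℝ → ℝ → ℝ} (h : IsL2L2 τ f) : SpaceTime τ :=
  MemLp.toLp (Function.uncurry f) h

theorem IsL2L2.coeFn_cls {τ : ℝ} {f : ℝ → ℝ → ℝ} (h : IsL2L2 τ f) :
    h.cls =ᵐ[cylMeasure τ] fun p => f p.1 p.2 := MemLp.coeFn_toLp h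

theorem IsL2L2.greenOp_cls {τ : ℝ} {f : ℝ → ℝ → ℝ} (h : IsL2L2 τ f) :
    greenOp τ h.cls =ᵐ[cylMeasure τ] fun p => ∫ y in Ioo (0 : ℝ) 1, green p.2 y * f p.1 y :=
  greenOp_toLp h

theorem IsL2L2.timeOp_cls {τ : ℝ} {f : ℝ → ℝ → ℝ} (h : IsL2L2 τ f) :
    timeOp τ h.cls =ᵐ[cylMeasure τ] fun p => ∫ s in (0 : ℝ)..p.1, f s p.2 :=
  timeOp_toLp h

theorem IsL2L2.green {τ : ℝ} {f : ℝ → ℝ → ℝ} (h : IsL2L2 τ f) :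
    IsL2L2 τ fun t x => ∫ y in Ioo (0 : ℝ) 1, green x y * f t y :=
  (Lp.memLp _).ae_eq h.greenOp_cls

theorem IsL2L2.primitive {τ : ℝ} {f : ℝ → ℝ → ℝ} (h : IsL2L2 τ f) :
    IsL2L2 τ fun t x => ∫ s in (0 : ℝ)..t, f s x :=
  (Lp.memLp _).ae_eq h.timeOp_cls

theorem IsL2L2.cls_eq_of_ae {τ : ℝ} {f : ℝ → ℝ → ℝ} (h : IsL2L2 τ f) {F : SpaceTime τ}
    (hF : F =ᵐ[cylMeasure τ] fun p => f p.1 p.2) : h.cls = F :=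
  Lp.ext (h.coeFn_cls.trans hF.symm)

theorem IsL2L2.cls_green {τ : ℝ} {f : ℝ → ℝ → ℝ} (h : IsL2L2 τ f) :
    h.green.cls = greenOp τ h.cls := h.green.cls_eq_of_ae h.greenOp_cls

theorem IsL2L2.cls_primitive {τ : ℝ} {f : ℝ → ℝ → ℝ} (h : IsL2L2 τ f) :
    h.primitive.cls = timeOp τ h.cls := h.primitive.cls_eq_of_ae h.timeOp_cls

theorem isL2L2_const_time (τ : ℝ) {g : ℝ → ℝ} (hg : MemLp g 2 spaceMeasure) :
    IsL2L2 τ fun _ x => g x := memLp_const_time hg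

theorem IsL2L2.add {τ : ℝ} {f g : ℝ → ℝ → ℝ} (hf : IsL2L2 τ f) (hg : IsL2L2 τ g) :
    IsL2L2 τ fun t x => f t x + g t x := MemLp.add hf hg

theorem IsL2L2.const_mul {τ : ℝ} {f : ℝ → ℝ → ℝ} (hf : IsL2L2 τ f) (c : ℝ) :
    IsL2L2 τ fun t x => c * f t x := MemLp.const_mul hf c

theorem IsL2L2.cls_add {τ : ℝ} {f g : ℝ → ℝ → ℝ} (hf : IsL2L2 τ f) (hg : IsL2L2 τ g) :
    (hf.add hg).cls = hf.cls + hg.cls := rfl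

theorem IsL2L2.cls_const_mul {τ : ℝ} {f : ℝ → ℝ → ℝ} (hf : IsL2L2 τ f) (c : ℝ) :
    (hf.const_mul c).cls = c • hf.cls := rfl

theorem IsL2L2.ae_section {τ : ℝ} {f : ℝ → ℝ → ℝ} (h : IsL2L2 τ f) :
    ∀ᵐ t ∂(timeMeasure τ), MemLp (f t) 2 spaceMeasure := MemLp.ae_section h

theorem IsL2L2.inner_cls {τ : ℝ} {f g : ℝ → ℝ → ℝ} (hf : IsL2L2 τ f) (hg : IsL2L2 τ g) :
    Integrable (fun p : ℝ × ℝ => f p.1 p.2 * g p.1 p.2) (cylMeasure τ) ∧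
    ⟪hf.cls, hg.cls⟫_ℝ = ∫ p, f p.1 p.2 * g p.1 p.2 ∂(cylMeasure τ) :=
  ⟨MemLp.integrable_mul (p := 2) (q := 2) hf hg, inner_toLp hf hg⟩

theorem isV_zero : IsV 0 0 := isV_iff.2 ⟨MemLp.zero', fun x _ => by simp⟩

theorem IsL2L2.isL2V_green {τ : ℝ} {f : ℝ → ℝ → ℝ} (h : IsL2L2 τ f) :
    IsL2V τ (fun t x => ∫ y in Ioo (0 : ℝ) 1, Beam.green x y * f t y) f where
  memLp := h.green
  memLp_xx := h
  section_mem := by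
    filter_upwards [h.ae_section] with t ht
    exact isV_iff.2 ⟨ht, fun _ _ => rfl⟩

theorem IsL2L2.isL2V_primitive {τ : ℝ} {f : ℝ → ℝ → ℝ} (h : IsL2L2 τ f) {w₀ w₀xx : ℝ → ℝ}
    (hw₀ : IsV w₀ w₀xx) :
    IsL2V τ (fun t x => w₀ x + ∫ s in (0 : ℝ)..t, ∫ y in Ioo (0 : ℝ) 1, Beam.green x y * f s y)
      (fun t x => w₀xx x + ∫ s in (0 : ℝ)..t, f s x) where
  memLp := (isL2L2_const_time τ hw₀.memLp).add h.green.primitive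
  memLp_xx := (isL2L2_const_time τ hw₀.memLp₂).add h.primitive
  section_mem := by
    filter_upwards [h.primitive.ae_section, ae_time_mem τ] with t h1 h2
    have h0 := isV_iff.1 hw₀
    refine isV_iff.2 ⟨h0.1.add h1, fun x hx => ?_⟩
    simp only [mul_add]
    rw [integral_add (integrable_green_mul (integrable_of_memLp_two h0.1) hx)
      (integrable_green_mul (integrable_of_memLp_two h1) hx), ← h0.2 x hx]
    congr 1
    exact (integral_mul_primitive (Ioo_subset_Icc_self h2) (f := Function.uncurry f) h
      (memLp_green_left hx)).symm

theorem IsL2V.cls_eq {τ : ℝ} {f fxx : ℝ → ℝ → ℝ} (h : IsL2V τ f fxx) :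
    h.memLp.cls = greenOp τ h.memLp_xx.cls := by
  rw [← IsL2L2.cls_green]
  apply Lp.ext
  refine h.memLp.coeFn_cls.trans (EventuallyEq.trans ?_ h.memLp_xx.green.coeFn_cls.symm)
  filter_upwards [ae_cyl_fst h.section_mem, ae_cyl_mem τ] with p h1 h2
  exact (isV_iff.1 h1).2 _ (Ioo_subset_Icc_self h2.2)

/-- The class in `L²((0,τ) × (0,1))` of a function of the space variable. -/
noncomputable def constCls (τ : ℝ) {g : ℝ → ℝ} (hg : MemLp g 2 spaceMeasure) : SpaceTime τ :=
  (isL2L2_const_time τ hg).cls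

/-- The relation between displacement and velocity is given without derivatives. It passes to second
space derivatives because Green's operator commutes with time integration and is injective. -/
theorem cls_xx_of_primitive {τ : ℝ} {w wxx v vxx : ℝ → ℝ → ℝ} {w₀ w₀xx : ℝ → ℝ}
    (hw : IsL2V τ w wxx) (hv : IsL2V τ v vxx) (hw₀ : IsV w₀ w₀xx)
    (h : ∀ t ∈ Icc 0 τ, ∀ x ∈ Icc (0 : ℝ) 1, w t x = w₀ x + ∫ s in (0 : ℝ)..t, v s x) :
    hw.memLp_xx.cls = constCls τ hw₀.memLp₂ + timeOp τ hv.memLp_xx.cls := by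
  have h1 : hw.memLp.cls = constCls τ hw₀.memLp + timeOp τ hv.memLp.cls := by
    rw [← IsL2L2.cls_primitive, constCls, ← IsL2L2.cls_add]
    apply Lp.ext
    refine hw.memLp.coeFn_cls.trans (EventuallyEq.trans ?_ (IsL2L2.coeFn_cls _).symm)
    filter_upwards [ae_cyl_mem τ] with p hp
    exact h _ (Ioo_subset_Icc_self hp.1) _ (Ioo_subset_Icc_self hp.2)
  have h2 : constCls τ hw₀.memLp = greenOp τ (constCls τ hw₀.memLp₂) := by
    rw [constCls, constCls, ← IsL2L2.cls_green]
    apply Lp.ext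
    refine (IsL2L2.coeFn_cls _).trans (EventuallyEq.trans ?_ (IsL2L2.coeFn_cls _).symm)
    filter_upwards [ae_cyl_mem τ] with p hp
    exact (isV_iff.1 hw₀).2 _ (Ioo_subset_Icc_self hp.2)
  rw [← sub_eq_zero]
  apply greenOp_injective
  rw [map_sub, map_add, ← hw.cls_eq, h1, h2, greenOp_timeOp, ← hv.cls_eq, sub_self]

end Fields

theorem integral_sub_sub {α : Type*} [MeasurableSpace α] {m : Measure α} {f g k : α → ℝ}
    (hf : Integrable f m) (hg : Integrable g m) (hk : Integrable k m) :
    ∫ x, (f x - g x - k x) ∂m = ∫ x, f x ∂m - ∫ x, g x ∂m - ∫ x, k x ∂m := by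
  rw [integral_sub (show Integrable (fun x => f x - g x) m from hf.sub hg) hk, integral_sub hf hg]

theorem integral_add_add {α : Type*} [MeasurableSpace α] {m : Measure α} {f g k : α → ℝ}
    (hf : Integrable f m) (hg : Integrable g m) (hk : Integrable k m) :
    ∫ x, (f x + g x + k x) ∂m = ∫ x, f x ∂m + ∫ x, g x ∂m + ∫ x, k x ∂m := by
  rw [integral_add (show Integrable (fun x => f x + g x) m from hf.add hg) hk, integral_add hf hg]

/-! ### Pairing the integrated equation with test functions in space -/

section WeakForm

theorem integrable_mul_of_memLp {f g : ℝ → ℝ} (hf : MemLp f 2 spaceMeasure)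
    (hg : MemLp g 2 spaceMeasure) : Integrable (fun x => f x * g x) spaceMeasure :=
  MemLp.integrable_mul (p := 2) (q := 2) hf hg

theorem integral_green_symm {f Φ : ℝ → ℝ} (hf : MemLp f 2 spaceMeasure)
    (hΦ : MemLp Φ 2 spaceMeasure) :
    ∫ x in Ioo (0 : ℝ) 1, Φ x * ∫ y in Ioo (0 : ℝ) 1, green x y * f y =
      ∫ x in Ioo (0 : ℝ) 1, f x * ∫ y in Ioo (0 : ℝ) 1, green x y * Φ y := by
  simp_rw [← integral_const_mul]
  rw [integral_integral_swap]
  · congr 1; ext x; congr 1; ext y; rw [green_comm]; ring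
  · have h1 : Integrable (fun p : ℝ × ℝ => Φ p.1 * f p.2) (spaceMeasure.prod spaceMeasure) :=
      (integrable_of_memLp_two hΦ).mul_prod (integrable_of_memLp_two hf)
    have h2 := h1.bdd_mul (c := 1) (f := fun p : ℝ × ℝ => green p.1 p.2)
      continuous_green.aestronglyMeasurable (by
        filter_upwards [Measure.quasiMeasurePreserving_fst.ae ae_space_mem,
          Measure.quasiMeasurePreserving_snd.ae ae_space_mem] with p h3 h4
        exact abs_green_le (Ioo_subset_Icc_self h3) (Ioo_subset_Icc_self h4))
    refine h2.congr (ae_of_all _ fun p => ?_)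
    simp only [Function.uncurry]
    ring

/-- Pairing the twice integrated equation with `Φ` is the weak form with `φ_xx = Φ`. -/
theorem pairing_ae_eq {τ μ : ℝ} {a F b : ℝ → ℝ → ℝ} (ha : IsL2L2 τ a) (hF : IsL2L2 τ F)
    (hb : IsL2L2 τ b) {v₀ : ℝ → ℝ} (hv₀ : MemLp v₀ 2 spaceMeasure) {r : ℝ → ℝ → ℝ}
    (hr : IsL2L2 τ r)
    (hr_eq : hr.cls = greenOp τ ha.cls - greenOp τ (constCls τ hv₀) -
      timeOp τ (greenOp τ hF.cls - hb.cls - μ • greenOp τ ha.cls))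
    {φ Φ : ℝ → ℝ} (hφ : IsV φ Φ) :
    ∀ᵐ t ∂(timeMeasure τ), ∫ x in Ioo (0 : ℝ) 1, Φ x * r t x =
      (∫ x in Ioo (0 : ℝ) 1, a t x * φ x) - (∫ x in Ioo (0 : ℝ) 1, v₀ x * φ x) -
        ∫ s in (0 : ℝ)..t, ((∫ x in Ioo (0 : ℝ) 1, F s x * φ x) -
          (∫ x in Ioo (0 : ℝ) 1, b s x * Φ x) - μ * ∫ x in Ioo (0 : ℝ) 1, a s x * φ x) := by
  have hΦ := hφ.memLp₂
  -- Green's operator is symmetric and φ = GΦ, so pairing Gf with Φ is pairing f with φ.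
  have hpair : ∀ {f : ℝ → ℝ}, MemLp f 2 spaceMeasure →
      ∫ x in Ioo (0 : ℝ) 1, Φ x * ∫ y in Ioo (0 : ℝ) 1, green x y * f y =
        ∫ x in Ioo (0 : ℝ) 1, f x * φ x := by
    intro f hf
    rw [integral_green_symm hf hΦ]
    refine setIntegral_congr_fun measurableSet_Ioo fun x hx => ?_
    simp only [(isV_iff.1 hφ).2 x (Ioo_subset_Icc_self hx)]
  have hX : IsL2L2 τ fun t x => (∫ y in Ioo (0 : ℝ) 1, green x y * F t y) +
      (-1 * b t x + -μ * ∫ y in Ioo (0 : ℝ) 1, green x y * a t y) :=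
    hF.green.add ((hb.const_mul (-1)).add (ha.green.const_mul (-μ)))
  have hX_cls : hX.cls = greenOp τ hF.cls - hb.cls - μ • greenOp τ ha.cls := by
    have : hX.cls = hF.green.cls + ((-1 : ℝ) • hb.cls + (-μ) • ha.green.cls) := rfl
    rw [this, hF.cls_green, ha.cls_green]
    module
  have hsec : ∀ᵐ s ∂(timeMeasure τ), ∫ x in Ioo (0 : ℝ) 1, Φ x *
      ((∫ y in Ioo (0 : ℝ) 1, green x y * F s y) +
        (-1 * b s x + -μ * ∫ y in Ioo (0 : ℝ) 1, green x y * a s y)) =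
      (∫ x in Ioo (0 : ℝ) 1, F s x * φ x) -
          (∫ x in Ioo (0 : ℝ) 1, b s x * Φ x) - μ * ∫ x in Ioo (0 : ℝ) 1, a s x * φ x := by
    filter_upwards [ha.ae_section, hF.ae_section, hb.ae_section, ha.green.ae_section,
      hF.green.ae_section] with s h1 h2 h3 h4 h5
    rw [← hpair h1, ← hpair h2, ← integral_const_mul,
      ← integral_sub_sub (integrable_mul_of_memLp hΦ h5) (integrable_mul_of_memLp h3 hΦ)
        ((integrable_mul_of_memLp hΦ h4).const_mul μ)]
    congr 1; ext x; ring
  have hr2 : ∀ᵐ t ∂(timeMeasure τ), ∀ᵐ x ∂spaceMeasure,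
      r t x = (∫ y in Ioo (0 : ℝ) 1, green x y * a t y) -
        (∫ y in Ioo (0 : ℝ) 1, green x y * v₀ y) -
        ∫ s in (0 : ℝ)..t, ((∫ y in Ioo (0 : ℝ) 1, green x y * F s y) +
          (-1 * b s x + -μ * ∫ y in Ioo (0 : ℝ) 1, green x y * a s y)) := by
    refine Measure.ae_ae_of_ae_prod (p := fun p : ℝ × ℝ => r p.1 p.2 =
      (∫ y in Ioo (0 : ℝ) 1, green p.2 y * a p.1 y) -
        (∫ y in Ioo (0 : ℝ) 1, green p.2 y * v₀ y) -
        ∫ s in (0 : ℝ)..p.1, ((∫ y in Ioo (0 : ℝ) 1, green p.2 y * F s y) +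
          (-1 * b s p.2 + -μ * ∫ y in Ioo (0 : ℝ) 1, green p.2 y * a s y))) ?_
    have e : hr.cls = ha.green.cls + ((-1 : ℝ) • (isL2L2_const_time τ hv₀).green.cls +
        (-1 : ℝ) • hX.primitive.cls) := by
      rw [hr_eq, ha.cls_green, (isL2L2_const_time τ hv₀).cls_green, hX.cls_primitive, hX_cls, constCls]
      module
    have e2 : hr.cls = (ha.green.add (((isL2L2_const_time τ hv₀).green.const_mul (-1)).add
      (hX.primitive.const_mul (-1)))).cls := e
    have h1 := hr.coeFn_cls
    rw [e2] at h1
    filter_upwards [h1, (ha.green.add (((isL2L2_const_time τ hv₀).green.const_mul (-1)).add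
      (hX.primitive.const_mul (-1)))).coeFn_cls] with p h2 h3
    rw [← h2, h3]
    ring
  filter_upwards [hr2, ha.ae_section, ha.green.ae_section, hX.primitive.ae_section,
    ae_time_mem τ] with t h1 h2 h3 h4 h5
  have hg := memLp_green_space (integrable_of_memLp_two hv₀)
  have e1 : ∫ x in Ioo (0 : ℝ) 1, Φ x * r t x =
      (∫ x in Ioo (0 : ℝ) 1, Φ x * ∫ y in Ioo (0 : ℝ) 1, green x y * a t y) -
      (∫ x in Ioo (0 : ℝ) 1, Φ x * ∫ y in Ioo (0 : ℝ) 1, green x y * v₀ y) -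
      ∫ x in Ioo (0 : ℝ) 1, Φ x * ∫ s in (0 : ℝ)..t,
        ((∫ y in Ioo (0 : ℝ) 1, green x y * F s y) +
          (-1 * b s x + -μ * ∫ y in Ioo (0 : ℝ) 1, green x y * a s y)) := by
    rw [← integral_sub_sub (integrable_mul_of_memLp hΦ h3) (integrable_mul_of_memLp hΦ hg)
        (integrable_mul_of_memLp hΦ h4)]
    refine integral_congr_ae ?_
    filter_upwards [h1] with x hx
    rw [hx]
    ring
  rw [e1, hpair h2, hpair hv₀]
  congr 1
  refine (integral_mul_primitive (Ioo_subset_Icc_self h5) hX hΦ).trans ?_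
  apply intervalIntegral.integral_congr_ae
  have hsec' := (ae_restrict_iff' measurableSet_Ioo).1 hsec
  have hne : ∀ᵐ s : ℝ, s ≠ τ := Measure.ae_ne _ _
  filter_upwards [hsec', hne] with s h6 h7 h8
  rw [uIoc_of_le h5.1.le] at h8
  exact h6 ⟨h8.1, (h8.2.trans h5.2.le).lt_of_ne h7⟩

/-- A field whose pairings with all functions vanish is zero. -/
theorem cls_eq_zero_of_pairing {τ : ℝ} {r : ℝ → ℝ → ℝ} (hr : IsL2L2 τ r)
    (h : ∀ φ Φ : ℝ → ℝ, IsV φ Φ → ∀ᵐ t ∂(timeMeasure τ), ∫ x in Ioo (0 : ℝ) 1, Φ x * r t x = 0) :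
    hr.cls = 0 := by
  -- With φ_xx the indicator of (-∞,q), the pairing is the primitive of r(t,·) at q. Rational q
  -- suffice by density, and countably many of them share one exceptional null set of times.
  have h1 : ∀ q : ℚ, ∀ᵐ t ∂(timeMeasure τ), ∫ x in Ioo (0 : ℝ) 1, before x q * r t x = 0 := by
    intro q
    refine h (fun x => ∫ y in Ioo (0 : ℝ) 1, green x y * before y q) _
      (isV_iff.2 ⟨?_, fun _ _ => rfl⟩)
    refine MemLp.of_bound ?_ 1 (ae_of_all _ fun x => norm_before_le _ _)
    exact (measurable_before.comp measurable_prodMk_right).aestronglyMeasurable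
  rw [← ae_all_iff] at h1
  apply Lp.ext
  refine hr.coeFn_cls.trans (EventuallyEq.trans ?_ (Lp.coeFn_zero ℝ 2 _).symm)
  refine ae_eq_zero_of_ae_ae (f := fun p : ℝ × ℝ => r p.1 p.2) hr.1 ?_
  filter_upwards [h1, hr.ae_section] with t h2 h3
  refine ae_eq_zero_of_primitive zero_le_one (integrable_of_memLp_two h3)
    (S := range ((↑) : ℚ → ℝ)) Rat.denseRange_cast ?_
  rintro _ ⟨q, rfl⟩ hq
  rw [← integral_before_mul (Ioo_subset_Icc_self hq)]
  exact h2 q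

end WeakForm

/-! ### Weak solutions as solutions of the operator equation -/

section Solution

variable {Cd μ τ : ℝ} {w₀ w₀xx v₀ : ℝ → ℝ}

/-- The indicator function of a set. -/
noncomputable def chi (ω : Set ℝ) : ℝ → ℝ := ω.indicator fun _ => 1

theorem chi_measurable {ω : Set ℝ} (hω : MeasurableSet ω) :
    AEStronglyMeasurable (chi ω) spaceMeasure :=
  (stronglyMeasurable_const.indicator hω).aestronglyMeasurable

theorem norm_chi_le (ω : Set ℝ) (x : ℝ) : ‖chi ω x‖ ≤ 1 := by
  by_cases h : x ∈ ω <;> simp [chi, h]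

theorem isL2L2_load {ω : Set ℝ} (hω : MeasurableSet ω) {u : ℝ → ℝ} (hu : MemLp u 2 (timeMeasure τ)) :
    IsL2L2 τ fun t x => chi ω x * u t :=
  memLp_tensor (chi_measurable hω) (ae_of_all _ (norm_chi_le ω)) hu

theorem cls_load {ω : Set ℝ} (hω : MeasurableSet ω) {u : ℝ → ℝ} (hu : MemLp u 2 (timeMeasure τ)) :
    (isL2L2_load hω hu).cls = tensorOp τ (chi ω) (hu.toLp u) :=
  (tensorOp_toLp (chi_measurable hω) (ae_of_all _ (norm_chi_le ω)) hu).symm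

/-- The residual `R` of the operator equation, paired with φ_xx at time t, is the defect of the
time-integrated weak form for φ (`pairing_ae_eq`). All these defects vanish exactly when R = 0. -/
theorem weak_eq_iff {ω : Set ℝ} (hω : MeasurableSet ω) (hw₀ : IsV w₀ w₀xx)
    (hv₀ : MemLp v₀ 2 spaceMeasure) {u : ℝ → ℝ} (hu : MemLp u 2 (timeMeasure τ)) {z : Motion}
    (hw : IsL2V τ z.w z.wxx) (hv : IsL2V τ z.v z.vxx)
    (hd : ∀ t ∈ Icc 0 τ, ∀ x ∈ Icc (0 : ℝ) 1, z.w t x = w₀ x + ∫ s in (0 : ℝ)..t, z.v s x) :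
    IsWeakSolution Cd μ τ w₀ v₀ ω u z ↔
      evolutionOp Cd μ (greenOp τ) (timeOp τ) hv.memLp_xx.cls =
        greenOp τ (constCls τ hv₀) + timeOp τ (greenOp τ (tensorOp τ (chi ω) (hu.toLp u)) -
          constCls τ hw₀.memLp₂) := by
  have hF := isL2L2_load (τ := τ) hω hu
  have hb : IsL2L2 τ fun t x => z.wxx t x + Cd * z.vxx t x :=
    hw.memLp_xx.add (hv.memLp_xx.const_mul Cd)
  set R : SpaceTime τ := greenOp τ hv.memLp.cls - greenOp τ (constCls τ hv₀) -
      timeOp τ (greenOp τ hF.cls - hb.cls - μ • greenOp τ hv.memLp.cls) with hR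
  have hr : IsL2L2 τ fun t x => R (t, x) := Lp.memLp R
  have hr_eq : hr.cls = R := hr.cls_eq_of_ae (EventuallyEq.refl _ _)
  have hload : ∀ s x, (ω.indicator (fun _ => u s) x : ℝ) = chi ω x * u s := by
    intro s x
    by_cases h : x ∈ ω <;> simp [chi, h]
  have hpair := fun (φ Φ : ℝ → ℝ) (hφ : IsV φ Φ) =>
    pairing_ae_eq (μ := μ) hv.memLp hF hb hv₀ hr hr_eq hφ
  have hRM : R = evolutionOp Cd μ (greenOp τ) (timeOp τ) hv.memLp_xx.cls -
      (greenOp τ (constCls τ hv₀) + timeOp τ (greenOp τ (tensorOp τ (chi ω) (hu.toLp u)) -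
          constCls τ hw₀.memLp₂)) := by
    have hb_cls : hb.cls = hw.memLp_xx.cls + Cd • hv.memLp_xx.cls := rfl
    rw [hR, hb_cls, cls_xx_of_primitive hw hv hw₀ hd, hv.cls_eq, cls_load hω hu, evolutionOp_apply]
    simp only [map_sub, map_add, map_smul]
    module
  rw [← sub_eq_zero, ← hRM]
  constructor
  · intro h
    rw [← hr_eq]
    refine cls_eq_zero_of_pairing hr fun φ Φ hφ => ?_
    filter_upwards [hpair φ Φ hφ, h.weak_eq φ Φ hφ] with t h1 h2
    rw [h1, h2]
    simp only [hload]
    ring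
  · intro h
    refine ⟨hw, hv, hd, fun φ Φ hφ => ?_⟩
    have h0 : ∀ᵐ t ∂(timeMeasure τ), ∀ᵐ x ∂spaceMeasure, R (t, x) = 0 := by
      refine Measure.ae_ae_of_ae_prod (p := fun p => R p = 0) ?_
      rw [h]
      exact Lp.coeFn_zero ℝ 2 (cylMeasure τ)
    filter_upwards [hpair φ Φ hφ, h0] with t h1 h2
    rw [integral_congr_ae (g := fun _ => 0) (by filter_upwards [h2] with x hx; rw [hx, mul_zero]),
      integral_zero] at h1
    simp only [hload]
    linarith

/-- Every solution of the operator equation is a weak solution. -/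
theorem exists_motion {ω : Set ℝ} (hω : MeasurableSet ω) (hw₀ : IsV w₀ w₀xx)
    (hv₀ : MemLp v₀ 2 spaceMeasure) {u : ℝ → ℝ} (hu : MemLp u 2 (timeMeasure τ))
    {ζ : SpaceTime τ}
    (hζ : evolutionOp Cd μ (greenOp τ) (timeOp τ) ζ =
        greenOp τ (constCls τ hv₀) + timeOp τ (greenOp τ (tensorOp τ (chi ω) (hu.toLp u)) -
          constCls τ hw₀.memLp₂)) :
    ∃ z : Motion, IsWeakSolution Cd μ τ w₀ v₀ ω u z := by
  have hf : IsL2L2 τ fun t x => ζ (t, x) := Lp.memLp ζ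
  have hf_cls : hf.cls = ζ := hf.cls_eq_of_ae (EventuallyEq.refl _ _)
  -- The fields are explicit integrals of one representative of ζ, so that the displacement relation
  -- holds at every point and not only almost everywhere.
  let z : Motion := ⟨fun t x => w₀ x + ∫ s in (0 : ℝ)..t, ∫ y in Ioo (0 : ℝ) 1, green x y * ζ (s, y),
    fun t x => w₀xx x + ∫ s in (0 : ℝ)..t, ζ (s, x),
    fun t x => ∫ y in Ioo (0 : ℝ) 1, green x y * ζ (t, y), fun t x => ζ (t, x)⟩
  refine ⟨z, (weak_eq_iff hω hw₀ hv₀ hu (z := z) (hf.isL2V_primitive hw₀) hf.isL2V_green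
    fun t _ x _ => rfl).2 ?_⟩
  rw [← hf_cls] at hζ
  exact hζ

end Solution

/-! ### The cost as a squared Hilbert norm -/

section Cost

/-- Three space-time fields, with the Hilbert sum norm. -/
abbrev Output (τ : ℝ) := WithLp 2 (SpaceTime τ × WithLp 2 (SpaceTime τ × SpaceTime τ))

/-- The observed quantities of a motion with second space derivative `a` of the displacement and
`ζ` of the velocity. -/
noncomputable def observe (κ τ : ℝ) (a ζ : SpaceTime τ) : Output τ :=
  WithLp.toLp 2 (√κ • a, WithLp.toLp 2 (greenOp τ a, greenOp τ ζ))

theorem norm_observe_sq {κ τ : ℝ} (hκ : 0 ≤ κ) (a ζ : SpaceTime τ) :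
    ‖observe κ τ a ζ‖ ^ 2 = κ * ‖a‖ ^ 2 + (‖greenOp τ a‖ ^ 2 + ‖greenOp τ ζ‖ ^ 2) := by
  rw [observe, WithLp.prod_norm_sq_eq_of_L2, WithLp.prod_norm_sq_eq_of_L2]
  change ‖√κ • a‖ ^ 2 + (‖greenOp τ a‖ ^ 2 + ‖greenOp τ ζ‖ ^ 2) = _
  rw [norm_smul, mul_pow, Real.norm_eq_abs, sq_abs, Real.sq_sqrt hκ]

theorem inner_observe {κ τ : ℝ} (hκ : 0 ≤ κ) (a ζ b ξ : SpaceTime τ) :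
    ⟪observe κ τ a ζ, observe κ τ b ξ⟫_ℝ =
      κ * ⟪a, b⟫_ℝ + (⟪greenOp τ a, greenOp τ b⟫_ℝ + ⟪greenOp τ ζ, greenOp τ ξ⟫_ℝ) := by
  rw [observe, observe, WithLp.prod_inner_apply, WithLp.prod_inner_apply]
  simp only
  rw [real_inner_smul_left, real_inner_smul_right, ← mul_assoc, Real.mul_self_sqrt hκ]

theorem observe_add {κ τ : ℝ} (a ζ b ξ : SpaceTime τ) :
    observe κ τ (a + b) (ζ + ξ) = observe κ τ a ζ + observe κ τ b ξ := by
  rw [observe, map_add, map_add, smul_add]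
  rfl

/-- The observation of the response to a change of velocity. -/
noncomputable def responseOp (κ τ : ℝ) : SpaceTime τ →L[ℝ] Output τ :=
  (WithLp.prodContinuousLinearEquiv 2 ℝ _ _).symm.toContinuousLinearMap ∘L
    ((√κ • timeOp τ).prod ((WithLp.prodContinuousLinearEquiv 2 ℝ _ _).symm.toContinuousLinearMap ∘L
      ((greenOp τ ∘L timeOp τ).prod (greenOp τ))))

theorem responseOp_apply (κ τ : ℝ) (ζ : SpaceTime τ) :
    responseOp κ τ ζ = observe κ τ (timeOp τ ζ) ζ := rfl

theorem cost_eq {κ γ τ : ℝ} (hκ : 0 ≤ κ) {u : ℝ → ℝ} (hu : MemLp u 2 (timeMeasure τ)) {z : Motion}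
    (hw : IsL2V τ z.w z.wxx) (hv : IsL2V τ z.v z.vxx) :
    cost κ γ τ u z =
      ‖observe κ τ hw.memLp_xx.cls hv.memLp_xx.cls‖ ^ 2 + γ * ‖hu.toLp u‖ ^ 2 := by
  rw [norm_observe_sq hκ, ← hw.cls_eq, ← hv.cls_eq, ← real_inner_self_eq_norm_sq,
    ← real_inner_self_eq_norm_sq, ← real_inner_self_eq_norm_sq, norm_sq_toLp]
  obtain ⟨i1, e1⟩ := hw.memLp_xx.inner_cls hw.memLp_xx
  obtain ⟨i2, e2⟩ := hw.memLp.inner_cls hw.memLp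
  obtain ⟨i3, e3⟩ := hv.memLp.inner_cls hv.memLp
  have hint : Integrable (fun p : ℝ × ℝ => κ * z.wxx p.1 p.2 ^ 2 + z.w p.1 p.2 ^ 2 +
      z.v p.1 p.2 ^ 2) (cylMeasure τ) := by
    simp only [sq]
    exact ((i1.const_mul κ).add i2).add i3
  rw [e1, e2, e3, ← integral_const_mul, ← integral_const_mul, ← add_assoc,
    ← integral_add_add (i1.const_mul κ) i2 i3, cost,
    integral_add hint.integral_prod_left]
  · congr 1
    rw [← integral_prod _ hint]
    simp only [sq]
  · exact (hu.integrable_sq).const_mul γ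

/-- The control-to-output operator of the actuator profile `g`. -/
noncomputable def controlOp (κ τ : ℝ) (Z : SpaceTime τ →L[ℝ] SpaceTime τ) (g : ℝ → ℝ) :
    Control τ →L[ℝ] Output τ :=
  responseOp κ τ ∘L Z ∘L greenOp τ ∘L tensorOp τ g

end Cost

/-! ### The adjoint equation in operator form -/

section Adjoint

variable {Cd μ τ κ : ℝ}

theorem IsTest.cls_xx {ψ ψxx ψt ψtxx ψtt : ℝ → ℝ → ℝ} (h : IsTest τ ψ ψxx ψt ψtxx ψtt) :
    h.mem.memLp_xx.cls = timeOp τ h.mem_t.memLp_xx.cls := by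
  have h1 := cls_xx_of_primitive h.mem h.mem_t isV_zero
    (fun t ht x hx => by rw [h.eq_t t ht x hx, Pi.zero_apply, zero_add])
  have h2 : constCls τ isV_zero.memLp₂ = 0 :=
    IsL2L2.cls_eq_of_ae _ (Lp.coeFn_zero ℝ 2 (cylMeasure τ))
  rw [h1, h2, zero_add]

theorem IsTest.cls {ψ ψxx ψt ψtxx ψtt : ℝ → ℝ → ℝ} (h : IsTest τ ψ ψxx ψt ψtxx ψtt) :
    h.mem.memLp.cls = timeOp τ h.mem_t.memLp.cls := by
  rw [h.mem.cls_eq, h.cls_xx, h.mem_t.cls_eq, greenOp_timeOp]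

theorem IsTest.cls_t {ψ ψxx ψt ψtxx ψtt : ℝ → ℝ → ℝ} (h : IsTest τ ψ ψxx ψt ψtxx ψtt) :
    h.mem_t.memLp.cls = timeOp τ h.mem_tt.cls := by
  rw [← h.mem_tt.cls_primitive, ← sub_eq_zero]
  have e : h.mem_t.memLp.cls - h.mem_tt.primitive.cls =
      (h.mem_t.memLp.add (h.mem_tt.primitive.const_mul (-1))).cls := by
    change _ = h.mem_t.memLp.cls + (-1 : ℝ) • h.mem_tt.primitive.cls
    module
  rw [e]
  apply Lp.ext
  refine (IsL2L2.coeFn_cls _).trans (EventuallyEq.trans ?_ (Lp.coeFn_zero ℝ 2 _).symm)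
  refine ae_eq_zero_of_ae_ae (h.mem_t.memLp.add (h.mem_tt.primitive.const_mul (-1))).1 ?_
  filter_upwards [h.eq_tt] with t ht
  filter_upwards [ht] with x hx
  change ψt t x + -1 * _ = 0
  rw [hx]
  ring

theorem inner_testOp (ξ φ q : SpaceTime τ) :
    ⟪ξ, greenOp τ q⟫_ℝ + ⟪timeOp τ φ + Cd • φ, q⟫_ℝ + ⟪μ • greenOp τ φ, greenOp τ q⟫_ℝ =
      ⟪q, greenOp τ ξ + timeOp τ φ + Cd • φ + μ • greenOp τ (greenOp τ φ)⟫_ℝ := by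
  rw [← greenOp_symm, ← greenOp_symm, map_smul, ← inner_add_left, ← inner_add_left,
    real_inner_comm, ← add_assoc]

theorem IsTest.lhs_eq {ψ ψxx ψt ψtxx ψtt p pxx : ℝ → ℝ → ℝ} (h : IsTest τ ψ ψxx ψt ψtxx ψtt)
    (hp : IsL2V τ p pxx) :
    ∫ t in Ioo (0 : ℝ) τ, ∫ x in Ioo (0 : ℝ) 1,
        (ψtt t x * p t x + (ψxx t x + Cd * ψtxx t x) * pxx t x + μ * ψt t x * p t x) =
      ⟪hp.memLp_xx.cls, greenOp τ h.mem_tt.cls + timeOp τ h.mem_t.memLp_xx.cls +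
        Cd • h.mem_t.memLp_xx.cls + μ • greenOp τ (greenOp τ h.mem_t.memLp_xx.cls)⟫_ℝ := by
  have hb := h.mem.memLp_xx.add (h.mem_t.memLp_xx.const_mul Cd)
  obtain ⟨i1, e1⟩ := h.mem_tt.inner_cls hp.memLp
  obtain ⟨i2, e2⟩ := hb.inner_cls hp.memLp_xx
  obtain ⟨i3, e3⟩ := (h.mem_t.memLp.const_mul μ).inner_cls hp.memLp
  have hi : Integrable (fun q : ℝ × ℝ => ψtt q.1 q.2 * p q.1 q.2 +
      (ψxx q.1 q.2 + Cd * ψtxx q.1 q.2) * pxx q.1 q.2 + μ * ψt q.1 q.2 * p q.1 q.2)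
      (cylMeasure τ) := (i1.add i2).add i3
  rw [← integral_prod _ hi, integral_add_add i1 i2 i3, ← e1, ← e2, ← e3, hp.cls_eq]
  have e4 : hb.cls = timeOp τ h.mem_t.memLp_xx.cls + Cd • h.mem_t.memLp_xx.cls := by
    rw [← h.cls_xx]; rfl
  have e5 : (h.mem_t.memLp.const_mul μ).cls = μ • greenOp τ h.mem_t.memLp_xx.cls := by
    rw [← h.mem_t.cls_eq]; rfl
  rw [e4, e5]
  exact inner_testOp _ _ _

/-- The right-hand side of the adjoint equation. -/
noncomputable def adjointRhs (κ : ℝ) (a w v : SpaceTime τ) : SpaceTime τ :=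
  (2 : ℝ) • (κ • (timeOp τ).adjoint a + greenOp τ ((timeOp τ).adjoint w) + greenOp τ v)

theorem inner_adjointRhs (a w v f : SpaceTime τ) :
    ⟪adjointRhs κ a w v, f⟫_ℝ =
      2 * (κ * ⟪a, timeOp τ f⟫_ℝ + ⟪w, timeOp τ (greenOp τ f)⟫_ℝ + ⟪v, greenOp τ f⟫_ℝ) := by
  rw [adjointRhs, real_inner_smul_left, inner_add_left, inner_add_left, real_inner_smul_left,
    ContinuousLinearMap.adjoint_inner_left, greenOp_symm, greenOp_symm,
    ContinuousLinearMap.adjoint_inner_left]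

theorem IsTest.rhs_eq {ψ ψxx ψt ψtxx ψtt : ℝ → ℝ → ℝ} (h : IsTest τ ψ ψxx ψt ψtxx ψtt)
    {z : Motion} (hw : IsL2V τ z.w z.wxx) (hv : IsL2V τ z.v z.vxx) :
    ∫ t in Ioo (0 : ℝ) τ, ∫ x in Ioo (0 : ℝ) 1,
        2 * (κ * z.wxx t x * ψxx t x + z.w t x * ψ t x + z.v t x * ψt t x) =
      ⟪adjointRhs κ hw.memLp_xx.cls hw.memLp.cls hv.memLp.cls, h.mem_t.memLp_xx.cls⟫_ℝ := by
  obtain ⟨i1, e1⟩ := (hw.memLp_xx.const_mul κ).inner_cls h.mem.memLp_xx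
  obtain ⟨i2, e2⟩ := hw.memLp.inner_cls h.mem.memLp
  obtain ⟨i3, e3⟩ := hv.memLp.inner_cls h.mem_t.memLp
  have hi : Integrable (fun q : ℝ × ℝ => 2 * (κ * z.wxx q.1 q.2 * ψxx q.1 q.2 +
      z.w q.1 q.2 * ψ q.1 q.2 + z.v q.1 q.2 * ψt q.1 q.2)) (cylMeasure τ) :=
    ((i1.add i2).add i3).const_mul 2
  rw [← integral_prod _ hi, integral_const_mul, integral_add_add i1 i2 i3, ← e1, ← e2, ← e3,
    inner_adjointRhs, IsL2L2.cls_const_mul, real_inner_smul_left, h.cls_xx, h.cls, h.mem_t.cls_eq]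

/-- For a test function, (ψ_txx, ψ_tt) is an admissible pair for `exists_adjoint_state`, because
both G ψ_txx and I ψ_tt equal ψ_t. The element q obtained there is p_xx, and p = Gq. -/
theorem exists_isAdjoint (hτ : 0 < τ) (hCd : 0 < Cd) (hμ : 0 ≤ μ) {z : Motion}
    (hw : IsL2V τ z.w z.wxx) (hv : IsL2V τ z.v z.vxx) :
    ∃ p pxx, IsAdjoint Cd μ τ κ z p pxx := by
  obtain ⟨q, hq⟩ := (isVolterraPair hτ).exists_adjoint_state hCd hμ
    (adjointRhs κ hw.memLp_xx.cls hw.memLp.cls hv.memLp.cls)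
  have hf : IsL2L2 τ fun t x => q (t, x) := Lp.memLp q
  have hf_cls : hf.cls = q := hf.cls_eq_of_ae (EventuallyEq.refl _ _)
  refine ⟨_, _, hf.isL2V_green, fun ψ ψxx ψt ψtxx ψtt h => ?_⟩
  rw [h.lhs_eq hf.isL2V_green, h.rhs_eq hw hv, ← hq _ h.mem_tt.cls
    (by rw [← h.mem_t.cls_eq, h.cls_t])]
  exact congrArg (⟪·, _⟫_ℝ) hf_cls

/-- The adjoint equation, tested with the twice integrated field. -/
theorem IsAdjoint.operator_eq {z : Motion} {p pxx : ℝ → ℝ → ℝ} (h : IsAdjoint Cd μ τ κ z p pxx)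
    (hw : IsL2V τ z.w z.wxx) (hv : IsL2V τ z.v z.vxx) (α : SpaceTime τ) :
    ⟪h.mem.memLp_xx.cls, evolutionOp Cd μ (greenOp τ) (timeOp τ) α⟫_ℝ =
      ⟪adjointRhs κ hw.memLp_xx.cls hw.memLp.cls hv.memLp.cls, timeOp τ α⟫_ℝ := by
  have hf : IsL2L2 τ fun t x => α (t, x) := Lp.memLp α
  have hf_cls : hf.cls = α := hf.cls_eq_of_ae (EventuallyEq.refl _ _)
  have hT := hf.primitive
  -- The test function has ψ_txx = Iα and ψ_tt = Gα. With this choice the test operator equals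
  -- `evolutionOp` applied to α.
  have htest : IsTest τ (fun t x => (0 : ℝ → ℝ) x +
        ∫ s in (0 : ℝ)..t, ∫ y in Ioo (0 : ℝ) 1, green x y * ∫ r in (0 : ℝ)..s, α (r, y))
      (fun t x => (0 : ℝ → ℝ) x + ∫ s in (0 : ℝ)..t, ∫ r in (0 : ℝ)..s, α (r, x))
      (fun t x => ∫ y in Ioo (0 : ℝ) 1, green x y * ∫ s in (0 : ℝ)..t, α (s, y))
      (fun t x => ∫ s in (0 : ℝ)..t, α (s, x))
      (fun t x => ∫ y in Ioo (0 : ℝ) 1, green x y * α (t, y)) := by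
    refine ⟨hT.isL2V_primitive isV_zero, hT.isL2V_green, hf.green, fun t _ x _ => ?_, ?_⟩
    · rw [Pi.zero_apply, zero_add]
    · filter_upwards [ae_time_mem τ] with t ht
      filter_upwards [ae_space_mem] with x hx
      exact integral_mul_primitive (Ioo_subset_Icc_self ht) hf
        (memLp_green_left (Ioo_subset_Icc_self hx))
  have h1 := h.eq _ _ _ _ _ htest
  rw [htest.lhs_eq h.mem, htest.rhs_eq hw hv] at h1
  have e1 : htest.mem_t.memLp_xx.cls = timeOp τ α := hf.cls_primitive.trans (congrArg _ hf_cls)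
  have e2 : htest.mem_tt.cls = greenOp τ α := hf.cls_green.trans (congrArg _ hf_cls)
  rw [e1, e2] at h1
  rw [← h1, evolutionOp_apply, greenOp_timeOp, greenOp_timeOp]
  congr 1
  abel

end Adjoint

/-! ### Reduction to a linear quadratic problem and existence of optimal controls -/

section Reduced

variable {Cd μ γ τ κ : ℝ} {w₀ w₀xx v₀ : ℝ → ℝ}

/-- The output of the uncontrolled motion whose velocity has second space derivative `ζ`. -/
noncomputable def freeOutput (κ τ : ℝ) (a ζ : SpaceTime τ) : Output τ :=
  observe κ τ (a + timeOp τ ζ) ζ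

theorem observe_solution (hτ : 0 < τ) (hCd : 0 < Cd) (hμ : 0 ≤ μ) (hw₀ : IsV w₀ w₀xx)
    (hv₀ : MemLp v₀ 2 spaceMeasure) {Z : SpaceTime τ →L[ℝ] SpaceTime τ}
    (hZ : ∀ f, evolutionOp Cd μ (greenOp τ) (timeOp τ) (Z f) = timeOp τ f) {ζ₀ : SpaceTime τ}
    (hζ₀ : evolutionOp Cd μ (greenOp τ) (timeOp τ) ζ₀ =
      greenOp τ (constCls τ hv₀) - timeOp τ (constCls τ hw₀.memLp₂))
    {ω : Set ℝ} (hω : MeasurableSet ω) {u : ℝ → ℝ} (hu : MemLp u 2 (timeMeasure τ)) {z : Motion}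
    (hz : IsWeakSolution Cd μ τ w₀ v₀ ω u z) :
    observe κ τ hz.disp_mem.memLp_xx.cls hz.vel_mem.memLp_xx.cls =
      freeOutput κ τ (constCls τ hw₀.memLp₂) ζ₀ + controlOp κ τ Z (chi ω) (hu.toLp u) := by
  have h1 := (weak_eq_iff hω hw₀ hv₀ hu hz.disp_mem hz.vel_mem hz.disp_eq).1 hz
  set f := greenOp τ (tensorOp τ (chi ω) (hu.toLp u)) with hf
  -- Both sides solve the same operator equation, and injectivity gives uniqueness of the weak
  -- solution.
  have h2 : hz.vel_mem.memLp_xx.cls = ζ₀ + Z f := by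
    rw [← sub_eq_zero]
    apply (isVolterraPair hτ).injective hCd hμ
    rw [map_sub, map_add, h1, hζ₀, hZ, map_sub]
    abel
  rw [cls_xx_of_primitive hz.disp_mem hz.vel_mem hw₀ hz.disp_eq, h2, map_add, ← add_assoc,
    observe_add]
  rfl

/-- The operator `Z` and the free part ζ₀ are independent of ω, so different actuators can be
compared inside one family of quadratic problems in which only `chi ω` varies. -/
theorem costSet_eq (hτ : 0 < τ) (hCd : 0 < Cd) (hμ : 0 ≤ μ) (hκ : 0 ≤ κ) (hw₀ : IsV w₀ w₀xx)
    (hv₀ : MemLp v₀ 2 spaceMeasure) {Z : SpaceTime τ →L[ℝ] SpaceTime τ}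
    (hZ : ∀ f, evolutionOp Cd μ (greenOp τ) (timeOp τ) (Z f) = timeOp τ f) {ζ₀ : SpaceTime τ}
    (hζ₀ : evolutionOp Cd μ (greenOp τ) (timeOp τ) ζ₀ =
      greenOp τ (constCls τ hv₀) - timeOp τ (constCls τ hw₀.memLp₂))
    {ω : Set ℝ} (hω : MeasurableSet ω) :
    costSet Cd μ γ τ κ w₀ v₀ ω = range (lqCost γ (freeOutput κ τ (constCls τ hw₀.memLp₂) ζ₀)
      (controlOp κ τ Z (chi ω))) := by
  ext c
  constructor
  · rintro ⟨u, z, hu, hz, rfl⟩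
    refine ⟨hu.toLp u, ?_⟩
    rw [cost_eq hκ hu hz.disp_mem hz.vel_mem,
      observe_solution hτ hCd hμ hw₀ hv₀ hZ hζ₀ hω hu hz, lqCost]
  · rintro ⟨u, rfl⟩
    have hu := Lp.memLp u
    obtain ⟨z, hz⟩ := exists_motion (Cd := Cd) (μ := μ) hω hw₀ hv₀ hu
      (ζ := ζ₀ + Z (greenOp τ (tensorOp τ (chi ω) (hu.toLp u)))) (by
        rw [map_add, hζ₀, hZ, map_sub]; abel)
    refine ⟨u, z, hu, hz, ?_⟩
    rw [cost_eq hκ hu hz.disp_mem hz.vel_mem,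
      observe_solution hτ hCd hμ hw₀ hv₀ hZ hζ₀ hω hu hz, lqCost, Lp.toLp_coeFn]

theorem exists_reduction (hτ : 0 < τ) (hCd : 0 < Cd) (hμ : 0 ≤ μ) (hw₀ : IsV w₀ w₀xx)
    (hv₀ : MemLp v₀ 2 spaceMeasure) :
    ∃ (Z : SpaceTime τ →L[ℝ] SpaceTime τ) (ζ₀ : SpaceTime τ),
      (∀ f, evolutionOp Cd μ (greenOp τ) (timeOp τ) (Z f) = timeOp τ f) ∧
      evolutionOp Cd μ (greenOp τ) (timeOp τ) ζ₀ =
        greenOp τ (constCls τ hv₀) - timeOp τ (constCls τ hw₀.memLp₂) := by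
  obtain ⟨Z, hZ⟩ := (isVolterraPair hτ).exists_solutionOp hCd hμ
  obtain ⟨ζ, hζ⟩ := (isVolterraPair hτ).exists_initial hCd hμ (constCls τ hv₀)
    (timeOp_add_adjoint_const hτ hv₀)
  exact ⟨Z, ζ - Z (constCls τ hw₀.memLp₂), hZ, by rw [map_sub, hζ, hZ]⟩

theorem exists_optimal (hτ : 0 < τ) (hCd : 0 < Cd) (hμ : 0 ≤ μ) (hγ : 0 < γ) (hκ : 0 ≤ κ)
    (hw₀ : IsV w₀ w₀xx) (hv₀ : MemLp v₀ 2 spaceMeasure) {ω : Set ℝ} (hω : MeasurableSet ω) :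
    ∃ u z, IsOptimal Cd μ γ τ κ w₀ v₀ ω u z := by
  obtain ⟨Z, ζ₀, hZ, hζ₀⟩ := exists_reduction (Cd := Cd) (μ := μ) hτ hCd hμ hw₀ hv₀
  have hset := costSet_eq (γ := γ) hτ hCd hμ hκ hw₀ hv₀ hZ hζ₀ hω
  obtain ⟨k, hk⟩ := exists_lq_minimizer hγ (freeOutput κ τ (constCls τ hw₀.memLp₂) ζ₀)
    (controlOp κ τ Z (chi ω))
  have hmem : lqCost γ (freeOutput κ τ (constCls τ hw₀.memLp₂) ζ₀) (controlOp κ τ Z (chi ω)) k ∈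
      costSet Cd μ γ τ κ w₀ v₀ ω := hset ▸ mem_range_self k
  obtain ⟨u, z, hu, hz, hc⟩ := hmem
  refine ⟨u, z, hu, hz, ⟨u, z, hu, hz, rfl⟩, ?_⟩
  rw [← hc, hset]
  rintro _ ⟨j, rfl⟩
  exact hk j

end Reduced

/-! ### Asymptotics of the optimal cost for small changes of the actuator -/

section Sensitivity

theorem integral_green_chi {B : Set ℝ} (hB : MeasurableSet B) (hsub : B ⊆ Ioo 0 1) (x : ℝ) :
    ∫ y in Ioo (0 : ℝ) 1, green x y * chi B y = ∫ y in B, green x y := by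
  have : ∀ y, green x y * chi B y = B.indicator (green x) y := by
    intro y
    by_cases h : y ∈ B <;> simp [chi, h]
  simp_rw [this]
  rw [integral_indicator hB, Measure.restrict_restrict hB, inter_eq_self_of_subset_left hsub]

theorem abs_integral_green_sub_le {B : Set ℝ} (hB : MeasurableSet B) (hsub : B ⊆ Ioo 0 1)
    {η ε : ℝ} (hBε : B ⊆ Metric.closedBall η ε) {x : ℝ} (hx : x ∈ Icc (0 : ℝ) 1) :
    |(∫ y in B, green x y) - volume.real B * green η x| ≤ ε * volume.real B := by
  have hfin : volume B < ⊤ := (measure_mono hsub).trans_lt (by simp)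
  have hi : IntegrableOn (green x) B :=
    ((continuous_green_left x).integrableOn_Icc (a := 0) (b := 1)).mono_set
      (hsub.trans Ioo_subset_Icc_self)
  have hc : IntegrableOn (fun _ => green η x) B := integrableOn_const hfin.ne
  have e : (∫ y in B, green x y) - volume.real B * green η x =
      ∫ y in B, (green x y - green η x) := by
    rw [integral_sub hi hc, setIntegral_const, smul_eq_mul]
  rw [e]
  refine norm_setIntegral_le_of_norm_le_const (f := fun y => green x y - green η x) hfin
    fun y hy => ?_
  rw [green_comm x y]
  exact (abs_green_sub_le hx).trans (by simpa [Real.dist_eq] using hBε hy)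

theorem abs_integral_green_le {B : Set ℝ} (hsub : B ⊆ Ioo 0 1)
    {x : ℝ} (hx : x ∈ Icc (0 : ℝ) 1) : |∫ y in B, green x y| ≤ volume.real B := by
  have hfin : volume B < ⊤ := (measure_mono hsub).trans_lt (by simp)
  have := norm_setIntegral_le_of_norm_le_const (f := green x) (C := 1) hfin fun y hy =>
    abs_green_le hx (Ioo_subset_Icc_self (hsub hy))
  simpa using this

/-- The L² norm of the indicator of B is only √|B|, which would leave a remainder of order |B|. Its
potential is of order |B|, so the quadratic remainder is of order |B|² and is negligible after
division by |B|. -/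
theorem norm_tensorOp_potential_le {τ : ℝ} {B : Set ℝ} (hB : MeasurableSet B) (hsub : B ⊆ Ioo 0 1)
    {η ε : ℝ} (hε : 0 ≤ ε) (hη : η ∈ Icc (0 : ℝ) 1) (hBε : B ⊆ Metric.closedBall η ε) :
    ‖greenOp τ ∘L tensorOp τ (chi B)‖ ≤ volume.real B ∧
    ‖greenOp τ ∘L tensorOp τ (chi B) - volume.real B • tensorOp τ (green η)‖ ≤
      ε * volume.real B := by
  have hkm : AEStronglyMeasurable (fun x => ∫ y in B, green x y) spaceMeasure :=
    (continuous_green.stronglyMeasurable.integral_prod_right'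
      (ν := volume.restrict B)).aestronglyMeasurable
  have hkb : ∀ᵐ x ∂spaceMeasure, ‖∫ y in B, green x y‖ ≤ volume.real B := by
    filter_upwards [ae_space_mem] with x hx
    exact abs_integral_green_le hsub (Ioo_subset_Icc_self hx)
  have hgm : AEStronglyMeasurable (green η) spaceMeasure :=
    (continuous_green_left η).aestronglyMeasurable
  have hgb : ∀ᵐ x ∂spaceMeasure, ‖green η x‖ ≤ 1 := by
    filter_upwards [ae_space_mem] with x hx
    exact abs_green_le hη (Ioo_subset_Icc_self hx)
  have e : greenOp τ ∘L tensorOp τ (chi B) = tensorOp τ fun x => ∫ y in B, green x y := by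
    ext1 u
    exact greenOp_tensorOp (chi_measurable hB) (ae_of_all _ (norm_chi_le B))
      (fun x _ => (integral_green_chi hB hsub x).symm) hkm hkb u
  refine ⟨e ▸ norm_tensorOp_le hkm measureReal_nonneg hkb, ?_⟩
  have hgb' : ∀ᵐ x ∂spaceMeasure, ‖-volume.real B * green η x‖ ≤ ‖-volume.real B‖ * 1 := by
    filter_upwards [hgb] with x hx
    rw [norm_mul]; gcongr
  have e2 : greenOp τ ∘L tensorOp τ (chi B) - volume.real B • tensorOp τ (green η) =
      tensorOp τ fun x => (∫ y in B, green x y) + -volume.real B * green η x := by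
    rw [e, tensorOp_add hkm (hgm.const_mul _) hkb hgb', tensorOp_smul hgm hgb, neg_smul,
      sub_eq_add_neg]
  rw [e2]
  refine norm_tensorOp_le (hkm.add (hgm.const_mul _)) (by positivity) ?_
  filter_upwards [ae_space_mem] with x hx
  change |(∫ y in B, green x y) + -volume.real B * green η x| ≤ _
  rw [neg_mul, ← sub_eq_add_neg]
  exact abs_integral_green_sub_le hB hsub hBε (Ioo_subset_Icc_self hx)

variable {Cd μ γ τ κ : ℝ} {w₀ w₀xx v₀ : ℝ → ℝ}

/-- The pairing of the optimal control with the adjoint state at a point. -/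
theorem integral_control_adjoint {u : ℝ → ℝ} (hu : MemLp u 2 (timeMeasure τ))
    {p pxx : ℝ → ℝ → ℝ} (hp : IsL2V τ p pxx) (hτ : 0 < τ) {η : ℝ} (hη : η ∈ Icc (0 : ℝ) 1) :
    IntervalIntegrable (fun s => u s * p s η) volume 0 τ ∧
    ⟪hp.memLp_xx.cls, tensorOp τ (green η) (hu.toLp u)⟫_ℝ = ∫ s in (0 : ℝ)..τ, u s * p s η := by
  have hgb : ∀ᵐ x ∂spaceMeasure, ‖green η x‖ ≤ 1 := by
    filter_upwards [ae_space_mem] with x hx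
    exact abs_green_le hη (Ioo_subset_Icc_self hx)
  obtain ⟨h1, h2⟩ := inner_tensorOp (continuous_green_left η).aestronglyMeasurable hgb hu
    hp.memLp_xx
  have h3 : (fun t => u t * ∫ x in Ioo (0 : ℝ) 1, green η x * Function.uncurry pxx (t, x))
      =ᵐ[timeMeasure τ] fun t => u t * p t η := by
    filter_upwards [hp.section_mem] with t ht
    rw [(isV_iff.1 ht).2 η hη]
    rfl
  constructor
  · rw [intervalIntegrable_iff_integrableOn_Ioo_of_le hτ.le]
    exact h1.congr h3
  · rw [intervalIntegral.integral_of_le hτ.le, integral_Ioc_eq_integral_Ioo]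
    exact h2.trans (integral_congr_ae h3)

theorem abs_sub_le_of_expansion {x s b d e ε k K : ℝ} (hs : |s| ≤ 1) (hk : 0 ≤ k) (hb : 0 ≤ b)
    (hε : 0 ≤ ε) (hK : 0 ≤ K) (h1 : |x - s * e| ≤ K * b ^ 2) (h2 : |e - b * d| ≤ k * (b * ε)) :
    |x - b * (s * d)| ≤ (k + K) * b * (ε + b) := by
  have h3 : |s * (e - b * d)| ≤ k * (b * ε) := by
    rw [abs_mul]
    calc |s| * |e - b * d| ≤ 1 * (k * (b * ε)) := by gcongr
      _ = _ := one_mul _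
  have h4 : x - b * (s * d) = (x - s * e) + s * (e - b * d) := by ring
  rw [h4]
  refine (abs_add_le _ _).trans ((add_le_add h1 h3).trans ?_)
  have h5 : 0 ≤ k * (b * b) := by positivity
  have h6 : 0 ≤ K * (b * ε) := by positivity
  nlinarith

set_option maxHeartbeats 2000000 in
/-- First order expansion of the optimal cost under a small change of the actuator. -/
theorem exists_cost_expansion (hτ : 0 < τ) (hCd : 0 < Cd) (hμ : 0 ≤ μ) (hγ : 0 < γ) (hκ : 0 ≤ κ)
    (hw₀ : IsV w₀ w₀xx) (hv₀ : MemLp v₀ 2 spaceMeasure) {ω : Set ℝ} (hω : MeasurableSet ω)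
    {u : ℝ → ℝ} {z : Motion} {p pxx : ℝ → ℝ → ℝ} (hu : IsOptimal Cd μ γ τ κ w₀ v₀ ω u z)
    (hp : IsAdjoint Cd μ τ κ z p pxx) {η : ℝ} (hη : η ∈ Icc (0 : ℝ) 1) :
    ∃ K : ℝ, ∀ (ε s : ℝ) (B ω' : Set ℝ), 0 ≤ ε → |s| ≤ 1 → MeasurableSet B → B ⊆ Ioo 0 1 →
      B ⊆ Metric.closedBall η ε → MeasurableSet ω' → (∀ x, chi ω' x = chi ω x + s * chi B x) →
      |J₁ Cd μ γ τ κ w₀ v₀ ω' - J₁ Cd μ γ τ κ w₀ v₀ ω -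
        volume.real B * (s * ∫ t in (0 : ℝ)..τ, u t * p t η)| ≤
        K * volume.real B * (ε + volume.real B) := by
  obtain ⟨Z, ζ₀, hZ, hζ₀⟩ := exists_reduction (Cd := Cd) (μ := μ) hτ hCd hμ hw₀ hv₀
  have hset := fun (ω : Set ℝ) (hω : MeasurableSet ω) =>
    costSet_eq (γ := γ) hτ hCd hμ hκ hw₀ hv₀ hZ hζ₀ hω
  set y₀ := freeOutput κ τ (constCls τ hw₀.memLp₂) ζ₀ with hy₀
  set L := controlOp κ τ Z (chi ω) with hL
  set k := hu.control_mem.toLp u with hk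
  have hz := hu.solution
  have hobs := observe_solution (κ := κ) hτ hCd hμ hw₀ hv₀ hZ hζ₀ hω hu.control_mem hz
  have hcost : cost κ γ τ u z = lqCost γ y₀ L k := by
    rw [cost_eq hκ hu.control_mem hz.disp_mem hz.vel_mem, hobs, lqCost]
  have hmin : ∀ j, lqCost γ y₀ L k ≤ lqCost γ y₀ L j := by
    intro j
    rw [← hcost]
    exact hu.least.2 (by rw [hset ω hω]; exact mem_range_self j)
  have hJ : J₁ Cd μ γ τ κ w₀ v₀ ω = lqCost γ y₀ L k := by
    rw [J₁, hu.least.csInf_eq, hcost]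
  set q := hp.mem.memLp_xx.cls with hq
  -- The factor 2 of the adjoint right-hand side is the factor 2 in the derivative of the squared
  -- output norm.
  have hdual : ∀ f, ⟪q, f⟫_ℝ = 2 * ⟪y₀ + L k, responseOp κ τ (Z f)⟫_ℝ := by
    intro f
    rw [(isVolterraPair hτ).adjoint_duality hCd hμ hZ
      (hp.operator_eq hz.disp_mem hz.vel_mem) f, inner_adjointRhs, ← hobs, responseOp_apply,
      inner_observe hκ, ← hz.disp_mem.cls_eq, ← hz.vel_mem.cls_eq, greenOp_timeOp, add_assoc]
  obtain ⟨-, hpair⟩ := integral_control_adjoint hu.control_mem hp.mem hτ hη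
  rw [← hpair]
  set d := ⟪q, tensorOp τ (green η) k⟫_ℝ with hd
  set A := ‖responseOp κ τ ∘L Z‖ with hA
  set c := ‖k‖ ^ 2 + ‖y₀ + L k‖ ^ 2 / γ with hc
  have hc0 : 0 ≤ c := by positivity
  -- The first summand bounds the error of replacing the potential of B by |B| times Green's
  -- function at η; the second bounds the quadratic remainder of the optimal value.
  refine ⟨‖q‖ * ‖k‖ + A ^ 2 * c, fun ε s B ω' hε hs hB hsub hBε hω' hchi => ?_⟩
  obtain ⟨hn1, hn2⟩ := norm_tensorOp_potential_le (τ := τ) hB hsub hε hη hBε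
  set b := volume.real B with hb
  have hb0 : 0 ≤ b := measureReal_nonneg
  set D : Control τ →L[ℝ] Output τ := s • (responseOp κ τ ∘L Z ∘L greenOp τ ∘L tensorOp τ (chi B))
    with hD
  have hL' : controlOp κ τ Z (chi ω') = L + D := by
    have e1 : chi ω' = fun x => chi ω x + s * chi B x := funext hchi
    have hsb : ∀ᵐ x ∂spaceMeasure, ‖s * chi B x‖ ≤ ‖s‖ * 1 := by
      filter_upwards with x
      rw [norm_mul]
      gcongr
      exact norm_chi_le B x
    have e2 : tensorOp τ (chi ω') = tensorOp τ (chi ω) + s • tensorOp τ (chi B) := by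
      rw [e1, tensorOp_add (chi_measurable hω) ((chi_measurable hB).const_mul s)
        (ae_of_all _ (norm_chi_le ω)) hsb,
        tensorOp_smul (chi_measurable hB) (ae_of_all _ (norm_chi_le B))]
    rw [controlOp, e2, hL, hD, controlOp]
    simp only [ContinuousLinearMap.comp_add, ContinuousLinearMap.comp_smul]
  have hDn : ‖D‖ ≤ A * b := by
    rw [hD, norm_smul, Real.norm_eq_abs]
    have h1 : ‖responseOp κ τ ∘L Z ∘L greenOp τ ∘L tensorOp τ (chi B)‖ ≤ A * b := by
      have := ContinuousLinearMap.opNorm_comp_le (responseOp κ τ ∘L Z)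
        (greenOp τ ∘L tensorOp τ (chi B))
      exact this.trans (by gcongr)
    calc |s| * _ ≤ 1 * (A * b) := by gcongr
      _ = _ := one_mul _
  have hDn2 : ‖D‖ ^ 2 ≤ A ^ 2 * b ^ 2 := by
    rw [← mul_pow]; gcongr
  have hlin : 2 * ⟪y₀ + L k, D k⟫_ℝ = s * ⟪q, greenOp τ (tensorOp τ (chi B) k)⟫_ℝ := by
    rw [hdual, hD]
    simp only [smul_apply, ContinuousLinearMap.comp_apply, real_inner_smul_right]
    ring
  have herr : |⟪q, greenOp τ (tensorOp τ (chi B) k)⟫_ℝ - b * d| ≤ ‖q‖ * ‖k‖ * (b * ε) := by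
    rw [hd, ← real_inner_smul_right, ← inner_sub_right]
    refine (abs_real_inner_le_norm _ _).trans ?_
    have := (greenOp τ ∘L tensorOp τ (chi B) - b • tensorOp τ (green η)).le_opNorm k
    have h2 : ‖greenOp τ (tensorOp τ (chi B) k) - b • tensorOp τ (green η) k‖ ≤
        ε * b * ‖k‖ := this.trans (by gcongr)
    calc _ ≤ ‖q‖ * (ε * b * ‖k‖) := by gcongr
      _ = _ := by ring
  have hval : |J₁ Cd μ γ τ κ w₀ v₀ ω' - lqCost γ y₀ L k - 2 * ⟪y₀ + L k, D k⟫_ℝ| ≤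
      A ^ 2 * c * b ^ 2 := by
    rw [J₁, hset ω' hω', hL']
    exact (abs_lq_value_sub_le hγ D hmin).trans
      ((mul_le_mul_of_nonneg_right hDn2 hc0).trans_eq (by ring))
  rw [hJ]
  rw [hlin] at hval
  exact abs_sub_le_of_expansion hs (by positivity) hb0 hε (by positivity) hval herr

/-- A first order expansion of a shape functional yields a topological derivative. -/
theorem tendsto_of_expansion {j : ℝ → ℝ} {b : ℝ → ℝ} {j₀ K d : ℝ} (hb : ∀ ε, 0 < ε → b ε = 2 * ε)
    (h : ∀ᶠ ε in 𝓝[>] (0 : ℝ), |j ε - j₀ - b ε * d| ≤ K * b ε * (ε + b ε)) :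
    Tendsto (fun ε => (j ε - j₀) / b ε) (𝓝[>] 0) (𝓝 d) := by
  rw [tendsto_iff_norm_sub_tendsto_zero]
  -- With b = 2ε the factor ε + b of the error bound is 3ε.
  have hlim : Tendsto (fun ε : ℝ => K * (3 * ε)) (𝓝[>] 0) (𝓝 0) := by
    have : Tendsto (fun ε : ℝ => K * (3 * ε)) (𝓝 0) (𝓝 (K * (3 * 0))) := by
      apply Continuous.tendsto; fun_prop
    simpa using this.mono_left nhdsWithin_le_nhds
  refine squeeze_zero' (Eventually.of_forall fun _ => norm_nonneg _) ?_ hlim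
  filter_upwards [h, self_mem_nhdsWithin] with ε hε hpos
  have hpos' : 0 < ε := hpos
  have hbpos : 0 < b ε := by rw [hb ε hpos']; linarith
  have e : (j ε - j₀) / b ε - d = (j ε - j₀ - b ε * d) / b ε := by field_simp
  rw [e, Real.norm_eq_abs, abs_div, abs_of_pos hbpos, div_le_iff₀ hbpos]
  refine hε.trans (le_of_eq ?_)
  rw [hb ε hpos']
  ring

end Sensitivity

end Beam

/-! ### The main theorem -/

theorem mainTheorem2 (Cd μ γ τ κ : ℝ) (hCd : 0 < Cd) (hμ : 0 ≤ μ) (hγ : 0 < γ) (hτ : 0 < τ)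
    (hκ : 0 ≤ κ) (w₀ w₀xx v₀ : ℝ → ℝ) (hw₀ : Beam.IsV w₀ w₀xx)
    (hv₀ : MemLp v₀ 2 Beam.spaceMeasure) (ω : Set ℝ) (hω : IsOpen ω) (hω_sub : ω ⊆ Icc 0 1) :
    (∃ (u : ℝ → ℝ) (z : Beam.Motion) (p pxx : ℝ → ℝ → ℝ),
      Beam.IsOptimal Cd μ γ τ κ w₀ v₀ ω u z ∧ Beam.IsAdjoint Cd μ τ κ z p pxx) ∧
    ∀ (u : ℝ → ℝ) (z : Beam.Motion) (p pxx : ℝ → ℝ → ℝ),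
      Beam.IsOptimal Cd μ γ τ κ w₀ v₀ ω u z → Beam.IsAdjoint Cd μ τ κ z p pxx →
      ∀ η₀ ∈ Ioo (0 : ℝ) 1 \ frontier ω,
        IntervalIntegrable (fun s => u s * p s η₀) volume 0 τ ∧
        (η₀ ∈ ω → Beam.HasTopologicalDerivAt (Beam.J₁ Cd μ γ τ κ w₀ v₀) ω η₀
          (-∫ s in (0 : ℝ)..τ, u s * p s η₀)) ∧
        (η₀ ∉ ω → Beam.HasTopologicalDerivAt (Beam.J₁ Cd μ γ τ κ w₀ v₀) ω η₀
          (∫ s in (0 : ℝ)..τ, u s * p s η₀)) := by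
  constructor
  · obtain ⟨u, z, hu⟩ := Beam.exists_optimal (Cd := Cd) (μ := μ) hτ hCd hμ hγ hκ hw₀ hv₀ hω.measurableSet
    obtain ⟨p, pxx, hp⟩ := Beam.exists_isAdjoint (κ := κ) hτ hCd hμ hu.solution.disp_mem
      hu.solution.vel_mem
    exact ⟨u, z, p, pxx, hu, hp⟩
  · intro u z p pxx hu hp η hη
    have hη1 := Ioo_subset_Icc_self hη.1
    obtain ⟨K, hK⟩ := Beam.exists_cost_expansion hτ hCd hμ hγ hκ hw₀ hv₀ hω.measurableSet hu hp hη1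
    refine ⟨(Beam.integral_control_adjoint hu.control_mem hp.mem hτ hη1).1, fun hmem => ⟨fun _ => ?_,
      fun hn => absurd (subset_closure hmem) hn⟩, fun hmem => ⟨fun h => absurd h hmem, fun hn => ?_⟩⟩
    · refine Beam.tendsto_of_expansion (K := K) (fun ε hε => ?_) ?_
      · rw [Real.volume_real_closedBall hε.le]
      -- Once the ball lies inside ω, removing it subtracts its indicator exactly, so the expansion
      -- applies with s = -1.
      · have h1 : ∀ᶠ ε in 𝓝[>] (0 : ℝ), Metric.closedBall η ε ⊆ ω ∩ Ioo 0 1 :=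
          nhdsWithin_le_nhds (eventually_closedBall_subset
            ((hω.inter isOpen_Ioo).mem_nhds ⟨hmem, hη.1⟩))
        filter_upwards [h1, self_mem_nhdsWithin] with ε h2 h3
        have h4 := hK ε (-1) (Metric.closedBall η ε) (ω \ Metric.closedBall η ε) (le_of_lt h3)
          (by simp) Metric.isClosed_closedBall.measurableSet (h2.trans inter_subset_right)
          subset_rfl (hω.measurableSet.diff Metric.isClosed_closedBall.measurableSet) (by
            intro x
            by_cases hx : x ∈ Metric.closedBall η ε
            · have := (h2 hx).1
              simp [Beam.chi, hx, this, -Metric.mem_closedBall]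
            · by_cases hx' : x ∈ ω <;> simp [Beam.chi, hx, hx', -Metric.mem_closedBall])
        rwa [neg_one_mul] at h4
    · refine Beam.tendsto_of_expansion (K := K) (fun ε hε => ?_) ?_
      · rw [Real.volume_real_ball hε.le]
      -- Once the ball is disjoint from ω, adding it adds its indicator exactly, so s = 1.
      · have h1 : ∀ᶠ ε in 𝓝[>] (0 : ℝ), Metric.closedBall η ε ⊆ (closure ω)ᶜ ∩ Ioo 0 1 :=
          nhdsWithin_le_nhds (eventually_closedBall_subset
            ((isClosed_closure.isOpen_compl.inter isOpen_Ioo).mem_nhds ⟨hn, hη.1⟩))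
        filter_upwards [h1, self_mem_nhdsWithin] with ε h2 h3
        have h5 := Metric.ball_subset_closedBall.trans h2
        have h4 := hK ε 1 (Metric.ball η ε) (ω ∪ Metric.ball η ε) (le_of_lt h3)
          (by simp) Metric.isOpen_ball.measurableSet (h5.trans inter_subset_right)
          Metric.ball_subset_closedBall (hω.measurableSet.union Metric.isOpen_ball.measurableSet) (by
            intro x
            by_cases hx : x ∈ Metric.ball η ε
            · have : x ∉ ω := fun h => (h5 hx).1 (subset_closure h)
              simp [Beam.chi, hx, this, -Metric.mem_ball]
            · by_cases hx' : x ∈ ω <;> simp [Beam.chi, hx, hx', -Metric.mem_ball])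
        rwa [one_mul] at h4
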